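/- Let $d_x,d_y\ge 1$ be integers and $d=d_x+d_y$. Let $(X_1,Y_1),(X_2,Y_2),\dots$ be i.i.d. random vectors in $\mathbb R^{d_x}\times\mathbb R^{d_y}$ with joint probability density $f\ge 0$, and put $f_X(x)=\int f(x,y)\,dy$ and $f_Y(y)=\int f(x,y)\,dx$. For a function $g$ on $\mathbb R^m$ and $C\in\mathbb R$ let $S(g,C)$ be the set of points at which it fails that $g$ is twice continuously differentiable in a neighbourhood and its Hessian satisfies $\|H_g\|_2<C$ (spectral norm). Let $\mathcal H^{s}$ denote $s$-dimensional Hausdorff measure. Assume that there are finite constants $C_a,\dots,C_h$ and $C_0>0$ such that (a) $f\le C_a$ almost everywhere; (b) for some $\gamma>0$, $\int f\,|\log f|^{1+\gamma}\,dx\,dy\le C_b$; (c) $\int f\,e^{-bf}\,dx\,dy\le C_c\,e^{-C_0 b}$ for all $b>1$; (d) almost everywhere, $f$ is twice continuously differentiable with $\|H_f\|_2<C_d$, i.e. $S(f,C_d)$ is a null set; (e) the conditional densities satisfy $f(x,y)/f_X(x)<C_e$ and $f(x,y)/f_Y(y)<C_e$ almost everywhere (with $0/0=0$); (f) $f_X<C_f$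 and $f_Y<C_f$ almost everywhere; (g) $\mathcal H^{d-1}(S(f,C_d))\le C_g$; (h) $\mathcal H^{d_x-1}(S(f_X,C_d))\le C_h$ and $\mathcal H^{d_y-1}(S(f_Y,C_d))\le C_h$. For $p\in\{2,\infty\}$, an integer $k\ge1$ and the sample $(X_i,Y_i)_{1\le i\le N}$ with $N>k$, let $\rho_{k,i,p}$ be the $\ell_p$ distance in $\mathbb R^d$ from $(X_i,Y_i)$ to its $k$-th nearest neighbour among the other sample points, and let $n_{x,i,p}=\#\{j\ne i:\|X_j-X_i\|_p\le\rho_{k,i,p}\}$, $n_{y,i,p}=\#\{j\ne i:\|Y_j-Y_i\|_p\le\rho_{k,i,p}\}$. Let $\psi=\Gamma'/\Gamma$, $c_{m}=\pi^{m/2}/\Gamma(m/2+1)$ and, for $\delta>0$, $a_N=\big((\log N)^{1+\delta}/N\big)^{1/d}$. The truncated estimators are $$\widehat I_{\rm tKSG}=\frac1N\sum_{i=1}^N \mathbf 1\{\rho_{k,i,\infty}\le a_N\}\big(\psi(k)+\log N-\psi(n_{x,i,\infty}+1)-\psi(n_{y,i,\infty}+1)\big),$$ $$\widehat I_{\rm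 tBI\text{-}KSG}=\frac1N\sum_{i=1}^N \mathbf 1\{\rho_{k,i,2}\le a_N\}\Big(\psi(k)+\log N+\log\frac{c_{d_x}c_{d_y}}{c_{d}}-\log n_{x,i,2}-\log n_{y,i,2}\Big).$$ Let $I(X;Y)=H(X)+H(Y)-H(X,Y)$, where $H$ is the differential entropy $-\int g\log g$ of the respective density $g$. Then for every fixed integer $k>\max\{d_x/d_y,\,d_y/d_x\}$ and every fixed $\delta>0$, both estimators are integrable and, as $N\to\infty$, $$\mathbb E\big[\widehat I_{\rm tKSG}\big]-I(X;Y)=O\!\left(\frac{(\log N)^{(1+\delta)(1+\frac1{d_x+d_y})}}{N^{\frac1{d_x+d_y}}}\right),\qquad \mathbb E\big[\widehat I_{\rm tBI\text{-}KSG}\big]-I(X;Y)=O\!\left(\frac{(\log N)^{(1+\delta)(1+\frac1{d_x+d_y})}}{N^{\frac1{d_x+d_y}}}\right).$$ -/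

import Mathlib

open MeasureTheory ProbabilityTheory Filter Asymptotics
open scoped ENNReal

noncomputable section

namespace KSG

/-- The point `(x, y)` of `ℝ^{d_x + d_y}`, with its Euclidean structure. -/
def joint {dx dy : ℕ} (x : EuclideanSpace ℝ (Fin dx)) (y : EuclideanSpace ℝ (Fin dy)) :
    EuclideanSpace ℝ (Fin dx ⊕ Fin dy) :=
  WithLp.toLp 2 (Sum.elim x.ofLp y.ofLp)

/-! ### Densities, entropy and mutual information -/

/-- The marginal density `f_X(x) = ∫ f(x, y) dy`. -/
def marginalX {dx dy : ℕ} (f : EuclideanSpace ℝ (Fin dx ⊕ Fin dy) → ℝ)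
    (x : EuclideanSpace ℝ (Fin dx)) : ℝ :=
  ∫ y : EuclideanSpace ℝ (Fin dy), f (joint x y)

/-- The marginal density `f_Y(y) = ∫ f(x, y) dx`. -/
def marginalY {dx dy : ℕ} (f : EuclideanSpace ℝ (Fin dx ⊕ Fin dy) → ℝ)
    (y : EuclideanSpace ℝ (Fin dy)) : ℝ :=
  ∫ x : EuclideanSpace ℝ (Fin dx), f (joint x y)

/-- The differential entropy `-∫ g log g` of a density `g`. -/
def differentialEntropy {ι : Type*} [Fintype ι] (g : EuclideanSpace ℝ ι → ℝ) : ℝ :=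
  -∫ z : EuclideanSpace ℝ ι, g z * Real.log (g z)

/-- The mutual information `I(X;Y) = H(X) + H(Y) - H(X,Y)` of a pair with joint density `f`. -/
def mutualInformation {dx dy : ℕ} (f : EuclideanSpace ℝ (Fin dx ⊕ Fin dy) → ℝ) : ℝ :=
  differentialEntropy (marginalX f) + differentialEntropy (marginalY f) - differentialEntropy f

/-- The set of points at which it fails that `g` is twice continuously differentiable
(in a neighbourhood) with Hessian of spectral norm `< C`.  The spectral norm of the Hessian is
the operator norm of the second derivative with respect to the Euclidean norm. -/
def nonsmoothSet {ι : Type*} [Fintype ι] (g : EuclideanSpace ℝ ι → ℝ) (C : ℝ) :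
    Set (EuclideanSpace ℝ ι) :=
  {z | ¬ (ContDiffAt ℝ 2 g z ∧ ‖fderiv ℝ (fderiv ℝ g) z‖ < C)}

/-- The regularity assumption on the joint density `f`, with its constants. -/
structure RateAssumption {dx dy : ℕ} (f : EuclideanSpace ℝ (Fin dx ⊕ Fin dy) → ℝ)
    (Ca Cb Cc Cd Ce Cf Cg Ch C0 : ℝ) : Prop where
  /-- The exponential rate in the tail condition is positive. -/
  C0_pos : 0 < C0
  /-- (a) The density is bounded. -/
  bounded : ∀ᵐ z, f z ≤ Ca
  /-- (b) A moment of order `1 + γ` of the log-density. -/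
  logMoment : ∃ γ : ℝ, 0 < γ ∧ Integrable (fun z => f z * |Real.log (f z)| ^ (1 + γ)) ∧
    ∫ z, f z * |Real.log (f z)| ^ (1 + γ) ≤ Cb
  /-- (c) The tail condition. -/
  tail : ∀ b : ℝ, 1 < b → ∫ z, f z * Real.exp (-b * f z) ≤ Cc * Real.exp (-C0 * b)
  /-- (d) Twice continuous differentiability with bounded Hessian, almost everywhere. -/
  smooth : ∀ᵐ z, z ∉ nonsmoothSet f Cd
  /-- (e) The conditional density of `Y` given `X` is bounded. -/
  condYX : ∀ᵐ p : EuclideanSpace ℝ (Fin dx) × EuclideanSpace ℝ (Fin dy),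
    f (joint p.1 p.2) / marginalX f p.1 < Ce
  /-- (e) The conditional density of `X` given `Y` is bounded. -/
  condXY : ∀ᵐ p : EuclideanSpace ℝ (Fin dx) × EuclideanSpace ℝ (Fin dy),
    f (joint p.1 p.2) / marginalY f p.2 < Ce
  /-- (f) The marginal density of `X` is bounded. -/
  margX : ∀ᵐ x, marginalX f x < Cf
  /-- (f) The marginal density of `Y` is bounded. -/
  margY : ∀ᵐ y, marginalY f y < Cf
  /-- (g) Hausdorff bound on the exceptional set of the joint density. -/
  hausdorff : μH[(dx : ℝ) + dy - 1] (nonsmoothSet f Cd) ≤ ENNReal.ofReal Cg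
  /-- (h) Hausdorff bound on the exceptional set of the density of `X`. -/
  hausdorffX : μH[(dx : ℝ) - 1] (nonsmoothSet (marginalX f) Cd) ≤ ENNReal.ofReal Ch
  /-- (h) Hausdorff bound on the exceptional set of the density of `Y`. -/
  hausdorffY : μH[(dy : ℝ) - 1] (nonsmoothSet (marginalY f) Cd) ≤ ENNReal.ofReal Ch

/-! ### The estimators -/

/-- The `ℓ_p` distance of two vectors. -/
def lpDist {ι : Type*} [Fintype ι] (p : ℝ≥0∞) (u v : EuclideanSpace ℝ ι) : ℝ :=
  dist (WithLp.toLp p u.ofLp : PiLp p fun _ : ι => ℝ) (WithLp.toLp p v.ofLp)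

/-- The number of `j ≠ i` with `‖w_j - w_i‖_p ≤ r`. -/
def neighborCount {ι : Type*} [Fintype ι] {N : ℕ} (p : ℝ≥0∞) (w : Fin N → EuclideanSpace ℝ ι)
    (i : Fin N) (r : ℝ) : ℕ :=
  (Finset.univ.filter fun j : Fin N => j ≠ i ∧ lpDist p (w j) (w i) ≤ r).card

/-- The `ℓ_p` distance from `w_i` to its `k`-th nearest neighbor among the other points
(meaningful as soon as `1 ≤ k < N`). -/
def knnDist {ι : Type*} [Fintype ι] {N : ℕ} (p : ℝ≥0∞) (k : ℕ)
    (w : Fin N → EuclideanSpace ℝ ι) (i : Fin N) : ℝ :=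
  sInf {r : ℝ | 0 ≤ r ∧ k ≤ neighborCount p w i r}

/-- `ρ_{k,i,p}`, computed from the joint sample `(x_j, y_j)`. -/
def rho {dx dy N : ℕ} (p : ℝ≥0∞) (k : ℕ) (x : Fin N → EuclideanSpace ℝ (Fin dx))
    (y : Fin N → EuclideanSpace ℝ (Fin dy)) (i : Fin N) : ℝ :=
  knnDist p k (fun j => joint (x j) (y j)) i

/-- `n_{x,i,p}`, the number of `j ≠ i` with `‖x_j - x_i‖_p ≤ ρ_{k,i,p}`. -/
def nX {dx dy N : ℕ} (p : ℝ≥0∞) (k : ℕ) (x : Fin N → EuclideanSpace ℝ (Fin dx))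
    (y : Fin N → EuclideanSpace ℝ (Fin dy)) (i : Fin N) : ℕ :=
  neighborCount p x i (rho p k x y i)

/-- `n_{y,i,p}`, the number of `j ≠ i` with `‖y_j - y_i‖_p ≤ ρ_{k,i,p}`. -/
def nY {dx dy N : ℕ} (p : ℝ≥0∞) (k : ℕ) (x : Fin N → EuclideanSpace ℝ (Fin dx))
    (y : Fin N → EuclideanSpace ℝ (Fin dy)) (i : Fin N) : ℕ :=
  neighborCount p y i (rho p k x y i)

/-- The digamma function `ψ = Γ' / Γ`. -/
def digamma : ℝ → ℝ := logDeriv Real.Gamma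

/-- The volume `π^{d/2} / Γ(d/2 + 1)` of the `d`-dimensional Euclidean unit ball. -/
def unitBallVolume (d : ℕ) : ℝ :=
  Real.pi ^ ((d : ℝ) / 2) / Real.Gamma ((d : ℝ) / 2 + 1)

/-- The truncation threshold `a_N = ((log N)^{1+δ} / N)^{1/d}`. -/
def threshold (d : ℕ) (δ : ℝ) (N : ℕ) : ℝ :=
  (Real.log N ^ (1 + δ) / N) ^ (1 / (d : ℝ))

/-- The local information estimate `ι_{k,i,∞}`. -/
def localKSG {dx dy N : ℕ} (k : ℕ) (δ : ℝ) (x : Fin N → EuclideanSpace ℝ (Fin dx))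
    (y : Fin N → EuclideanSpace ℝ (Fin dy)) (i : Fin N) : ℝ :=
  if rho ∞ k x y i ≤ threshold (dx + dy) δ N then
    digamma k + Real.log N - digamma ((nX ∞ k x y i : ℝ) + 1) - digamma ((nY ∞ k x y i : ℝ) + 1)
  else 0

/-- The local information estimate `ι_{k,i,2}`. -/
def localBIKSG {dx dy N : ℕ} (k : ℕ) (δ : ℝ) (x : Fin N → EuclideanSpace ℝ (Fin dx))
    (y : Fin N → EuclideanSpace ℝ (Fin dy)) (i : Fin N) : ℝ :=
  if rho 2 k x y i ≤ threshold (dx + dy) δ N then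
    digamma k + Real.log N
      + Real.log (unitBallVolume dx * unitBallVolume dy / unitBallVolume (dx + dy))
      - Real.log (nX 2 k x y i) - Real.log (nY 2 k x y i)
  else 0

/-- The truncated KSG estimator. -/
def tKSG {dx dy N : ℕ} (k : ℕ) (δ : ℝ) (x : Fin N → EuclideanSpace ℝ (Fin dx))
    (y : Fin N → EuclideanSpace ℝ (Fin dy)) : ℝ :=
  (1 / (N : ℝ)) * ∑ i, localKSG k δ x y i

/-- The truncated BI-KSG estimator. -/
def tBIKSG {dx dy N : ℕ} (k : ℕ) (δ : ℝ) (x : Fin N → EuclideanSpace ℝ (Fin dx))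
    (y : Fin N → EuclideanSpace ℝ (Fin dy)) : ℝ :=
  (1 / (N : ℝ)) * ∑ i, localBIKSG k δ x y i

end KSG

end

namespace KSG

section Translation

variable {ι : Type*} [Fintype ι]

/-! ### Translation estimates for piecewise smooth densities -/

/-! Fix a sample point z and let F, F_X, F_Y be the distribution functions (`distFun`) of the
distances from z to a random point, measured in the joint space and in the two marginal spaces. The
other N - 1 points are i.i.d., so at the k-th neighbour distance ρ the mass F(ρ) has a Beta law with
E log F(ρ) = ψ(k) - ψ(N). Given the k nearest points, the remaining points are independent outside
the ball they span, so n_x - k is binomial with mean close to N F_X(ρ), and E log n_x is close to E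
log(N F_X(ρ)). If small balls have mass nearly density times volume, then log F_X + log F_Y - log F
is nearly log(v_x v_y / v) minus the information density at z, the powers of ρ cancelling because d
= d_x + d_y. Hence the conditional mean of the local estimate is nearly the information density
(`abs_integral_localEst_sub_le`), whose mean is I(X;Y).

Two facts about the densities make this quantitative. First, the tail condition, valid for every
large b, forces f to vanish or to be at least C0/2 almost everywhere (`RateAssumption.dichotomy`),
and the bounded conditional densities pass such a gap to the marginals. So all logarithms are
bounded on the supports, the supports have finite volume, and F(ρ)/F_X(ρ) is O(ρ).

Second, the Hausdorff bounds control how badly densities oscillate. The points from which a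
coordinate segment of length t meets the nonsmooth set form a set of volume O(t)
(`volume_sweep_le`). Off this set the second difference is O(t²) by the Hessian bound, and
membership in the support does not change along the segment, by the gap. So second differences are
O(t) in L¹, which gives an L¹ modulus of continuity O(t log(1/t)) for the density
(`le_of_zygmund_recursion`), and O(t) for the indicator of its support. Summing the mean
oscillations over dyadic scales below a gives the function `oscMax`. It dominates the error of the
ball masses at all radii up to a simultaneously (`PiecewiseSmooth.setIntegral_bounds`), and its
integral is O(a log(1/a)).

At points where the oscillation of the supports is small, the bias is O(`oscMax` + a). At the other
points the crude bound O(log N) is used, and their probability is O(a) by Markov's inequality.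
Integrating over z with a = a_N gives a bias O(a_N log N), which is within the claimed rate.

Both estimators are instances of one functional `pointEst`, with φ standing for m ↦ ψ(m + 1) or log;
the argument uses only |φ(m) - log m| ≤ 1/m. The condition on k enters through k ≥ 2, which makes
1/F(ρ) integrable. -/

lemma volume_coordBox (a b : ι → ℝ) :
    volume {z : EuclideanSpace ℝ ι | ∀ i, a i ≤ z i ∧ z i ≤ b i}
      = ∏ i, ENNReal.ofReal (b i - a i) := by
  rw [← Real.volume_Icc_pi,
    ← (PiLp.volume_preserving_ofLp ι).measure_preimage measurableSet_Icc.nullMeasurableSet]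
  congr 1
  ext z
  simp [Set.mem_Icc, Pi.le_def, forall_and]

/-- The points from which the segment of length `t` in the `i`-th coordinate direction meets `S`. -/
def sweep [DecidableEq ι] (S : Set (EuclideanSpace ℝ ι)) (i : ι) (t : ℝ) :
    Set (EuclideanSpace ℝ ι) :=
  {z | ∃ s ∈ Set.Icc 0 t, z + s • EuclideanSpace.single i (1 : ℝ) ∈ S}

/-- With r the diameter of U, the swept set lies in a box of side 2r in every direction except i,
where the side is 2r + t ≤ 3t. The volume is thus of order t r^(d-1), matching the exponent of the
Hausdorff measure. -/
lemma volume_sweep_le_of_ediam [DecidableEq ι] (U : Set (EuclideanSpace ℝ ι)) (i : ι) {t : ℝ}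
    (ht : 0 < t) (hU : Metric.ediam U ≤ ENNReal.ofReal t) (hne : U.Nonempty) :
    volume (sweep U i t)
      ≤ ENNReal.ofReal (3 * 2 ^ Fintype.card ι * t)
        * Metric.ediam U ^ ((Fintype.card ι : ℝ) - 1) := by
  obtain ⟨u, hu⟩ := hne
  have hfin : Metric.ediam U ≠ ∞ := ne_top_of_le_ne_top ENNReal.ofReal_ne_top hU
  set r := (Metric.ediam U).toReal with hr
  have hr0 : 0 ≤ r := ENNReal.toReal_nonneg
  have hrU : Metric.ediam U = ENNReal.ofReal r := (ENNReal.ofReal_toReal hfin).symm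
  have hrt : r ≤ t := by
    rw [hrU] at hU
    exact (ENNReal.ofReal_le_ofReal_iff ht.le).1 hU
  have hsub : sweep U i t ⊆ {z | ∀ j, (u j - r - (if j = i then t else 0)) ≤ z j ∧ z j ≤ u j + r} := by
    rintro z ⟨s, hs, hz⟩ j
    have h1 : edist (z + s • EuclideanSpace.single i (1 : ℝ)) u ≤ ENNReal.ofReal r :=
      hrU ▸ Metric.edist_le_ediam_of_mem hz hu
    have h2 : ‖z + s • EuclideanSpace.single i (1 : ℝ) - u‖ ≤ r := by
      rw [edist_dist, ENNReal.ofReal_le_ofReal_iff hr0, dist_eq_norm] at h1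
      exact h1
    have h3 := (PiLp.norm_apply_le (z + s • EuclideanSpace.single i (1 : ℝ) - u) j).trans h2
    have h4 : (z + s • EuclideanSpace.single i (1 : ℝ) - u) j
        = z j + s * (if j = i then 1 else 0) - u j := by
      simp
    rw [h4, Real.norm_eq_abs, abs_le] at h3
    have := hs.1
    have := hs.2
    split_ifs at h3 ⊢ <;> constructor <;> linarith
  refine (measure_mono hsub).trans ?_
  rw [volume_coordBox, ← Finset.mul_prod_erase _ _ (Finset.mem_univ i)]
  have hprod : ∏ x ∈ Finset.univ.erase i,
      ENNReal.ofReal (u x + r - (u x - r - if x = i then t else 0))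
      = ENNReal.ofReal (2 * r) ^ (Fintype.card ι - 1) := by
    rw [Finset.prod_congr rfl (g := fun _ => ENNReal.ofReal (2 * r))]
    · rw [Finset.prod_const, Finset.card_erase_of_mem (Finset.mem_univ i), Finset.card_univ]
    · intro x hx
      rw [if_neg (Finset.ne_of_mem_erase hx)]
      congr 1
      ring
  have hcard : 1 ≤ Fintype.card ι := Fintype.card_pos_iff.2 ⟨i⟩
  have hpow : Metric.ediam U ^ ((Fintype.card ι : ℝ) - 1)
      = ENNReal.ofReal (r ^ (Fintype.card ι - 1)) := by
    rw [← Nat.cast_one, ← Nat.cast_sub hcard, ENNReal.rpow_natCast, hrU, ENNReal.ofReal_pow hr0]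
  rw [hprod, hpow, ← ENNReal.ofReal_pow (by positivity), ← ENNReal.ofReal_mul (by simp; linarith),
    ← ENNReal.ofReal_mul (by positivity)]
  apply ENNReal.ofReal_le_ofReal
  simp only [if_true]
  obtain ⟨m, hm⟩ := Nat.exists_eq_add_of_le' hcard
  rw [hm, Nat.add_sub_cancel, mul_pow, pow_succ]
  have : (u i + r - (u i - r - t)) ≤ 3 * t := by linarith
  calc (u i + r - (u i - r - t)) * (2 ^ m * r ^ m) ≤ 3 * t * (2 ^ m * r ^ m) := by gcongr
    _ ≤ 3 * (2 ^ m * 2) * t * r ^ m := by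
      have : 0 ≤ t * (2 ^ m * r ^ m) := by positivity
      nlinarith

/-- Sum the single-set bound over a cover of S by sets of diameter at most t. The Hausdorff measure
is the supremum over mesh sizes of the infimum over covers, so at mesh t the infimum is at most the
measure; the summand 1 is the slack needed to choose an actual cover. -/
lemma volume_sweep_le [DecidableEq ι] (S : Set (EuclideanSpace ℝ ι)) (i : ι) {t : ℝ} (ht : 0 < t) :
    volume (sweep S i t)
      ≤ ENNReal.ofReal (3 * 2 ^ Fintype.card ι * t) * (μH[(Fintype.card ι : ℝ) - 1] S + 1) := by
  by_cases hS : μH[(Fintype.card ι : ℝ) - 1] S = ∞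
  · rw [hS, top_add, ENNReal.mul_top]
    · exact le_top
    · simp; positivity
  have h1 : (⨅ (U : ℕ → Set (EuclideanSpace ℝ ι)) (_ : S ⊆ ⋃ n, U n)
      (_ : ∀ n, Metric.ediam (U n) ≤ ENNReal.ofReal t),
      ∑' n, ⨆ _ : (U n).Nonempty, Metric.ediam (U n) ^ ((Fintype.card ι : ℝ) - 1))
      < μH[(Fintype.card ι : ℝ) - 1] S + 1 := by
    refine lt_of_le_of_lt ?_ (ENNReal.lt_add_right hS one_ne_zero)
    conv_rhs => rw [Measure.hausdorffMeasure_apply]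
    exact le_iSup₂_of_le (ENNReal.ofReal t) (ENNReal.ofReal_pos.2 ht) le_rfl
  simp only [iInf_lt_iff] at h1
  obtain ⟨U, hSU, hU, hlt⟩ := h1
  have hsub : sweep S i t ⊆ ⋃ n, sweep (U n) i t := by
    rintro z ⟨s, hs, hz⟩
    obtain ⟨n, hn⟩ := Set.mem_iUnion.1 (hSU hz)
    exact Set.mem_iUnion.2 ⟨n, s, hs, hn⟩
  calc volume (sweep S i t) ≤ ∑' n, volume (sweep (U n) i t) :=
        (measure_mono hsub).trans (measure_iUnion_le _)
    _ ≤ ∑' n, ENNReal.ofReal (3 * 2 ^ Fintype.card ι * t)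
          * ⨆ _ : (U n).Nonempty, Metric.ediam (U n) ^ ((Fintype.card ι : ℝ) - 1) := by
        refine ENNReal.tsum_le_tsum fun n => ?_
        by_cases hne : (U n).Nonempty
        · simp only [hne, iSup_pos]
          exact volume_sweep_le_of_ediam _ _ ht (hU n) hne
        · rw [Set.not_nonempty_iff_eq_empty] at hne
          simp [hne, sweep]
    _ ≤ _ := by
        rw [ENNReal.tsum_mul_left]
        gcongr

/-- A bounded density which is bounded below on its support and is piecewise smooth. -/
structure PiecewiseSmooth (g : EuclideanSpace ℝ ι → ℝ) (c C Cd : ℝ) : Prop where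
  pos : 0 < c
  measurable : Measurable g
  nonneg : ∀ z, 0 ≤ g z
  lintegral_ne_top : ∫⁻ z, ENNReal.ofReal (g z) ≠ ∞
  le : ∀ᵐ z, g z ≤ C
  dichotomy : ∀ᵐ z, g z = 0 ∨ c ≤ g z
  hausdorff : μH[(Fintype.card ι : ℝ) - 1] (nonsmoothSet g Cd) ≠ ∞

variable {g : EuclideanSpace ℝ ι → ℝ} {c C Cd : ℝ}

lemma PiecewiseSmooth.volume_pos_ne_top (hg : PiecewiseSmooth g c C Cd) :
    volume {z | 0 < g z} ≠ ∞ := by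
  have h1 : volume {z | ENNReal.ofReal c ≤ ENNReal.ofReal (g z)} ≠ ∞ := by
    have := meas_ge_le_lintegral_div (μ := volume) (hg.measurable.ennreal_ofReal).aemeasurable
      (ε := ENNReal.ofReal c) (by simpa using hg.pos) ENNReal.ofReal_ne_top
    exact ne_top_of_le_ne_top (ENNReal.div_ne_top hg.lintegral_ne_top (by simpa using hg.pos)) this
  refine ne_top_of_le_ne_top h1 (measure_mono_ae ?_)
  filter_upwards [hg.dichotomy] with z hz (h0 : 0 < g z)
  rcases hz with hz | hz
  · exact absurd hz h0.ne'
  · exact ENNReal.ofReal_le_ofReal hz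

/-- The gap is assumed only almost everywhere. At a continuity point a value strictly between 0 and
c would persist on a neighbourhood, which has positive measure. -/
lemma PiecewiseSmooth.dichotomy_of_smooth (hg : PiecewiseSmooth g c C Cd)
    {z : EuclideanSpace ℝ ι} (hz : z ∉ nonsmoothSet g Cd) : g z = 0 ∨ c ≤ g z := by
  by_contra! h
  have hpos : 0 < g z := lt_of_le_of_ne (hg.nonneg z) (Ne.symm h.1)
  have hcont : ContinuousAt g z := (not_not.1 hz).1.continuousAt
  have hU : {w | 0 < g w ∧ g w < c} ∈ nhds z :=
    (hcont.eventually (lt_mem_nhds hpos)).and (hcont.eventually (gt_mem_nhds h.2))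
  have h0 : volume {w | 0 < g w ∧ g w < c} = 0 := by
    refine measure_mono_null ?_ (ae_iff.1 hg.dichotomy)
    rintro w ⟨h1, h2⟩ (h3 | h3) <;> linarith
  exact (Measure.measure_pos_of_mem_nhds volume hU).ne' h0

lemma hasDerivAt_comp_line [DecidableEq ι] {F : Type*} [NormedAddCommGroup F] [NormedSpace ℝ F]
    {G : EuclideanSpace ℝ ι → F} (z : EuclideanSpace ℝ ι) (i : ι) (s : ℝ)
    (h : DifferentiableAt ℝ G (z + s • EuclideanSpace.single i (1 : ℝ))) :
    HasDerivAt (fun s : ℝ => G (z + s • EuclideanSpace.single i (1 : ℝ)))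
      (fderiv ℝ G (z + s • EuclideanSpace.single i (1 : ℝ)) (EuclideanSpace.single i (1 : ℝ))) s := by
  have h1 : HasDerivAt (fun s : ℝ => z + s • EuclideanSpace.single i (1 : ℝ))
      (EuclideanSpace.single i (1 : ℝ)) s := by
    simpa using ((hasDerivAt_id s).smul_const (EuclideanSpace.single i (1 : ℝ))).const_add z
  exact h.hasFDerivAt.comp_hasDerivAt s h1

/-- Along a segment avoiding the nonsmooth set, g is continuous and never takes the value c/2, so by
the intermediate value theorem it cannot cross the gap. -/
lemma PiecewiseSmooth.pos_iff_of_notMem_sweep [DecidableEq ι] (hg : PiecewiseSmooth g c C Cd)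
    {z : EuclideanSpace ℝ ι} {i : ι} {t : ℝ} (ht : 0 ≤ t) (hz : z ∉ sweep (nonsmoothSet g Cd) i t) :
    0 < g z ↔ 0 < g (z + t • EuclideanSpace.single i (1 : ℝ)) := by
  have hoff : ∀ s ∈ Set.Icc 0 t, z + s • EuclideanSpace.single i (1 : ℝ) ∉ nonsmoothSet g Cd :=
    fun s hs h => hz ⟨s, hs, h⟩
  have hcont : ContinuousOn (fun s : ℝ => g (z + s • EuclideanSpace.single i (1 : ℝ)))
      (Set.Icc 0 t) := fun s hs =>
    (hasDerivAt_comp_line z i s ((not_not.1 (hoff s hs)).1.differentiableAt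
      (by norm_num))).continuousAt.continuousWithinAt
  have hdich := fun s hs => hg.dichotomy_of_smooth (hoff s hs)
  have hc := hg.pos
  have hmid : ∀ s ∈ Set.Icc 0 t, g (z + s • EuclideanSpace.single i (1 : ℝ)) ≠ c / 2 := by
    intro s hs h
    rcases hdich s hs with h1 | h1 <;> linarith
  have h0 := hdich 0 ⟨le_rfl, ht⟩
  have h1 := hdich t ⟨ht, le_rfl⟩
  rw [zero_smul, add_zero] at h0
  constructor
  · intro hp
    by_contra hn
    have e0 : c ≤ g z := h0.resolve_left hp.ne'
    have e1 : g (z + t • EuclideanSpace.single i (1 : ℝ)) = 0 :=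
      h1.resolve_right fun h => hn (hc.trans_le h)
    obtain ⟨s, hs, hs'⟩ := intermediate_value_Icc' ht hcont
      (show c / 2 ∈ Set.Icc _ _ from ⟨by rw [e1]; linarith, by simp only [zero_smul, add_zero]; linarith⟩)
    exact hmid s hs hs'
  · intro hp
    by_contra hn
    have e1 := h1.resolve_left hp.ne'
    have e0 : g z = 0 := h0.resolve_right fun h => hn (hc.trans_le h)
    obtain ⟨s, hs, hs'⟩ := intermediate_value_Icc ht hcont
      (show c / 2 ∈ Set.Icc _ _ from ⟨by simp only [zero_smul, add_zero]; linarith, by linarith⟩)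
    exact hmid s hs hs'

/-- The second difference is the increment over [0, t] of s ↦ g(z + (s + t)e) - g(z + se). Its
derivative is a difference of slopes, at most Cd t by the Hessian bound; so the mean value
inequality is applied twice. -/
lemma abs_second_difference_le [DecidableEq ι] {z : EuclideanSpace ℝ ι} {i : ι} {t : ℝ}
    (ht : 0 ≤ t) (hz : z ∉ sweep (nonsmoothSet g Cd) i (2 * t)) :
    |g (z + (2 * t) • EuclideanSpace.single i (1 : ℝ))
      - 2 * g (z + t • EuclideanSpace.single i (1 : ℝ)) + g z| ≤ Cd * t ^ 2 := by
  set e : EuclideanSpace ℝ ι := EuclideanSpace.single i (1 : ℝ) with he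
  have hoff : ∀ s ∈ Set.Icc 0 (2 * t), z + s • e ∉ nonsmoothSet g Cd :=
    fun s hs h => hz ⟨s, hs, h⟩
  have hd1 : ∀ s ∈ Set.Icc 0 (2 * t),
      HasDerivAt (fun s : ℝ => g (z + s • e)) (fderiv ℝ g (z + s • e) e) s := fun s hs =>
    hasDerivAt_comp_line z i s ((not_not.1 (hoff s hs)).1.differentiableAt (by norm_num))
  have hd2 : ∀ s ∈ Set.Icc 0 (2 * t), HasDerivAt (fun s : ℝ => fderiv ℝ g (z + s • e) e)
      (fderiv ℝ (fderiv ℝ g) (z + s • e) e e) s := by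
    intro s hs
    have h1 : ContDiffAt ℝ 1 (fderiv ℝ g) (z + s • e) :=
      (not_not.1 (hoff s hs)).1.fderiv_right (by norm_num)
    have h2 := hasDerivAt_comp_line z i s (h1.differentiableAt (by norm_num))
    simpa using h2.clm_apply (hasDerivAt_const s e)
  have hb2 : ∀ s ∈ Set.Icc 0 (2 * t), ‖fderiv ℝ (fderiv ℝ g) (z + s • e) e e‖ ≤ Cd := by
    intro s hs
    have h1 := (not_not.1 (hoff s hs)).2.le
    have h2 := (fderiv ℝ (fderiv ℝ g) (z + s • e)).le_opNorm₂ e e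
    have h3 : ‖e‖ = 1 := by simp [he]
    rw [h3, mul_one, mul_one] at h2
    exact h2.trans h1
  have hslope : ∀ s ∈ Set.Icc 0 t,
      ‖fderiv ℝ g (z + (s + t) • e) e - fderiv ℝ g (z + s • e) e‖ ≤ Cd * t := by
    intro s hs
    have := Convex.norm_image_sub_le_of_norm_hasDerivWithin_le
      (fun s hs => (hd2 s hs).hasDerivWithinAt) hb2 (convex_Icc 0 (2 * t))
      (x := s) (y := s + t) ⟨hs.1, by linarith [hs.2]⟩ ⟨by linarith [hs.1], by linarith [hs.2]⟩
    simpa [abs_of_nonneg ht] using this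
  have hd3 : ∀ s ∈ Set.Icc 0 t, HasDerivWithinAt
      (fun s : ℝ => g (z + (s + t) • e) - g (z + s • e))
      (fderiv ℝ g (z + (s + t) • e) e - fderiv ℝ g (z + s • e) e) (Set.Icc 0 t) s := by
    intro s hs
    have h1 := (hd1 (s + t) ⟨by linarith [hs.1], by linarith [hs.2]⟩).comp_add_const s t
    exact (h1.sub (hd1 s ⟨hs.1, by linarith [hs.2]⟩)).hasDerivWithinAt
  have := Convex.norm_image_sub_le_of_norm_hasDerivWithin_le hd3 hslope (convex_Icc 0 t)
    (x := 0) (y := t) ⟨le_rfl, ht⟩ ⟨ht, le_rfl⟩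
  simp only [zero_add, zero_smul, add_zero, sub_zero, Real.norm_eq_abs, abs_of_nonneg ht] at this
  rw [show t + t = 2 * t by ring] at this
  calc _ = _ := by congr 1; ring
    _ ≤ _ := this
    _ = _ := by ring

/-- The `L¹` distance between `g` and its translate by `h`. -/
noncomputable def shiftDiff (g : EuclideanSpace ℝ ι → ℝ) (h : EuclideanSpace ℝ ι) : ℝ≥0∞ :=
  ∫⁻ z, ‖g (z + h) - g z‖ₑ

lemma shiftDiff_zero : shiftDiff g 0 = 0 := by simp [shiftDiff]

lemma shiftDiff_add_le (hg : Measurable g) (h h' : EuclideanSpace ℝ ι) :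
    shiftDiff g (h + h') ≤ shiftDiff g h + shiftDiff g h' := by
  have h1 : shiftDiff g h' = ∫⁻ z, ‖g (z + h + h') - g (z + h)‖ₑ :=
    (lintegral_add_right_eq_self (fun z => ‖g (z + h') - g z‖ₑ) h).symm
  rw [h1, add_comm (shiftDiff g h), shiftDiff, shiftDiff, ← lintegral_add_left (by fun_prop)]
  refine lintegral_mono fun z => ?_
  calc ‖g (z + (h + h')) - g z‖ₑ
      = ‖(g (z + h + h') - g (z + h)) + (g (z + h) - g z)‖ₑ := by
        rw [sub_add_sub_cancel, add_assoc]
    _ ≤ _ := enorm_add_le _ _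

lemma shiftDiff_neg (h : EuclideanSpace ℝ ι) : shiftDiff g (-h) = shiftDiff g h := by
  rw [shiftDiff, shiftDiff, ← lintegral_add_right_eq_self (fun z => ‖g (z + -h) - g z‖ₑ) h]
  refine lintegral_congr fun z => ?_
  rw [add_neg_cancel_right, enorm_sub_rev]

lemma shiftDiff_sum_le (hg : Measurable g) {κ : Type*} (s : Finset κ)
    (h : κ → EuclideanSpace ℝ ι) : shiftDiff g (∑ i ∈ s, h i) ≤ ∑ i ∈ s, shiftDiff g (h i) := by
  classical
  induction s using Finset.induction_on with
  | empty => simp [shiftDiff_zero]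
  | insert a s ha ih =>
    rw [Finset.sum_insert ha, Finset.sum_insert ha]
    exact (shiftDiff_add_le hg _ _).trans (by gcongr)

/-- Moving along the coordinate directions in turn reduces every translation to the positive
coordinate shifts that the sweep estimates handle. -/
lemma shiftDiff_le_sum_coord [DecidableEq ι] (hg : Measurable g) (h : EuclideanSpace ℝ ι) :
    shiftDiff g h ≤ ∑ i, shiftDiff g (|h i| • EuclideanSpace.single i (1 : ℝ)) := by
  have h1 : h = ∑ i, h i • EuclideanSpace.single i (1 : ℝ) := by
    ext j
    simp [Pi.single_apply]
  conv_lhs => rw [h1]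
  refine (shiftDiff_sum_le hg _ _).trans (Finset.sum_le_sum fun i _ => ?_)
  rcases abs_cases (h i) with ⟨h2, _⟩ | ⟨h2, _⟩
  · rw [h2]
  · rw [h2, neg_smul, shiftDiff_neg]

lemma shiftDiff_le_two_mul (hg : Measurable g) (h : EuclideanSpace ℝ ι) :
    shiftDiff g h ≤ 2 * ∫⁻ z, ‖g z‖ₑ := by
  calc shiftDiff g h ≤ ∫⁻ z, (‖g (z + h)‖ₑ + ‖g z‖ₑ) := lintegral_mono fun z => enorm_sub_le
    _ = _ := by
      rw [lintegral_add_left (by fun_prop), lintegral_add_right_eq_self (fun z => ‖g z‖ₑ) h,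
        two_mul]

lemma PiecewiseSmooth.shiftDiff_indicator_le [DecidableEq ι] (hg : PiecewiseSmooth g c C Cd)
    (i : ι) {t : ℝ} (ht : 0 < t) :
    shiftDiff (Set.indicator {z | 0 < g z} fun _ => (1 : ℝ)) (t • EuclideanSpace.single i (1 : ℝ))
      ≤ volume (sweep (nonsmoothSet g Cd) i t) := by
  rw [← measure_toMeasurable, ← lintegral_indicator_one (measurableSet_toMeasurable _ _), shiftDiff]
  refine lintegral_mono fun z => ?_
  by_cases hz : z ∈ sweep (nonsmoothSet g Cd) i t
  · rw [Set.indicator_of_mem (subset_toMeasurable _ _ hz), Pi.one_apply]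
    simp only [Set.indicator_apply]
    split_ifs <;> simp
  · have := hg.pos_iff_of_notMem_sweep ht.le hz
    simp only [Set.indicator_apply, Set.mem_ofPred_eq, this]
    simp

end Translation

/-! ### L¹ modulus of continuity and masses of small sets -/

section Oscillation

variable {ι : Type*} [Fintype ι] {g : EuclideanSpace ℝ ι → ℝ} {c C Cd : ℝ}

/-- On the swept set the integrand is at most 2|C| and the volume is O(t). Elsewhere it is at most
Cd t², and it vanishes unless one of the three points lies in the support, whose volume is finite.
-/
lemma PiecewiseSmooth.exists_lintegral_second_difference_le [DecidableEq ι]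
    (hg : PiecewiseSmooth g c C Cd) :
    ∃ K : ℝ, 0 ≤ K ∧ ∀ (i : ι) (t : ℝ), 0 < t → t ≤ 1 →
      ∫⁻ z, ‖g (z + (2 * t) • EuclideanSpace.single i (1 : ℝ))
        - 2 * g (z + t • EuclideanSpace.single i (1 : ℝ)) + g z‖ₑ ≤ ENNReal.ofReal (K * t) := by
  set A : Set (EuclideanSpace ℝ ι) := {z | 0 < g z} with hA
  have hAm : MeasurableSet A := measurableSet_lt measurable_const hg.measurable
  set H := (μH[(Fintype.card ι : ℝ) - 1] (nonsmoothSet g Cd)).toReal with hH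
  have hH0 : 0 ≤ H := ENNReal.toReal_nonneg
  have hHeq : μH[(Fintype.card ι : ℝ) - 1] (nonsmoothSet g Cd) = ENNReal.ofReal H :=
    (ENNReal.ofReal_toReal hg.hausdorff).symm
  set V := (volume A).toReal with hV
  have hV0 : 0 ≤ V := ENNReal.toReal_nonneg
  have hVeq : volume A = ENNReal.ofReal V := (ENNReal.ofReal_toReal hg.volume_pos_ne_top).symm
  refine ⟨2 * |C| * (3 * 2 ^ Fintype.card ι * 2 * (H + 1)) + |Cd| * (3 * V), by positivity,
    fun i t ht ht1 => ?_⟩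
  set e : EuclideanSpace ℝ ι := EuclideanSpace.single i (1 : ℝ) with he
  set E := toMeasurable volume (sweep (nonsmoothSet g Cd) i (2 * t)) with hE
  have hshift : ∀ h : EuclideanSpace ℝ ι, ∀ᵐ z, g (z + h) ≤ C := fun h =>
    (measurePreserving_add_right volume h).quasiMeasurePreserving.ae hg.le
  have hpt : ∀ᵐ z, ‖g (z + (2 * t) • e) - 2 * g (z + t • e) + g z‖ₑ
      ≤ ENNReal.ofReal (2 * |C|) * E.indicator 1 z
        + ENNReal.ofReal (|Cd| * t ^ 2) * (A.indicator 1 z + A.indicator 1 (z + t • e)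
          + A.indicator 1 (z + (2 * t) • e)) := by
    filter_upwards [hg.le, hshift (t • e), hshift ((2 * t) • e)] with z h0 h1 h2
    have n0 := hg.nonneg z
    have n1 := hg.nonneg (z + t • e)
    have n2 := hg.nonneg (z + (2 * t) • e)
    have hC := le_abs_self C
    by_cases hz : z ∈ sweep (nonsmoothSet g Cd) i (2 * t)
    · refine le_add_right ?_
      rw [Set.indicator_of_mem (subset_toMeasurable _ _ hz), Pi.one_apply, mul_one,
        Real.enorm_eq_ofReal_abs]
      refine ENNReal.ofReal_le_ofReal (abs_le.2 ⟨?_, ?_⟩) <;> linarith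
    · refine le_add_left ?_
      have h3 := abs_second_difference_le ht.le hz
      by_cases hor : z ∈ A ∨ z + t • e ∈ A ∨ z + (2 * t) • e ∈ A
      · have h4 : (1 : ℝ≥0∞) ≤ A.indicator 1 z + A.indicator 1 (z + t • e)
          + A.indicator 1 (z + (2 * t) • e) := by
          rcases hor with h | h | h
          · exact le_add_right (le_add_right (Set.indicator_of_mem h (1 : EuclideanSpace ℝ ι → ℝ≥0∞)).ge)
          · exact le_add_right (le_add_left (Set.indicator_of_mem h (1 : EuclideanSpace ℝ ι → ℝ≥0∞)).ge)
          · exact le_add_left (Set.indicator_of_mem h (1 : EuclideanSpace ℝ ι → ℝ≥0∞)).ge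
        refine le_trans ?_ (le_mul_of_one_le_right' h4)
        rw [Real.enorm_eq_ofReal_abs]
        refine ENNReal.ofReal_le_ofReal (h3.trans ?_)
        gcongr
        exact le_abs_self Cd
      · push Not at hor
        have hzero : ∀ w, w ∉ A → g w = 0 := fun w hw => le_antisymm (not_lt.1 hw) (hg.nonneg w)
        rw [hzero _ hor.1, hzero _ hor.2.1, hzero _ hor.2.2]
        simp
  have hind : ∀ h : EuclideanSpace ℝ ι, ∫⁻ z, A.indicator (1 : EuclideanSpace ℝ ι → ℝ≥0∞) (z + h) = volume A := by
    intro h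
    rw [lintegral_add_right_eq_self (A.indicator (1 : EuclideanSpace ℝ ι → ℝ≥0∞)) h, lintegral_indicator_one hAm]
  have hmeas : Measurable (A.indicator (1 : EuclideanSpace ℝ ι → ℝ≥0∞)) := measurable_one.indicator hAm
  refine (lintegral_mono_ae hpt).trans ?_
  rw [lintegral_add_left ((measurable_one.indicator (measurableSet_toMeasurable _ _)).const_mul _),
    lintegral_const_mul _ (measurable_one.indicator (measurableSet_toMeasurable _ _)),
    lintegral_const_mul _ (by fun_prop), lintegral_add_left (by fun_prop),
    lintegral_add_left hmeas, hind, hind, lintegral_indicator_one hAm,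
    lintegral_indicator_one (measurableSet_toMeasurable _ _), measure_toMeasurable, hVeq]
  calc _ ≤ ENNReal.ofReal (2 * |C|) * (ENNReal.ofReal (3 * 2 ^ Fintype.card ι * (2 * t))
          * (ENNReal.ofReal H + 1)) + ENNReal.ofReal (|Cd| * t ^ 2)
            * (ENNReal.ofReal V + ENNReal.ofReal V + ENNReal.ofReal V) := by
        gcongr
        rw [← hHeq]
        exact volume_sweep_le _ _ (by positivity)
    _ = ENNReal.ofReal (2 * |C| * (3 * 2 ^ Fintype.card ι * (2 * t) * (H + 1))
          + |Cd| * t ^ 2 * (V + V + V)) := by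
        rw [← ENNReal.ofReal_one, ← ENNReal.ofReal_add hH0 zero_le_one,
          ← ENNReal.ofReal_add hV0 hV0, ← ENNReal.ofReal_add (by positivity) hV0,
          ← ENNReal.ofReal_mul (by positivity), ← ENNReal.ofReal_mul (by positivity),
          ← ENNReal.ofReal_mul (by positivity), ← ENNReal.ofReal_add (by positivity) (by positivity)]
    _ ≤ _ := by
        apply ENNReal.ofReal_le_ofReal
        have h1 : |Cd| * t ^ 2 * (V + V + V) ≤ |Cd| * (3 * V) * t := by
          have : 0 ≤ |Cd| * (3 * V) * t := by positivity
          nlinarith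
        linarith

/-- Twice the first difference with step h is the first difference with step 2h minus the second
difference. This is the source of the recursion in `le_of_zygmund_recursion`. -/
lemma two_mul_shiftDiff_le (hg : Measurable g) (h : EuclideanSpace ℝ ι) :
    2 * shiftDiff g h
      ≤ shiftDiff g ((2 : ℝ) • h) + ∫⁻ z, ‖g (z + (2 : ℝ) • h) - 2 * g (z + h) + g z‖ₑ := by
  rw [shiftDiff, shiftDiff, ← lintegral_const_mul _ (by fun_prop), ← lintegral_add_left (by fun_prop)]
  refine lintegral_mono fun z => ?_
  calc 2 * ‖g (z + h) - g z‖ₑ = ‖2 * (g (z + h) - g z)‖ₑ := by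
        rw [enorm_mul]
        congr 1
        rw [Real.enorm_eq_ofReal_abs]
        simp
    _ = ‖(g (z + (2 : ℝ) • h) - g z) - (g (z + (2 : ℝ) • h) - 2 * g (z + h) + g z)‖ₑ := by
        congr 1
        ring
    _ ≤ _ := enorm_sub_le

/-- The Zygmund recursion `2 T(t) ≤ T(2t) + K t` loses one logarithm. -/
lemma le_of_zygmund_recursion {T : ℝ → ℝ} {K B : ℝ} (hK : 0 ≤ K) (hB : 0 ≤ B)
    (hT : ∀ t, 0 < t → t ≤ 1 → 2 * T t ≤ T (2 * t) + K * t) (hTB : ∀ t, 0 < t → T t ≤ B)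
    {a : ℝ} (ha : 0 < a) (ha1 : a ≤ 1) (j : ℕ) {t : ℝ} (ht : 0 < t) (hta : t ≤ a / 2 ^ j) :
    T t ≤ (2 * B + 3 * K) * (a * (1 + Real.log (1 / a))) * ((j + 1) / 2 ^ j) := by
  -- Each halving of the scale adds the same amount K s to 2^j T(s / 2^j), so the loss is linear in
  -- the number of halvings.
  have step : ∀ (j : ℕ) (s : ℝ), 0 < s → s ≤ 2 → T (s / 2 ^ j) ≤ (T s + K * s * j) / 2 ^ j := by
    intro j s hs hs2
    induction j with
    | zero => simp
    | succ j ih =>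
      have hp : (1 : ℝ) ≤ 2 ^ j := one_le_pow₀ (by norm_num)
      have h1 := hT (s / 2 ^ (j + 1)) (by positivity)
        (by rw [div_le_one (by positivity), pow_succ]; linarith)
      have h2 : 2 * (s / 2 ^ (j + 1)) = s / 2 ^ j := by rw [pow_succ]; field_simp
      rw [h2] at h1
      have h3 : (T s + K * s * ((j + 1 : ℕ) : ℝ)) / 2 ^ (j + 1)
          = ((T s + K * s * j) / 2 ^ j + K * (s / 2 ^ (j + 1)) * 2) / 2 := by
        push_cast
        rw [pow_succ]
        field_simp
        ring
      rw [h3]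
      have : 0 ≤ K * (s / 2 ^ (j + 1)) := by positivity
      linarith
  have hlog : 0 ≤ Real.log (1 / a) := Real.log_nonneg (by rw [le_div_iff₀ ha]; linarith)
  -- Descend from scale 2^J s ≤ 1 with 2^J comparable to 1/a. The recursion is then restarted at
  -- scale a, which separates the factor log(1/a) from the summable factor (j + 1)/2^j.
  have base : ∀ s, 0 < s → s ≤ a → T s ≤ a * (2 * B + 2 * K * Real.log (1 / a)) := by
    intro s hs hsa
    obtain ⟨J, hJ1, hJ2⟩ := exists_nat_pow_near (x := 1 / a) (y := 2)
      (by rw [le_div_iff₀ ha]; linarith) (by norm_num)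
    have hp : (0 : ℝ) < 2 ^ J := by positivity
    have hJa : 2 ^ J * a ≤ 1 := by rwa [le_div_iff₀ ha] at hJ1
    have hJb : 1 < 2 ^ J * 2 * a := by rwa [div_lt_iff₀ ha, pow_succ] at hJ2
    have h1 := step J (2 ^ J * s) (by positivity) (by nlinarith)
    have h2 : 2 ^ J * s / 2 ^ J = s := by field_simp
    rw [h2] at h1
    have hJlog : (J : ℝ) ≤ 2 * Real.log (1 / a) := by
      have h3 := Real.log_le_log hp hJ1
      rw [Real.log_pow] at h3
      have := Real.log_two_gt_d9
      have hJ0 : (0 : ℝ) ≤ J := Nat.cast_nonneg J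
      nlinarith
    have h4 : T (2 ^ J * s) / 2 ^ J ≤ 2 * a * B := by
      rw [div_le_iff₀ hp]
      have := hTB (2 ^ J * s) (by positivity)
      nlinarith
    have h5 : K * (2 ^ J * s) * J / 2 ^ J = K * s * J := by field_simp
    rw [add_div, h5] at h1
    have h6 : K * s * J ≤ K * a * (2 * Real.log (1 / a)) := by gcongr
    linarith
  have hp : (0 : ℝ) < 2 ^ j := by positivity
  have hs : 2 ^ j * t ≤ a := by
    rw [le_div_iff₀ hp] at hta
    linarith
  have h1 := step j (2 ^ j * t) (by positivity) (by linarith)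
  have h2 : 2 ^ j * t / 2 ^ j = t := by field_simp
  rw [h2] at h1
  have h3 := base (2 ^ j * t) (by positivity) hs
  have h4 : K * (2 ^ j * t) * j ≤ K * a * j := by gcongr
  refine h1.trans ?_
  rw [mul_div_assoc', div_le_div_iff_of_pos_right hp]
  have hj : (0 : ℝ) ≤ j := Nat.cast_nonneg j
  have e1 : 0 ≤ a * B * j := by positivity
  have e2 : 0 ≤ a * K * j := by positivity
  have e3 : 0 ≤ a * K * Real.log (1 / a) := by positivity
  have e4 : 0 ≤ a * B * Real.log (1 / a) := by positivity
  have e5 : 0 ≤ a * K * j * Real.log (1 / a) := by positivity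
  have e6 : 0 ≤ a * B * j * Real.log (1 / a) := by positivity
  have e7 : 0 ≤ a * K := by positivity
  nlinarith

/-- A dyadic modulus of continuity in `L¹` below the scale `a`. -/
def ShiftBound (g : EuclideanSpace ℝ ι → ℝ) (a B : ℝ) : Prop :=
  ∀ (j : ℕ) (h : EuclideanSpace ℝ ι), (∀ i, |h i| ≤ a / 2 ^ j) →
    shiftDiff g h ≤ ENNReal.ofReal (B * ((j + 1) / 2 ^ j))

lemma shiftBound_of_coord [DecidableEq ι] (hg : Measurable g) {a B : ℝ}
    (h : ∀ (i : ι) (j : ℕ) (t : ℝ), 0 < t → t ≤ a / 2 ^ j →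
      shiftDiff g (t • EuclideanSpace.single i (1 : ℝ)) ≤ ENNReal.ofReal (B * ((j + 1) / 2 ^ j))) :
    ShiftBound g a (Fintype.card ι * B) := by
  intro j u hu
  refine (shiftDiff_le_sum_coord hg u).trans ?_
  calc _ ≤ ∑ _i : ι, ENNReal.ofReal (B * ((j + 1) / 2 ^ j)) := by
        refine Finset.sum_le_sum fun i _ => ?_
        rcases (abs_nonneg (u i)).eq_or_lt with h0 | h0
        · rw [← h0, zero_smul, shiftDiff_zero]
          exact zero_le
        · exact h i j _ h0 (hu i)
    _ = _ := by
        rw [Finset.sum_const, Finset.card_univ, nsmul_eq_mul, ← ENNReal.ofReal_natCast,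
          ← ENNReal.ofReal_mul (by positivity), mul_assoc]

/-- The recursion starts from the trivial bound, twice the mass of g, and is driven by the second
differences. -/
lemma PiecewiseSmooth.exists_shiftBound (hg : PiecewiseSmooth g c C Cd) :
    ∃ K : ℝ, 0 ≤ K ∧ ∀ a, 0 < a → a ≤ 1 → ShiftBound g a (K * (a * (1 + Real.log (1 / a)))) := by
  classical
  obtain ⟨K, hK, hK2⟩ := hg.exists_lintegral_second_difference_le
  have hfin : ∫⁻ z, ‖g z‖ₑ ≠ ∞ := by
    refine ne_of_eq_of_ne (lintegral_congr fun z => ?_) hg.lintegral_ne_top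
    rw [Real.enorm_of_nonneg (hg.nonneg z)]
  set B := (2 * ∫⁻ z, ‖g z‖ₑ).toReal with hB
  have hBtop : 2 * ∫⁻ z, ‖g z‖ₑ ≠ ∞ := ENNReal.mul_ne_top (by simp) hfin
  have hB0 : 0 ≤ B := ENNReal.toReal_nonneg
  have hle : ∀ h, shiftDiff g h ≤ 2 * ∫⁻ z, ‖g z‖ₑ := shiftDiff_le_two_mul hg.measurable
  have hne : ∀ h, shiftDiff g h ≠ ∞ := fun h => ne_top_of_le_ne_top hBtop (hle h)
  refine ⟨Fintype.card ι * (2 * B + 3 * K), by positivity, fun a ha ha1 => ?_⟩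
  have hlog : 0 ≤ Real.log (1 / a) := Real.log_nonneg (by rw [le_div_iff₀ ha]; linarith)
  rw [mul_assoc]
  refine shiftBound_of_coord hg.measurable fun i j t ht hta => ?_
  rw [← ENNReal.ofReal_toReal (hne _)]
  refine ENNReal.ofReal_le_ofReal ?_
  refine le_of_zygmund_recursion
    (T := fun t => (shiftDiff g (t • EuclideanSpace.single i (1 : ℝ))).toReal) hK hB0 ?_ ?_
    ha ha1 j ht hta
  · intro t ht ht1
    have h1 := two_mul_shiftDiff_le hg.measurable (t • EuclideanSpace.single i (1 : ℝ))
    rw [smul_smul] at h1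
    have h2 := h1.trans (add_le_add_right (hK2 i t ht ht1) _)
    have h3 := ENNReal.toReal_mono (by simp [hne]) h2
    rw [ENNReal.toReal_mul, ENNReal.toReal_add (hne _) (by simp),
      ENNReal.toReal_ofReal (by positivity)] at h3
    simpa using h3
  · intro t _
    exact ENNReal.toReal_mono hBtop (hle _)

/-- Here the swept volume bounds first differences directly, so no logarithm is lost. This saved
logarithm is what pays later for the crude O(log N) bound at bad points. -/
lemma PiecewiseSmooth.exists_shiftBound_indicator (hg : PiecewiseSmooth g c C Cd) :
    ∃ K : ℝ, 0 ≤ K ∧ ∀ a, 0 < a →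
      ShiftBound (Set.indicator {z | 0 < g z} fun _ => (1 : ℝ)) a (K * a) := by
  classical
  set H := (μH[(Fintype.card ι : ℝ) - 1] (nonsmoothSet g Cd)).toReal with hH
  have hH0 : 0 ≤ H := ENNReal.toReal_nonneg
  have hHeq : μH[(Fintype.card ι : ℝ) - 1] (nonsmoothSet g Cd) = ENNReal.ofReal H :=
    (ENNReal.ofReal_toReal hg.hausdorff).symm
  refine ⟨Fintype.card ι * (3 * 2 ^ Fintype.card ι * (H + 1)), by positivity, fun a ha => ?_⟩
  rw [mul_assoc]
  refine shiftBound_of_coord (measurable_const.indicator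
    (measurableSet_lt measurable_const hg.measurable)) fun i j t ht hta => ?_
  refine (hg.shiftDiff_indicator_le i ht).trans ((volume_sweep_le _ i ht).trans ?_)
  rw [hHeq, ← ENNReal.ofReal_one, ← ENNReal.ofReal_add hH0 zero_le_one,
    ← ENNReal.ofReal_mul (by positivity)]
  refine ENNReal.ofReal_le_ofReal ?_
  have h1 : a / 2 ^ j ≤ a * ((j + 1) / 2 ^ j) := by
    rw [mul_div_assoc']
    gcongr
    have : (0 : ℝ) ≤ j := Nat.cast_nonneg j
    nlinarith
  calc 3 * 2 ^ Fintype.card ι * t * (H + 1) = 3 * 2 ^ Fintype.card ι * (H + 1) * t := by ring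
    _ ≤ 3 * 2 ^ Fintype.card ι * (H + 1) * (a * ((j + 1) / 2 ^ j)) := by
        gcongr
        exact hta.trans h1
    _ = _ := by ring

/-- The centered closed cube of side `2 r`. -/
def cube (ι : Type*) [Fintype ι] (r : ℝ) : Set (EuclideanSpace ℝ ι) := {h | ∀ i, |h i| ≤ r}

lemma volume_cube (r : ℝ) : volume (cube ι r) = ENNReal.ofReal (2 * r) ^ Fintype.card ι := by
  have h := volume_coordBox (fun _ : ι => -r) (fun _ => r)
  rw [Finset.prod_const, Finset.card_univ] at h
  rw [two_mul, ← sub_neg_eq_add, ← h]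
  congr 1
  ext z
  simp [cube, abs_le]

/-- A dyadic maximal function controlling the mean oscillation of `g` around `z` at all scales
below `a`. -/
noncomputable def oscMax (g : EuclideanSpace ℝ ι → ℝ) (a : ℝ) (z : EuclideanSpace ℝ ι) : ℝ≥0∞ :=
  ∑' j : ℕ, (volume (cube ι (a / 2 ^ j)))⁻¹ * ∫⁻ h in cube ι (a / 2 ^ j), ‖g (z + h) - g z‖ₑ

lemma measurable_oscMax (hg : Measurable g) (a : ℝ) : Measurable (oscMax g a) := by
  refine Measurable.tsum fun j => Measurable.const_mul ?_ _
  exact Measurable.lintegral_prod_right' (f := fun p : _ × _ => ‖g (p.1 + p.2) - g p.1‖ₑ)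
    (by fun_prop)

lemma summable_succ_div_two_pow : Summable fun j : ℕ => ((j : ℝ) + 1) / 2 ^ j := by
  have h1 := summable_pow_mul_geometric_of_norm_lt_one 1 (r := (1 / 2 : ℝ)) (by norm_num)
  have h2 := summable_geometric_of_lt_one (r := (1 / 2 : ℝ)) (by norm_num) (by norm_num)
  refine (h1.add h2).congr fun j => ?_
  rw [pow_one, one_div, inv_pow]
  field_simp

/-- By Tonelli the j-th term integrates to an average of translation distances over a cube of
half-side a / 2^j, at most B (j + 1)/2^j. This series converges, so summing over all scales instead
of taking a supremum costs only a constant. -/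
lemma lintegral_oscMax_le (hg : Measurable g) {a B : ℝ} (ha : 0 < a) (hB : 0 ≤ B)
    (h : ShiftBound g a B) :
    ∫⁻ z, oscMax g a z ≤ ENNReal.ofReal (B * ∑' j : ℕ, ((j : ℝ) + 1) / 2 ^ j) := by
  have hm : Measurable fun p : EuclideanSpace ℝ ι × EuclideanSpace ℝ ι => ‖g (p.1 + p.2) - g p.1‖ₑ :=
    by fun_prop
  rw [← tsum_mul_left, ENNReal.ofReal_tsum_of_nonneg (fun j => mul_nonneg hB (by positivity))
    (summable_succ_div_two_pow.mul_left B)]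
  simp only [oscMax]
  rw [lintegral_tsum fun j => ((hm.lintegral_prod_right').const_mul _).aemeasurable]
  refine ENNReal.tsum_le_tsum fun j => ?_
  have hv0 : volume (cube ι (a / 2 ^ j)) ≠ 0 := by
    rw [volume_cube]
    exact pow_ne_zero _ (by simpa using by positivity)
  have hvt : volume (cube ι (a / 2 ^ j)) ≠ ∞ := by
    rw [volume_cube]
    exact ENNReal.pow_ne_top ENNReal.ofReal_ne_top
  rw [lintegral_const_mul _ hm.lintegral_prod_right', lintegral_lintegral_swap hm.aemeasurable]
  calc _ ≤ (volume (cube ι (a / 2 ^ j)))⁻¹ * ∫⁻ h in cube ι (a / 2 ^ j),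
          ENNReal.ofReal (B * ((j + 1) / 2 ^ j)) := by
        gcongr 1
        exact setLIntegral_mono measurable_const fun u hu => h j u hu
    _ = _ := by
        rw [setLIntegral_const, mul_comm _ (volume _), ← mul_assoc, ENNReal.inv_mul_cancel hv0 hvt,
          one_mul]

/-- Enlarge the cube to the dyadic one with r ≤ a / 2^j < 2r; its side is at most 4r, and its mean
oscillation is one term of the series. -/
lemma lintegral_cube_le_oscMax {a r : ℝ} (hr : 0 < r) (hra : r ≤ a) (z : EuclideanSpace ℝ ι) :
    ∫⁻ h in cube ι r, ‖g (z + h) - g z‖ₑ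
      ≤ ENNReal.ofReal ((4 * r) ^ Fintype.card ι) * oscMax g a z := by
  obtain ⟨j, hj1, hj2⟩ := exists_nat_pow_near (x := a / r) (y := 2)
    (by rwa [le_div_iff₀ hr, one_mul]) (by norm_num)
  have hp : (0 : ℝ) < 2 ^ j := by positivity
  have ha : 0 < a := hr.trans_le hra
  rw [le_div_iff₀ hr] at hj1
  rw [div_lt_iff₀ hr, pow_succ] at hj2
  have hrj : r ≤ a / 2 ^ j := by
    rw [le_div_iff₀ hp]
    linarith
  have hv0 : volume (cube ι (a / 2 ^ j)) ≠ 0 := by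
    rw [volume_cube]
    exact pow_ne_zero _ (by simpa using by positivity)
  have hvt : volume (cube ι (a / 2 ^ j)) ≠ ∞ := by
    rw [volume_cube]
    exact ENNReal.pow_ne_top ENNReal.ofReal_ne_top
  calc ∫⁻ h in cube ι r, ‖g (z + h) - g z‖ₑ
      ≤ ∫⁻ h in cube ι (a / 2 ^ j), ‖g (z + h) - g z‖ₑ :=
        lintegral_mono_set fun h hh i => (hh i).trans hrj
    _ = volume (cube ι (a / 2 ^ j)) * ((volume (cube ι (a / 2 ^ j)))⁻¹
          * ∫⁻ h in cube ι (a / 2 ^ j), ‖g (z + h) - g z‖ₑ) := by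
        rw [← mul_assoc, ENNReal.mul_inv_cancel hv0 hvt, one_mul]
    _ ≤ _ := by
        gcongr
        · rw [volume_cube, ← ENNReal.ofReal_pow (by positivity)]
          apply ENNReal.ofReal_le_ofReal
          have : 2 * (a / 2 ^ j) ≤ 4 * r := by
            rw [mul_div_assoc', div_le_iff₀ hp]
            linarith
          exact pow_le_pow_left₀ (by positivity) this _
        · exact ENNReal.le_tsum (f := fun j : ℕ => (volume (cube ι (a / 2 ^ j)))⁻¹
            * ∫⁻ h in cube ι (a / 2 ^ j), ‖g (z + h) - g z‖ₑ) j

lemma abs_setIntegral_sub_le {a r : ℝ} (hr : 0 < r) (hra : r ≤ a) {z : EuclideanSpace ℝ ι}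
    (hg : Integrable g) (hM : oscMax g a z ≠ ∞) {S : Set (EuclideanSpace ℝ ι)}
    (hSr : ∀ w ∈ S, ∀ i, |w i - z i| ≤ r) :
    |(∫ w in S, g w) - (volume S).toReal * g z|
      ≤ (4 * r) ^ Fintype.card ι * (oscMax g a z).toReal := by
  have hpre : (fun w => z + w) ⁻¹' S ⊆ cube ι r := by
    intro w hw i
    simpa using hSr _ hw i
  have hSt : volume S ≠ ∞ := by
    rw [← measure_preimage_add volume z S]
    refine ne_top_of_le_ne_top ?_ (measure_mono hpre)
    rw [volume_cube]
    exact ENNReal.pow_ne_top ENNReal.ofReal_ne_top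
  have h1 : (∫ w in S, g w) - (volume S).toReal * g z = ∫ w in S, (g w - g z) := by
    rw [integral_sub hg.integrableOn (integrableOn_const hSt), setIntegral_const, smul_eq_mul]
    rfl
  rw [h1, ← Real.norm_eq_abs]
  have h2 : ∫⁻ w in S, ‖g w - g z‖ₑ ≤ ENNReal.ofReal ((4 * r) ^ Fintype.card ι) * oscMax g a z := by
    rw [← (measurePreserving_add_left volume z).setLIntegral_comp_preimage_emb
      (MeasurableEquiv.addLeft z).measurableEmbedding]
    exact (lintegral_mono_set hpre).trans (lintegral_cube_le_oscMax hr hra z)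
  have h3 := (norm_integral_le_lintegral_norm (μ := volume.restrict S) (fun w => g w - g z))
  simp only [ofReal_norm] at h3
  refine h3.trans ?_
  refine (ENNReal.toReal_mono (ENNReal.mul_ne_top ENNReal.ofReal_ne_top hM) h2).trans_eq ?_
  rw [ENNReal.toReal_mul, ENNReal.toReal_ofReal (by positivity)]

lemma PiecewiseSmooth.integrable (hg : PiecewiseSmooth g c C Cd) : Integrable g :=
  (lintegral_ofReal_ne_top_iff_integrable hg.measurable.aestronglyMeasurable
    (ae_of_all _ hg.nonneg)).1 hg.lintegral_ne_top

lemma abs_log_sub_log_le {x y m : ℝ} (hm : 0 < m) (hx : m ≤ x) (hy : m ≤ y) :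
    |Real.log x - Real.log y| ≤ |x - y| / m := by
  have key : ∀ x y : ℝ, m ≤ x → m ≤ y → Real.log x - Real.log y ≤ |x - y| / m := by
    intro x y hx hy
    have hx0 := hm.trans_le hx
    have hy0 := hm.trans_le hy
    rw [← Real.log_div hx0.ne' hy0.ne']
    refine (Real.log_le_sub_one_of_pos (by positivity)).trans ?_
    rw [div_sub_one hy0.ne']
    refine (div_le_div_of_nonneg_right (le_abs_self _) hy0.le).trans ?_
    gcongr
  refine abs_le.2 ⟨?_, key x y hx hy⟩
  have := key y x hy hx
  rw [abs_sub_comm] at this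
  linarith

/-- The mass of a small region around a point at which the support of `g` has small mean
oscillation. -/
lemma PiecewiseSmooth.setIntegral_bounds (hg : PiecewiseSmooth g c C Cd) {a r v : ℝ} (hr : 0 < r)
    (hra : r ≤ a) (hv : 0 < v) {z : EuclideanSpace ℝ ι} (hz : c ≤ g z)
    (hM : oscMax g a z ≠ ∞)
    (hMA : 4 ^ Fintype.card ι * oscMax (Set.indicator {z | 0 < g z} fun _ => (1 : ℝ)) a z
      ≤ ENNReal.ofReal (v / 2))
    {S : Set (EuclideanSpace ℝ ι)} (hSr : ∀ w ∈ S, ∀ i, |w i - z i| ≤ r)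
    (hSv : volume S = ENNReal.ofReal (v * r ^ Fintype.card ι)) :
    c * v / 2 * r ^ Fintype.card ι ≤ ∫ w in S, g w ∧
    ∫ w in S, g w ≤ C * v * r ^ Fintype.card ι ∧
    |Real.log (∫ w in S, g w) - Real.log (v * g z * r ^ Fintype.card ι)|
      ≤ 2 * 4 ^ Fintype.card ι / (c * v) * (oscMax g a z).toReal := by
  have hc := hg.pos
  set A : Set (EuclideanSpace ℝ ι) := {z | 0 < g z} with hA
  have hAm : MeasurableSet A := measurableSet_lt measurable_const hg.measurable
  set n := Fintype.card ι with hn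
  have hSreal : (volume S).toReal = v * r ^ n := by rw [hSv, ENNReal.toReal_ofReal (by positivity)]
  have hSt : volume S ≠ ∞ := by rw [hSv]; exact ENNReal.ofReal_ne_top
  have hMAt : oscMax (A.indicator fun _ => (1 : ℝ)) a z ≠ ∞ := by
    intro h
    rw [h, ENNReal.mul_top (by positivity)] at hMA
    exact ENNReal.ofReal_ne_top (top_le_iff.1 hMA)
  have hMAr : 4 ^ n * (oscMax (A.indicator fun _ => (1 : ℝ)) a z).toReal ≤ v / 2 := by
    have := ENNReal.toReal_mono ENNReal.ofReal_ne_top hMA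
    rwa [ENNReal.toReal_mul, ENNReal.toReal_pow, ENNReal.toReal_ofReal (by positivity)] at this
  have hAint : Integrable (A.indicator fun _ => (1 : ℝ)) :=
    (integrable_indicator_iff hAm).2 (integrableOn_const hg.volume_pos_ne_top)
  have h1 := abs_setIntegral_sub_le hr hra hAint hMAt hSr
  have hzA : z ∈ A := hc.trans_le hz
  rw [Set.indicator_of_mem hzA, mul_one, hSreal] at h1
  have hrn : 0 < r ^ n := by positivity
  -- Since z lies in the support, small oscillation of the support's indicator makes the support
  -- fill at least half of S. As g ≥ c there, the mass of S is bounded below whatever the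
  -- oscillation of g itself, and the logarithm can be treated as Lipschitz.
  have hlow : v / 2 * r ^ n ≤ ∫ w in S, A.indicator (fun _ => (1 : ℝ)) w := by
    have h2 := (abs_le.1 h1).1
    rw [mul_pow] at h2
    nlinarith
  have hb1 : c * v / 2 * r ^ n ≤ ∫ w in S, g w := by
    calc c * v / 2 * r ^ n = c * (v / 2 * r ^ n) := by ring
      _ ≤ c * ∫ w in S, A.indicator (fun _ => (1 : ℝ)) w := by gcongr
      _ = ∫ w in S, c * A.indicator (fun _ => (1 : ℝ)) w := (integral_const_mul _ _).symm
      _ ≤ ∫ w in S, g w := by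
        refine integral_mono_ae (hAint.integrableOn.const_mul c) hg.integrable.integrableOn ?_
        filter_upwards [ae_restrict_of_ae hg.dichotomy] with w hw
        by_cases hwA : w ∈ A
        · rw [Set.indicator_of_mem hwA, mul_one]
          exact hw.resolve_left (ne_of_gt hwA)
        · rw [Set.indicator_of_notMem hwA, mul_zero]
          exact hg.nonneg w
  refine ⟨hb1, ?_, ?_⟩
  · calc ∫ w in S, g w ≤ ∫ _ in S, C :=
        integral_mono_ae hg.integrable.integrableOn (integrableOn_const hSt)
          (ae_restrict_of_ae hg.le)
      _ = C * v * r ^ n := by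
        rw [setIntegral_const, smul_eq_mul, measureReal_def, hSreal]
        ring
  · have h3 := abs_setIntegral_sub_le hr hra hg.integrable hM hSr
    rw [hSreal] at h3
    have hb2 : c * v / 2 * r ^ n ≤ v * g z * r ^ n := by
      gcongr ?_ * _
      have : c * v ≤ v * g z := by nlinarith
      have : 0 < c * v := by positivity
      linarith
    refine (abs_log_sub_log_le (by positivity) hb1 hb2).trans ?_
    rw [div_le_iff₀ (by positivity)]
    calc _ = |(∫ w in S, g w) - v * r ^ n * g z| := by congr 2; ring
      _ ≤ _ := h3
      _ = _ := by rw [mul_pow, ← hn]; field_simp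

end Oscillation

section BinomialBeta

/-! ### Binomial and Beta computations -/

/-- The sum `∑ b, binom(m, b) p^b s^(m-b) h(b)`. -/
def binomSum (m : ℕ) (p s : ℝ) (h : ℕ → ℝ) : ℝ :=
  ∑ b ∈ Finset.range (m + 1), (m.choose b : ℝ) * p ^ b * s ^ (m - b) * h b

lemma binomSum_one (m : ℕ) (p s : ℝ) : binomSum m p s (fun _ => 1) = (p + s) ^ m := by
  rw [binomSum, add_pow]
  refine Finset.sum_congr rfl fun b _ => by ring

lemma binomSum_mono {m : ℕ} {p s : ℝ} (hp : 0 ≤ p) (hs : 0 ≤ s) {h h' : ℕ → ℝ}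
    (hh : ∀ b, h b ≤ h' b) : binomSum m p s h ≤ binomSum m p s h' := by
  refine Finset.sum_le_sum fun b _ => ?_
  have := hh b
  gcongr

lemma binomSum_const_mul (m : ℕ) (p s c : ℝ) (h : ℕ → ℝ) :
    binomSum m p s (fun b => c * h b) = c * binomSum m p s h := by
  rw [binomSum, binomSum, Finset.mul_sum]
  refine Finset.sum_congr rfl fun b _ => by ring

/-- The identity (b + 1) C(m+1, b+1) = (m + 1) C(m, b) turns the left side into the binomial
expansion of (p + s)^(m+1) without its first term. -/
lemma mul_binomSum_inv_succ_le (m : ℕ) {p s : ℝ} (hs : 0 ≤ s) :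
    (m + 1) * p * binomSum m p s (fun b => 1 / ((b : ℝ) + 1)) ≤ (p + s) ^ (m + 1) := by
  rw [add_pow, Finset.sum_range_succ', binomSum, Finset.mul_sum]
  refine le_add_of_le_of_nonneg (le_of_eq ?_) (by simp; positivity)
  refine Finset.sum_congr rfl fun b hb => ?_
  have h1 : ((m + 1).choose (b + 1) : ℝ) * (b + 1) = (m + 1) * m.choose b := by
    exact_mod_cast (Nat.add_one_mul_choose_eq m b).symm
  have hb0 : (b : ℝ) + 1 ≠ 0 := by positivity
  have h2 : ((m + 1).choose (b + 1) : ℝ) = (m + 1) * m.choose b / (b + 1) := by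
    rw [eq_div_iff hb0, h1]
  rw [h2, Nat.add_sub_add_right]
  field_simp
  ring

/-- The exact value has m in place of m + 1. The weaker form lets one normalisation serve both this
bound and `mul_binomSum_inv_succ_le`. -/
lemma mul_binomSum_id_le (m : ℕ) {p s : ℝ} (hp : 0 ≤ p) (hs : 0 ≤ s) :
    (p + s) * binomSum m p s (fun b => (b : ℝ)) ≤ (m + 1) * p * (p + s) ^ m := by
  have h : binomSum m p s (fun b => (b : ℝ)) = m * p * (p + s) ^ (m - 1) := by
    rcases m with _ | m
    · simp [binomSum]
    rw [binomSum, Finset.sum_range_succ', Nat.add_sub_cancel, add_pow, Finset.mul_sum]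
    simp only [Nat.cast_zero, mul_zero, add_zero]
    refine Finset.sum_congr rfl fun b hb => ?_
    have h1 : ((m + 1).choose (b + 1) : ℝ) * (b + 1) = (m + 1) * m.choose b := by
      exact_mod_cast (Nat.add_one_mul_choose_eq m b).symm
    rw [Nat.add_sub_add_right]
    push_cast
    calc _ = ((m + 1).choose (b + 1) : ℝ) * (b + 1) * p ^ (b + 1) * s ^ (m - b) := by ring
      _ = _ := by rw [h1]; ring
  rw [h]
  rcases m with _ | m
  · simp
    positivity
  · rw [Nat.add_sub_cancel]
    have : 0 ≤ p * (p + s) ^ (m + 1) := by positivity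
    calc _ = ((m + 1 : ℕ) : ℝ) * (p * (p + s) ^ (m + 1)) := by ring
      _ ≤ (((m + 1 : ℕ) : ℝ) + 1) * (p * (p + s) ^ (m + 1)) := by gcongr; linarith
      _ = _ := by ring

lemma integral_pow_mul_one_sub_pow (k m : ℕ) :
    ∫ u in (0 : ℝ)..1, u ^ k * (1 - u) ^ m = 1 / ((k + 1) * (k + m + 1).choose m) := by
  induction m generalizing k with
  | zero => simp [integral_pow]
  | succ m ih =>
    have h1 : ∫ u in (0 : ℝ)..1, ((k + 1) * (u ^ k * (1 - u) ^ (m + 1))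
        - (m + 1) * (u ^ (k + 1) * (1 - u) ^ m)) = 0 := by
      rw [intervalIntegral.integral_eq_sub_of_hasDerivAt
        (f := fun u : ℝ => u ^ (k + 1) * (1 - u) ^ (m + 1))]
      · simp
      · intro u _
        have h2 := (hasDerivAt_pow (k + 1) u).mul ((((hasDerivAt_id u).const_sub 1)).pow (m + 1))
        refine h2.congr_deriv ?_
        simp
        ring
      · exact Continuous.intervalIntegrable (by fun_prop) _ _
    rw [intervalIntegral.integral_sub (Continuous.intervalIntegrable (by fun_prop) _ _)
      (Continuous.intervalIntegrable (by fun_prop) _ _), intervalIntegral.integral_const_mul,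
      intervalIntegral.integral_const_mul, ih (k + 1)] at h1
    have h3 : ((k + (m + 1) + 1).choose (m + 1) : ℝ) * (m + 1)
        = (k + (m + 1) + 1).choose m * (k + 1 + 1) := by
      have := Nat.choose_succ_right_eq (k + (m + 1) + 1) m
      rw [show k + (m + 1) + 1 - m = k + 1 + 1 by omega] at this
      exact_mod_cast this
    rw [show k + 1 + m + 1 = k + (m + 1) + 1 by ring] at h1
    have hc1 : (0 : ℝ) < (k + (m + 1) + 1).choose m := by
      exact_mod_cast Nat.choose_pos (by omega)
    have hc2 : (0 : ℝ) < (k + (m + 1) + 1).choose (m + 1) := by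
      exact_mod_cast Nat.choose_pos (by omega)
    have hk : (0 : ℝ) < k + 1 := by positivity
    rw [sub_eq_zero] at h1
    rw [eq_div_iff (by positivity)]
    push_cast at h1
    calc _ = ((k + 1) * ∫ u in (0 : ℝ)..1, u ^ k * (1 - u) ^ (m + 1))
          * (k + (m + 1) + 1).choose (m + 1) := by ring
      _ = ((k + (m + 1) + 1).choose (m + 1) * (m + 1))
          * (1 / ((k + 1 + 1) * (k + (m + 1) + 1).choose m)) := by rw [h1]; ring
      _ = 1 := by rw [h3]; field_simp

lemma intervalIntegrable_mul_log {g : ℝ → ℝ} (hg : Continuous g) :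
    IntervalIntegrable (fun u => g u * Real.log u) volume 0 1 :=
  intervalIntegral.intervalIntegrable_log'.continuousOn_mul hg.continuousOn

/-- The expected logarithm of a Beta variable with integer parameters. -/
lemma integral_pow_mul_one_sub_pow_mul_log (k m : ℕ) :
    ∫ u in (0 : ℝ)..1, u ^ k * (1 - u) ^ m * Real.log u
      = -(1 / ((k + 1) * (k + m + 1).choose m) * ∑ j ∈ Finset.range (m + 1), 1 / ((k : ℝ) + 1 + j)) := by
  have hder : ∀ (k m : ℕ) (u : ℝ), 0 < u →
      HasDerivAt (fun u : ℝ => u ^ (k + 1) * (1 - u) ^ m * Real.log u)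
        ((k + 1) * (u ^ k * (1 - u) ^ m * Real.log u)
          - m * (u ^ (k + 1) * (1 - u) ^ (m - 1) * Real.log u) + u ^ k * (1 - u) ^ m) u := by
    intro k m u hu
    have h2 := ((hasDerivAt_pow (k + 1) u).mul ((((hasDerivAt_id u).const_sub 1)).pow m)).mul
      (Real.hasDerivAt_log hu.ne')
    refine h2.congr_deriv ?_
    simp
    field_simp
    ring
  -- One factor u is attached to the logarithm, since u log u is continuous at 0; the integration by
  -- parts then needs no limiting argument at the endpoint.
  have hcont : ∀ k m : ℕ, Continuous (fun u : ℝ => u ^ (k + 1) * (1 - u) ^ m * Real.log u) := by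
    intro k m
    have : (fun u : ℝ => u ^ (k + 1) * (1 - u) ^ m * Real.log u)
        = fun u => u ^ k * (1 - u) ^ m * (u * Real.log u) := by ext u; ring
    rw [this]
    exact (by fun_prop : Continuous fun u : ℝ => u ^ k * (1 - u) ^ m).mul Real.continuous_mul_log
  have hparts : ∀ k m : ℕ, (k + 1) * (∫ u in (0 : ℝ)..1, u ^ k * (1 - u) ^ m * Real.log u)
      - m * (∫ u in (0 : ℝ)..1, u ^ (k + 1) * (1 - u) ^ (m - 1) * Real.log u)
      + ∫ u in (0 : ℝ)..1, u ^ k * (1 - u) ^ m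
      = 0 := by
    intro k m
    have i1 : IntervalIntegrable (fun u : ℝ => (k + 1) * (u ^ k * (1 - u) ^ m * Real.log u))
        volume 0 1 := (intervalIntegrable_mul_log (by fun_prop)).const_mul _
    have i2 : IntervalIntegrable (fun u : ℝ => m * (u ^ (k + 1) * (1 - u) ^ (m - 1) * Real.log u))
        volume 0 1 := (intervalIntegrable_mul_log (by fun_prop)).const_mul _
    have i3 : IntervalIntegrable (fun u : ℝ => u ^ k * (1 - u) ^ m) volume 0 1 :=
      Continuous.intervalIntegrable (by fun_prop) _ _
    rw [← intervalIntegral.integral_const_mul, ← intervalIntegral.integral_const_mul,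
      ← intervalIntegral.integral_sub i1 i2, ← intervalIntegral.integral_add (i1.sub i2) i3,
      intervalIntegral.integral_eq_sub_of_hasDerivAt_of_le zero_le_one (hcont k m).continuousOn
        (fun u hu => hder k m u hu.1) ((i1.sub i2).add i3)]
    simp
  induction m generalizing k with
  | zero =>
    have h1 := hparts k 0
    rw [integral_pow_mul_one_sub_pow] at h1
    have hk : (0 : ℝ) < k + 1 := by positivity
    simp at h1 ⊢
    field_simp at h1 ⊢
    linarith
  | succ m ih =>
    have h1 := hparts k (m + 1)
    rw [Nat.add_sub_cancel, ih (k + 1), integral_pow_mul_one_sub_pow] at h1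
    have h3 : ((k + (m + 1) + 1).choose (m + 1) : ℝ) * (m + 1)
        = (k + (m + 1) + 1).choose m * (k + 1 + 1) := by
      have := Nat.choose_succ_right_eq (k + (m + 1) + 1) m
      rw [show k + (m + 1) + 1 - m = k + 1 + 1 by omega] at this
      exact_mod_cast this
    rw [show k + 1 + m + 1 = k + (m + 1) + 1 by ring] at h1
    have hc1 : (0 : ℝ) < (k + (m + 1) + 1).choose m := by
      exact_mod_cast Nat.choose_pos (by omega)
    have hc2 : (0 : ℝ) < (k + (m + 1) + 1).choose (m + 1) := by
      exact_mod_cast Nat.choose_pos (by omega)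
    have hk : (0 : ℝ) < k + 1 := by positivity
    rw [Finset.sum_range_succ']
    have hsum : ∑ j ∈ Finset.range (m + 1), 1 / (((k + 1 : ℕ) : ℝ) + 1 + j)
        = ∑ j ∈ Finset.range (m + 1), 1 / ((k : ℝ) + 1 + ((j + 1 : ℕ) : ℝ)) := by
      refine Finset.sum_congr rfl fun j _ => ?_
      push_cast
      congr 1
      ring
    rw [hsum] at h1
    set tail := ∑ j ∈ Finset.range (m + 1), 1 / ((k : ℝ) + 1 + ((j + 1 : ℕ) : ℝ))
    push_cast at h1 ⊢
    have hq : ((m : ℝ) + 1) * (1 / ((k + 1 + 1) * (k + (m + 1) + 1).choose m))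
        = 1 / (k + (m + 1) + 1).choose (m + 1) := by
      rw [mul_one_div, div_eq_div_iff (by positivity) (by positivity), one_mul, mul_comm, h3]
      ring
    have h4 : (k + 1) * (∫ u in (0 : ℝ)..1, u ^ k * (1 - u) ^ (m + 1) * Real.log u)
        = -((((m : ℝ) + 1) * (1 / ((k + 1 + 1) * (k + (m + 1) + 1).choose m))) * tail)
          - 1 / ((k + 1) * (k + (m + 1) + 1).choose (m + 1)) := by
      linarith
    rw [hq] at h4
    rw [← mul_right_inj' hk.ne', h4]
    field_simp
    ring

end BinomialBeta

section OrderStatistics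

/-! ### Order statistics of an i.i.d. sample -/

variable {E : Type*} [MeasurableSpace E] {κ : Type*} [Fintype κ]

/-- The number of sample points with `D ≤ r`. -/
noncomputable def countLE (D : E → ℝ) (w : κ → E) (r : ℝ) : ℕ :=
  (Finset.univ.filter fun j => D (w j) ≤ r).card

/-- The `k`-th smallest value of `D` on the sample. -/
noncomputable def kthDist (D : E → ℝ) (k : ℕ) (w : κ → E) : ℝ :=
  sInf {r : ℝ | 0 ≤ r ∧ k ≤ countLE D w r}

/-- The largest value of `D` on the sample. -/
noncomputable def maxDist (D : E → ℝ) (w : κ → E) : ℝ := ⨆ j, D (w j)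

lemma le_maxDist (D : E → ℝ) (w : κ → E) (j : κ) : D (w j) ≤ maxDist D w :=
  le_ciSup (f := fun j => D (w j)) (Set.finite_range _).bddAbove j

lemma measurable_maxDist {D : E → ℝ} (hD : Measurable D) :
    Measurable (maxDist D : (κ → E) → ℝ) :=
  Measurable.iSup fun j => hD.comp (measurable_pi_apply j)

lemma measurable_countLE {D : E → ℝ} (hD : Measurable D) :
    Measurable fun q : (κ → E) × ℝ => countLE D q.1 q.2 := by
  simp only [countLE, Finset.card_filter]
  refine Finset.measurable_sum _ fun j _ => Measurable.ite ?_ measurable_const measurable_const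
  exact measurableSet_le (by fun_prop) measurable_snd

variable {μ : Measure E} [IsProbabilityMeasure μ]

/-- Two independent copies of a variable without atoms almost surely differ, by Fubini on the
diagonal. The absence of ties makes the set of k nearest points unique. -/
lemma ae_injective_of_noAtoms {D : E → ℝ} (hD : Measurable D) (hatom : ∀ r, μ {x | D x = r} = 0) :
    ∀ᵐ w ∂(Measure.pi fun _ : κ => μ), Function.Injective fun j => D (w j) := by
  have hind : iIndepFun (fun (j : κ) (w : κ → E) => D (w j)) (Measure.pi fun _ : κ => μ) :=
    iIndepFun_pi fun _ => hD.aemeasurable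
  have hmap : ∀ j : κ, (Measure.pi fun _ : κ => μ).map (fun w => D (w j)) = μ.map D := by
    intro j
    have h1 := Measure.map_map (μ := Measure.pi fun _ : κ => μ) (f := fun w : κ → E => w j) hD
      (measurable_pi_apply j)
    exact h1.symm.trans (congrArg (Measure.map D) (measurePreserving_eval (fun _ : κ => μ) j).map_eq)
  have : ∀ i j : κ, ∀ᵐ w ∂(Measure.pi fun _ : κ => μ), D (w i) = D (w j) → i = j := by
    intro i j
    by_cases hij : i = j
    · exact ae_of_all _ fun _ _ => hij
    have hmi : ∀ j : κ, Measurable fun w : κ → E => D (w j) := fun j => by fun_prop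
    have h1 := (indepFun_iff_map_prod_eq_prod_map_map (hmi i).aemeasurable
      (hmi j).aemeasurable).1 (hind.indepFun hij)
    rw [hmap, hmap] at h1
    have h2 : ((μ.map D).prod (μ.map D)) {q : ℝ × ℝ | q.1 = q.2} = 0 := by
      rw [Measure.measure_prod_null (measurableSet_eq_fun measurable_fst measurable_snd)]
      refine ae_of_all _ fun x => ?_
      have : Prod.mk x ⁻¹' {q : ℝ × ℝ | q.1 = q.2} = {x} := by
        ext y
        simp [eq_comm]
      change (μ.map D) (Prod.mk x ⁻¹' {q : ℝ × ℝ | q.1 = q.2}) = 0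
      rw [this, Measure.map_apply hD (measurableSet_singleton x)]
      exact hatom x
    rw [← h1, Measure.map_apply ((hmi i).prodMk (hmi j))
      (measurableSet_eq_fun measurable_fst measurable_snd)] at h2
    filter_upwards [measure_eq_zero_iff_ae_notMem.1 h2] with w hw heq
    exact absurd heq hw
  filter_upwards [ae_all_iff.2 fun i => ae_all_iff.2 (this i)] with w hw i j hij
  exact hw i j hij

variable [DecidableEq κ]

/-- The sample points in `J` are closer than all the others. -/
def Nearest (D : E → ℝ) (w : κ → E) (J : Finset κ) : Prop :=
  ∀ j : {j // ¬ j ∈ J}, maxDist D (fun i : {i // i ∈ J} => w i) < D (w j)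

lemma Nearest.lt {D : E → ℝ} {w : κ → E} {J : Finset κ} (h : Nearest D w J) {i j : κ} (hi : i ∈ J)
    (hj : j ∉ J) : D (w i) < D (w j) :=
  (le_maxDist D (fun i : {i // i ∈ J} => w i) ⟨i, hi⟩).trans_lt (h ⟨j, hj⟩)

lemma Nearest.eq {D : E → ℝ} {w : κ → E} {J J' : Finset κ} (h : Nearest D w J)
    (h' : Nearest D w J') (hc : J.card = J'.card) : J = J' := by
  by_contra hne
  have h1 : ∃ i ∈ J, i ∉ J' := by
    by_contra! hsub
    exact hne (Finset.eq_of_subset_of_card_le hsub hc.ge)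
  have h2 : ∃ j ∈ J', j ∉ J := by
    by_contra! hsub
    exact hne (Finset.eq_of_subset_of_card_le hsub hc.le).symm
  obtain ⟨i, hi, hi'⟩ := h1
  obtain ⟨j, hj, hj'⟩ := h2
  exact lt_asymm (h.lt hi hj') (h'.lt hj hi')

/-- Take the k-subset minimising the sum of distances: if an outside point were closer than the
farthest inside one, exchanging them would lower the sum. -/
lemma exists_nearest {D : E → ℝ} {w : κ → E} (hinj : Function.Injective fun j => D (w j)) {k : ℕ}
    (hk : 1 ≤ k) (hkn : k ≤ Fintype.card κ) : ∃ J : Finset κ, J.card = k ∧ Nearest D w J := by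
  obtain ⟨J, hJ, hmin⟩ := Finset.exists_min_image (Finset.powersetCard k (Finset.univ : Finset κ))
    (fun J => ∑ j ∈ J, D (w j)) (Finset.powersetCard_nonempty.2 (by simpa using hkn))
  have hcard := (Finset.mem_powersetCard.1 hJ).2
  refine ⟨J, hcard, fun j => ?_⟩
  obtain ⟨j, hj⟩ := j
  have hne : Nonempty {i // i ∈ J} := by
    obtain ⟨i, hi⟩ := Finset.card_pos.1 (hcard ▸ hk)
    exact ⟨⟨i, hi⟩⟩
  obtain ⟨⟨i, hi⟩, hmax⟩ := exists_eq_ciSup_of_finite (f := fun i : {i // i ∈ J} => D (w i))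
  have hij : i ≠ j := fun h => hj (h ▸ hi)
  rw [maxDist, ← hmax]
  by_contra hlt
  have hlt' : D (w j) < D (w i) := lt_of_le_of_ne (not_lt.1 hlt) fun h => hij (hinj h).symm
  have hj' : j ∉ J.erase i := fun h => hj (Finset.mem_of_mem_erase h)
  have h1 := hmin (insert j (J.erase i)) (by
    rw [Finset.mem_powersetCard]
    refine ⟨Finset.subset_univ _, ?_⟩
    rw [Finset.card_insert_of_notMem hj', Finset.card_erase_of_mem hi]
    omega)
  have h2 := Finset.add_sum_erase J (fun j => D (w j)) hi
  rw [Finset.sum_insert hj'] at h1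
  linarith

lemma Nearest.kthDist_eq {D : E → ℝ} (hD0 : ∀ x, 0 ≤ D x) {w : κ → E} {J : Finset κ} {k : ℕ}
    (hk : 1 ≤ k) (hJ : J.card = k) (h : Nearest D w J) :
    kthDist D k w = maxDist D (fun i : {i // i ∈ J} => w i) := by
  have hne : Nonempty {i // i ∈ J} := by
    obtain ⟨i, hi⟩ := Finset.card_pos.1 (hJ ▸ hk)
    exact ⟨⟨i, hi⟩⟩
  refine IsLeast.csInf_eq ⟨⟨Real.iSup_nonneg fun j => hD0 _, ?_⟩, ?_⟩
  · rw [← hJ]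
    refine Finset.card_le_card fun j hj => ?_
    rw [Finset.mem_filter]
    exact ⟨Finset.mem_univ _, le_maxDist D (fun i : {i // i ∈ J} => w i) ⟨j, hj⟩⟩
  · rintro r ⟨_, hr⟩
    by_contra hlt
    rw [not_le] at hlt
    obtain ⟨⟨i, hi⟩, hmax⟩ := exists_eq_ciSup_of_finite (f := fun i : {i // i ∈ J} => D (w i))
    have hsub : (Finset.univ.filter fun j => D (w j) ≤ r) ⊂ J := by
      refine Finset.ssubset_iff_subset_ne.2 ⟨fun j hj => ?_, fun heq => ?_⟩
      · by_contra hjJ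
        exact absurd ((h ⟨j, hjJ⟩).trans_le (Finset.mem_filter.1 hj).2) hlt.not_gt
      · rw [← heq] at hi
        have h1 := (Finset.mem_filter.1 hi).2
        rw [maxDist, ← hmax] at hlt
        exact absurd h1 (not_le.2 hlt)
    have := Finset.card_lt_card hsub
    rw [hJ] at this
    exact absurd hr (not_le.2 this)

lemma Nearest.countLE_eq {D D' : E → ℝ} (hDD : ∀ x, D' x ≤ D x) {w : κ → E} {J : Finset κ} :
    countLE D' w (maxDist D (fun i : {i // i ∈ J} => w i))
      = J.card + countLE D' (fun j : {j // ¬ j ∈ J} => w j)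
          (maxDist D (fun i : {i // i ∈ J} => w i)) := by
  set R := maxDist D (fun i : {i // i ∈ J} => w i)
  rw [countLE, ← Finset.card_filter_add_card_filter_not (s := Finset.univ.filter fun j => D' (w j) ≤ R)
    (fun j => j ∈ J)]
  congr 1
  · congr 1
    ext j
    simp only [Finset.mem_filter, Finset.mem_univ, true_and, and_iff_right_iff_imp]
    exact fun hj => (hDD _).trans (le_maxDist D (fun i : {i // i ∈ J} => w i) ⟨j, hj⟩)
  · rw [countLE]
    symm
    refine Finset.card_bij (fun j _ => (j : κ)) ?_ ?_ ?_
    · intro j hj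
      simp only [Finset.mem_filter, Finset.mem_univ, true_and] at hj ⊢
      exact ⟨hj, j.2⟩
    · intro i _ j _ hij
      exact Subtype.ext hij
    · intro j hj
      simp only [Finset.mem_filter, Finset.mem_univ, true_and] at hj
      exact ⟨⟨j, hj.2⟩, by simpa using hj.1, rfl⟩

/-- Expand over the subset T of indices whose points fall in P. Each event is a product set, and
only the cardinality of T matters. The result is an unnormalised binomial law, as P and S need not
cover the space. -/
lemma lintegral_pi_count {P S : Set E} (hP : MeasurableSet P) (hS : MeasurableSet S)
    (hPS : Disjoint P S) (h : ℕ → ℝ≥0∞) [DecidablePred (· ∈ P)]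
    [∀ u : κ → E, Decidable (∀ j, u j ∈ P ∪ S)] :
    ∫⁻ u, (if ∀ j, u j ∈ P ∪ S then h (Finset.univ.filter fun j => u j ∈ P).card else 0)
        ∂(Measure.pi fun _ : κ => μ)
      = ∑ b ∈ Finset.range (Fintype.card κ + 1), ((Fintype.card κ).choose b : ℝ≥0∞)
          * (μ P ^ b * μ S ^ (Fintype.card κ - b)) * h b := by
  have hpt : ∀ u : κ → E,
      (if ∀ j, u j ∈ P ∪ S then h (Finset.univ.filter fun j => u j ∈ P).card else 0)
      = ∑ T ∈ (Finset.univ : Finset κ).powerset,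
          (Set.univ.pi fun j => if j ∈ T then P else S).indicator (fun _ => h T.card) u := by
    intro u
    split_ifs with hu
    · rw [Finset.sum_eq_single (Finset.univ.filter fun j => u j ∈ P)]
      · rw [Set.indicator_of_mem]
        intro j _
        by_cases hj : u j ∈ P
        · simp [hj]
        · have := (hu j).resolve_left hj
          simp [hj, this]
      · intro T _ hT
        refine Set.indicator_of_notMem (fun hmem => hT ?_) _
        ext j
        have hj := hmem j (Set.mem_univ j)
        simp only [Finset.mem_filter, Finset.mem_univ, true_and]
        constructor
        · intro hjT
          simpa [hjT] using hj
        · intro hjP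
          by_contra hjT
          simp only [hjT, if_false] at hj
          exact Set.disjoint_left.1 hPS hjP hj
      · intro h
        simp at h
    · symm
      refine Finset.sum_eq_zero fun T _ => Set.indicator_of_notMem (fun hmem => hu fun j => ?_) _
      have hj := hmem j (Set.mem_univ j)
      by_cases hjT : j ∈ T
      · simp only [hjT, if_true] at hj
        exact Or.inl hj
      · simp only [hjT, if_false] at hj
        exact Or.inr hj
  simp_rw [hpt]
  have hmeas : ∀ T : Finset κ, MeasurableSet (Set.univ.pi fun j => if j ∈ T then P else S) :=
    fun T => MeasurableSet.univ_pi fun j => by split_ifs <;> assumption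
  rw [lintegral_finsetSum _ fun T _ => measurable_const.indicator (hmeas T)]
  have hT : ∀ T ∈ (Finset.univ : Finset κ).powerset,
      ∫⁻ u, (Set.univ.pi fun j => if j ∈ T then P else S).indicator (fun _ => h T.card) u
        ∂(Measure.pi fun _ : κ => μ)
      = μ P ^ T.card * μ S ^ (Fintype.card κ - T.card) * h T.card := by
    intro T _
    rw [lintegral_indicator_const (hmeas T), Measure.pi_pi, mul_comm]
    congr 1
    have : ∀ j, μ (if j ∈ T then P else S) = if j ∈ T then μ P else μ S := fun j => by
      split_ifs <;> rfl
    simp_rw [this]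
    rw [Finset.prod_ite, Finset.prod_const, Finset.prod_const, Finset.filter_mem_eq_inter,
      Finset.univ_inter, Finset.filter_notMem_eq_sdiff, Finset.card_sdiff_of_subset
        (Finset.subset_univ T), Finset.card_univ]
  rw [Finset.sum_congr rfl hT, Finset.sum_powerset_apply_card
    (fun b => μ P ^ b * μ S ^ (Fintype.card κ - b) * h b), Finset.card_univ]
  refine Finset.sum_congr rfl fun b _ => ?_
  rw [nsmul_eq_mul]
  ring

/-- The joint law of the `k`-th smallest value of `D` and of the number of points with `D'` below
that value: given the `k` nearest points, the other points contribute a binomial count. -/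
theorem lintegral_kthDist_countLE {D D' : E → ℝ} (hD : Measurable D) (hD' : Measurable D')
    (hD0 : ∀ x, 0 ≤ D x) (hDD : ∀ x, D' x ≤ D x) (hatom : ∀ r, μ {x | D x = r} = 0) {k : ℕ}
    (hk : 1 ≤ k) (hkn : k ≤ Fintype.card κ) {G : ℝ × ℕ → ℝ≥0∞} (hG : Measurable G) :
    ∫⁻ w, G (kthDist D k w, countLE D' w (kthDist D k w)) ∂(Measure.pi fun _ : κ => μ)
      = ∑ J ∈ Finset.powersetCard k (Finset.univ : Finset κ),
          ∫⁻ v, ∑ b ∈ Finset.range (Fintype.card κ - k + 1),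
            ((Fintype.card κ - k).choose b : ℝ≥0∞)
              * (μ {x | maxDist D v < D x ∧ D' x ≤ maxDist D v} ^ b
                * μ {x | maxDist D v < D' x} ^ (Fintype.card κ - k - b)) * G (maxDist D v, k + b)
            ∂(Measure.pi fun _ : {j // j ∈ J} => μ) := by
  classical
  -- Almost surely exactly one J is the set of nearest points, so the integrand is the sum over J of
  -- its restrictions. On each piece the points of J fix the radius, and the others are independent
  -- of it, constrained to lie outside.
  set Φ : (J : Finset κ) → ({j // j ∈ J} → E) × ({j // ¬ j ∈ J} → E) → ℝ≥0∞ := fun J q =>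
    if ∀ j, maxDist D q.1 < D (q.2 j) then
      G (maxDist D q.1, k + countLE D' q.2 (maxDist D q.1)) else 0 with hΦ
  have hae : ∀ᵐ w ∂(Measure.pi fun _ : κ => μ),
      G (kthDist D k w, countLE D' w (kthDist D k w))
        = ∑ J ∈ Finset.powersetCard k (Finset.univ : Finset κ),
          Φ J (MeasurableEquiv.piEquivPiSubtypeProd (fun _ => E) (· ∈ J) w) := by
    filter_upwards [ae_injective_of_noAtoms hD hatom] with w hw
    obtain ⟨J, hJ, hnear⟩ := exists_nearest hw hk hkn
    rw [Finset.sum_eq_single J]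
    · have : ∀ j : {j // ¬ j ∈ J}, maxDist D (fun i : {i // i ∈ J} => w i) < D (w j) := hnear
      simp only [hΦ, MeasurableEquiv.piEquivPiSubtypeProd, MeasurableEquiv.coe_mk,
        Equiv.piEquivPiSubtypeProd_apply]
      rw [if_pos this, hnear.kthDist_eq hD0 hk hJ, Nearest.countLE_eq hDD, hJ]
    · intro J' hJ' hne
      simp only [hΦ, MeasurableEquiv.piEquivPiSubtypeProd, MeasurableEquiv.coe_mk,
        Equiv.piEquivPiSubtypeProd_apply]
      refine if_neg fun h => hne ?_
      have h' : Nearest D w J' := h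
      exact h'.eq hnear ((Finset.mem_powersetCard.1 hJ').2.trans hJ.symm)
    · intro h
      exact absurd (Finset.mem_powersetCard.2 ⟨Finset.subset_univ J, hJ⟩) h
  have hΦm : ∀ J, Measurable (Φ J) := by
    intro J
    have hR : Measurable fun q : ({j // j ∈ J} → E) × ({j // ¬ j ∈ J} → E) => maxDist D q.1 :=
      (measurable_maxDist hD).comp measurable_fst
    refine Measurable.ite ?_ ?_ measurable_const
    · have : {q : ({j // j ∈ J} → E) × ({j // ¬ j ∈ J} → E) | ∀ j, maxDist D q.1 < D (q.2 j)}
          = ⋂ j, {q | maxDist D q.1 < D (q.2 j)} := by ext; simp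
      rw [this]
      exact MeasurableSet.iInter fun j => measurableSet_lt hR (by fun_prop)
    · refine hG.comp (hR.prodMk (measurable_const.add ?_))
      exact (measurable_countLE hD').comp (measurable_snd.prodMk hR)
  rw [lintegral_congr_ae hae, lintegral_finsetSum]
  swap
  · exact fun J _ => (hΦm J).comp (MeasurableEquiv.measurable _)
  refine Finset.sum_congr rfl fun J hJ => ?_
  have hcard : Fintype.card {j // ¬ j ∈ J} = Fintype.card κ - k := by
    rw [Fintype.card_subtype_compl, Fintype.card_coe, (Finset.mem_powersetCard.1 hJ).2]
  have hmp : MeasurePreserving (MeasurableEquiv.piEquivPiSubtypeProd (fun _ => E) (· ∈ J))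
      (Measure.pi fun _ : κ => μ) ((Measure.pi fun _ : {j // j ∈ J} => μ).prod
        (Measure.pi fun _ : {j // ¬ j ∈ J} => μ)) := by
    convert measurePreserving_piEquivPiSubtypeProd (fun _ : κ => μ) (· ∈ J)
  rw [hmp.lintegral_comp (hΦm J),
    lintegral_prod _ (hΦm J).aemeasurable]
  refine lintegral_congr fun v => ?_
  set R := maxDist D v
  have hcount := lintegral_pi_count (κ := {j // ¬ j ∈ J}) (μ := μ)
    (P := {x | R < D x ∧ D' x ≤ R}) (S := {x | R < D' x})
    ((measurableSet_lt measurable_const hD).inter (measurableSet_le hD' measurable_const))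
    (measurableSet_lt measurable_const hD')
    (Set.disjoint_left.2 fun x hx hx' => absurd hx.2 (not_le.2 hx')) (fun b => G (R, k + b))
  rw [hcard] at hcount
  rw [← hcount]
  refine lintegral_congr fun u => ?_
  have hiff : (∀ j, R < D (u j)) ↔ ∀ j, u j ∈ {x | R < D x ∧ D' x ≤ R} ∪ {x | R < D' x} := by
    refine forall_congr' fun j => ⟨fun h => ?_, ?_⟩
    · rcases le_or_gt (D' (u j)) R with h' | h'
      · exact Or.inl ⟨h, h'⟩
      · exact Or.inr h'
    · rintro (h | h)
      · exact h.1
      · exact lt_of_lt_of_le h (hDD _)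
  simp only [hΦ]
  by_cases hall : ∀ j, R < D (u j)
  · rw [if_pos hall, if_pos (hiff.1 hall)]
    congr 3
    rw [countLE]
    congr 1
    ext j
    have := hall j
    simp [this, R]
  · rw [if_neg hall, if_neg fun h => hall (hiff.2 h)]

end OrderStatistics

section NearestNeighborLaw

/-! ### The law of the nearest neighbor mass -/

variable {E : Type*} [MeasurableSpace E] {μ : Measure E} [IsProbabilityMeasure μ]

/-- The distribution function of `D`. -/
noncomputable def distFun (μ : Measure E) (D : E → ℝ) (r : ℝ) : ℝ := μ.real {x | D x ≤ r}

lemma distFun_nonneg (D : E → ℝ) (r : ℝ) : 0 ≤ distFun μ D r := measureReal_nonneg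

lemma distFun_le_one (D : E → ℝ) (r : ℝ) : distFun μ D r ≤ 1 := measureReal_le_one

lemma monotone_distFun (D : E → ℝ) : Monotone (distFun μ D) := fun _ _ hrs =>
  measureReal_mono fun _ hx => le_trans hx hrs

lemma distFun_le_distFun {D D' : E → ℝ} (hDD : ∀ x, D' x ≤ D x) (r : ℝ) :
    distFun μ D r ≤ distFun μ D' r := measureReal_mono fun _ hx => (hDD _).trans hx

lemma distFun_eq_cdf {D : E → ℝ} (hD : Measurable D) : distFun μ D = cdf (μ.map D) := by
  have := Measure.isProbabilityMeasure_map (μ := μ) hD.aemeasurable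
  ext r
  rw [cdf_eq_real, map_measureReal_apply hD measurableSet_Iic]
  rfl

lemma continuous_distFun {D : E → ℝ} (hD : Measurable D) (hatom : ∀ r, μ {x | D x = r} = 0) :
    Continuous (distFun μ D) := by
  have := Measure.isProbabilityMeasure_map (μ := μ) hD.aemeasurable
  rw [distFun_eq_cdf hD, continuous_iff_continuousAt]
  intro r
  have h1 : (cdf (μ.map D)).measure {r} = 0 := by
    rw [measure_cdf, Measure.map_apply hD (measurableSet_singleton r)]
    exact hatom r
  rw [StieltjesFunction.measure_singleton, ENNReal.ofReal_eq_zero] at h1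
  rw [(monotone_cdf _).continuousAt_iff_leftLim_eq_rightLim, StieltjesFunction.rightLim_eq]
  exact le_antisymm ((monotone_cdf _).leftLim_le le_rfl) (by linarith)

/-- The witness is the largest u-quantile. The equivalence holds even where the distribution
function is flat, which is why the supremum of the sublevel set is taken. -/
lemma exists_distFun_le_iff {D : E → ℝ} (hD : Measurable D) (hD0 : ∀ x, 0 ≤ D x)
    (hatom : ∀ r, μ {x | D x = r} = 0) {u : ℝ} (hu0 : 0 ≤ u) (hu1 : u < 1) :
    ∃ t, distFun μ D t = u ∧ ∀ r, distFun μ D r ≤ u ↔ r ≤ t := by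
  have := Measure.isProbabilityMeasure_map (μ := μ) hD.aemeasurable
  have hcont := continuous_distFun hD hatom
  have hclosed : IsClosed {r | distFun μ D r ≤ u} := isClosed_le hcont continuous_const
  have hlim : Tendsto (distFun μ D) atTop (nhds 1) := by
    rw [distFun_eq_cdf hD]
    exact tendsto_cdf_atTop _
  obtain ⟨b, hb⟩ := (hlim.eventually (lt_mem_nhds hu1)).exists
  have hbdd : BddAbove {r | distFun μ D r ≤ u} := by
    refine ⟨b, fun r hr => ?_⟩
    by_contra hlt
    exact absurd ((hb.trans_le (monotone_distFun D (not_le.1 hlt).le)).trans_le hr) (lt_irrefl _)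
  have hne : {r | distFun μ D r ≤ u}.Nonempty := by
    refine ⟨-1, ?_⟩
    have : {x | D x ≤ -1} = ∅ := by
      ext x
      have := hD0 x
      simp
      linarith
    change μ.real {x | D x ≤ -1} ≤ u
    rw [this]
    simpa using hu0
  set t := sSup {r | distFun μ D r ≤ u}
  have hmem : distFun μ D t ≤ u := hclosed.csSup_mem hne hbdd
  refine ⟨t, le_antisymm hmem ?_, fun r => ⟨fun h => le_csSup hbdd h,
    fun h => (monotone_distFun D h).trans hmem⟩⟩
  refine ge_of_tendsto (hcont.continuousAt.tendsto.mono_left nhdsWithin_le_nhds :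
    Tendsto (distFun μ D) (nhdsWithin t (Set.Ioi t)) _) ?_
  filter_upwards [self_mem_nhdsWithin] with r hr
  by_contra hlt
  exact absurd (le_csSup hbdd (not_le.1 hlt).le) (not_le.2 hr)

lemma setLIntegral_pow_pred {k : ℕ} (hk : 1 ≤ k) {u : ℝ} (hu : 0 ≤ u) :
    ∫⁻ s in Set.Ioc 0 u, ENNReal.ofReal (k * s ^ (k - 1)) = ENNReal.ofReal (u ^ k) := by
  rw [← ofReal_integral_eq_lintegral_ofReal]
  · rw [← intervalIntegral.integral_of_le hu, intervalIntegral.integral_const_mul, integral_pow]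
    congr 1
    have hk0 : (k : ℝ) ≠ 0 := by positivity
    have hk1 : ((k - 1 : ℕ) : ℝ) + 1 = k := by exact_mod_cast Nat.sub_add_cancel hk
    rw [hk1, Nat.sub_add_cancel hk, zero_pow (by omega), sub_zero]
    field_simp
  · exact (Continuous.integrableOn_Icc (by fun_prop)).mono_set Set.Ioc_subset_Icc_self
  · filter_upwards [ae_restrict_mem measurableSet_Ioc] with s hs
    have := hs.1.le
    positivity

/-- By the probability integral transform this is the law of the maximum of i.i.d. uniform
variables: the maximum is at most u exactly when every distance is at most the quantile. -/
lemma map_distFun_maxDist {κ : Type*} [Fintype κ] [Nonempty κ] {D : E → ℝ} (hD : Measurable D)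
    (hD0 : ∀ x, 0 ≤ D x) (hatom : ∀ r, μ {x | D x = r} = 0) :
    (Measure.pi fun _ : κ => μ).map (fun v => distFun μ D (maxDist D v))
      = (volume.restrict (Set.Ioc 0 1)).withDensity
          fun s => ENNReal.ofReal (Fintype.card κ * s ^ (Fintype.card κ - 1)) := by
  have hm : Measurable fun v : κ → E => distFun μ D (maxDist D v) :=
    (monotone_distFun D).measurable.comp (measurable_maxDist hD)
  have := Measure.isProbabilityMeasure_map (μ := Measure.pi fun _ : κ => μ) hm.aemeasurable
  refine Measure.ext_of_Iic _ _ fun u => ?_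
  rw [Measure.map_apply hm measurableSet_Iic, withDensity_apply _ measurableSet_Iic,
    Measure.restrict_restrict measurableSet_Iic]
  rcases lt_or_ge u 0 with hu | hu
  · have h1 : (fun v : κ → E => distFun μ D (maxDist D v)) ⁻¹' Set.Iic u = ∅ := by
      ext v
      have := distFun_nonneg (μ := μ) D (maxDist D v)
      simp
      linarith
    have h2 : Set.Iic u ∩ Set.Ioc 0 1 = ∅ := by
      ext s
      simp
      intros
      linarith
    rw [h1, h2]
    simp
  rcases lt_or_ge u 1 with hu1 | hu1
  · obtain ⟨t, ht, hiff⟩ := exists_distFun_le_iff hD hD0 hatom hu hu1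
    have h1 : (fun v : κ → E => distFun μ D (maxDist D v)) ⁻¹' Set.Iic u
        = Set.univ.pi fun _ => {x | D x ≤ t} := by
      ext v
      simp only [Set.mem_preimage, Set.mem_Iic, hiff, Set.mem_pi, Set.mem_univ, true_implies,
        Set.mem_ofPred_eq]
      exact ⟨fun h j => (le_maxDist D v j).trans h, fun h => ciSup_le h⟩
    have h2 : Set.Iic u ∩ Set.Ioc 0 1 = Set.Ioc 0 u := by
      ext s
      simp only [Set.mem_inter_iff, Set.mem_Iic, Set.mem_Ioc]
      constructor
      · rintro ⟨h1, h2, _⟩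
        exact ⟨h2, h1⟩
      · rintro ⟨h1, h2⟩
        exact ⟨h2, h1, by linarith⟩
    rw [h1, h2, Measure.pi_pi, Finset.prod_const, Finset.card_univ,
      setLIntegral_pow_pred Fintype.card_pos hu, ENNReal.ofReal_pow hu, ← ht, distFun,
      ofReal_measureReal]
  · have h1 : (fun v : κ → E => distFun μ D (maxDist D v)) ⁻¹' Set.Iic u = Set.univ := by
      ext v
      simpa using (distFun_le_one (μ := μ) D (maxDist D v)).trans hu1
    have h2 : Set.Iic u ∩ Set.Ioc 0 1 = Set.Ioc 0 1 :=
      Set.inter_eq_right.2 fun s hs => hs.2.trans hu1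
    rw [h1, h2, setLIntegral_pow_pred Fintype.card_pos zero_le_one]
    simp

variable {κ : Type*} [Fintype κ] [DecidableEq κ] {D D' : E → ℝ}

lemma measureReal_strip (hD : Measurable D) (hDD : ∀ x, D' x ≤ D x)
    (r : ℝ) : μ.real {x | r < D x ∧ D' x ≤ r} = distFun μ D' r - distFun μ D r := by
  have h : {x | r < D x ∧ D' x ≤ r} = {x | D' x ≤ r} \ {x | D x ≤ r} := by
    ext x
    simp [and_comm]
  have hsub : {x | D x ≤ r} ⊆ {x | D' x ≤ r} := fun x hx => (hDD x).trans hx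
  rw [h, measureReal_sdiff hsub (measurableSet_le hD measurable_const)]
  rfl

lemma measureReal_lt (hD' : Measurable D') (r : ℝ) :
    μ.real {x | r < D' x} = 1 - distFun μ D' r := by
  have h : {x | r < D' x} = {x | D' x ≤ r}ᶜ := by
    ext x
    simp
  rw [h, probReal_compl_eq_one_sub (measurableSet_le hD' measurable_const)]
  rfl

/-- The conditional binomial expectation, given that the `k`-th distance is `r`. -/
noncomputable def condSum (μ : Measure E) (D D' : E → ℝ) (m k : ℕ) (G : ℝ × ℕ → ℝ) (r : ℝ) : ℝ :=
  binomSum m (distFun μ D' r - distFun μ D r) (1 - distFun μ D' r) fun b => G (r, k + b)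

lemma lintegral_ofReal_kthDist_countLE (hD : Measurable D) (hD' : Measurable D')
    (hD0 : ∀ x, 0 ≤ D x) (hDD : ∀ x, D' x ≤ D x) (hatom : ∀ r, μ {x | D x = r} = 0) {k : ℕ}
    (hk : 1 ≤ k) (hkn : k ≤ Fintype.card κ) {G : ℝ × ℕ → ℝ} (hG : Measurable G)
    (hG0 : ∀ q, 0 ≤ G q) :
    ∫⁻ w, ENNReal.ofReal (G (kthDist D k w, countLE D' w (kthDist D k w)))
        ∂(Measure.pi fun _ : κ => μ)
      = ∑ J ∈ Finset.powersetCard k (Finset.univ : Finset κ),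
          ∫⁻ v, ENNReal.ofReal (condSum μ D D' (Fintype.card κ - k) k G (maxDist D v))
            ∂(Measure.pi fun _ : {j // j ∈ J} => μ) := by
  rw [lintegral_kthDist_countLE hD hD' hD0 hDD hatom hk hkn hG.ennreal_ofReal]
  refine Finset.sum_congr rfl fun J _ => lintegral_congr fun v => ?_
  rw [condSum, binomSum, ← measureReal_strip hD hDD, ← measureReal_lt hD',
    ENNReal.ofReal_sum_of_nonneg]
  · refine Finset.sum_congr rfl fun b _ => ?_
    rw [ENNReal.ofReal_mul (by positivity), ENNReal.ofReal_mul (by positivity),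
      ENNReal.ofReal_mul (by positivity), ENNReal.ofReal_pow (by positivity),
      ENNReal.ofReal_pow (by positivity), ofReal_measureReal, ofReal_measureReal,
      ENNReal.ofReal_natCast]
    ring
  · intro b _
    have := hG0 (maxDist D v, k + b)
    positivity

lemma lintegral_kthDist_countLE_mono (hD : Measurable D) (hD' : Measurable D')
    (hD0 : ∀ x, 0 ≤ D x) (hDD : ∀ x, D' x ≤ D x) (hatom : ∀ r, μ {x | D x = r} = 0) {k : ℕ}
    (hk : 1 ≤ k) (hkn : k ≤ Fintype.card κ) {G G' : ℝ × ℕ → ℝ} (hG : Measurable G)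
    (hG0 : ∀ q, 0 ≤ G q) (hG' : Measurable G') (hG0' : ∀ q, 0 ≤ G' q)
    (h : ∀ r, condSum μ D D' (Fintype.card κ - k) k G r
      ≤ condSum μ D D' (Fintype.card κ - k) k G' r) :
    ∫⁻ w, ENNReal.ofReal (G (kthDist D k w, countLE D' w (kthDist D k w)))
        ∂(Measure.pi fun _ : κ => μ)
      ≤ ∫⁻ w, ENNReal.ofReal (G' (kthDist D k w, countLE D' w (kthDist D k w)))
        ∂(Measure.pi fun _ : κ => μ) := by
  rw [lintegral_ofReal_kthDist_countLE hD hD' hD0 hDD hatom hk hkn hG hG0,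
    lintegral_ofReal_kthDist_countLE hD hD' hD0 hDD hatom hk hkn hG' hG0']
  exact Finset.sum_le_sum fun J _ => lintegral_mono fun v => ENNReal.ofReal_le_ofReal (h _)

/-- The mass `F(ρ)` of the ball reaching the `k`-th neighbor has a Beta law. -/
theorem lintegral_distFun_kthDist (hD : Measurable D) (hD0 : ∀ x, 0 ≤ D x)
    (hatom : ∀ r, μ {x | D x = r} = 0) {k : ℕ} (hk : 1 ≤ k) (hkn : k ≤ Fintype.card κ)
    {g : ℝ → ℝ} (hg : Measurable g) (hg0 : ∀ u, 0 ≤ g u) :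
    ∫⁻ w, ENNReal.ofReal (g (distFun μ D (kthDist D k w))) ∂(Measure.pi fun _ : κ => μ)
      = ∫⁻ u in Set.Ioc 0 1, ENNReal.ofReal ((Fintype.card κ).choose k * k
          * (u ^ (k - 1) * (1 - u) ^ (Fintype.card κ - k) * g u)) := by
  have hF : Measurable (distFun μ D) := (monotone_distFun D).measurable
  have h1 := lintegral_ofReal_kthDist_countLE (κ := κ) hD hD hD0 (fun _ => le_rfl) hatom hk hkn
    (G := fun q => g (distFun μ D q.1)) (hg.comp (hF.comp measurable_fst)) (fun _ => hg0 _)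
  -- With D' = D the strip is empty, so the binomial sum reduces to the probability that all
  -- remaining points lie outside the ball.
  have h2 : ∀ r, condSum μ D D (Fintype.card κ - k) k (fun q => g (distFun μ D q.1)) r
      = (1 - distFun μ D r) ^ (Fintype.card κ - k) * g (distFun μ D r) := by
    intro r
    have h3 := binomSum_const_mul (Fintype.card κ - k) (distFun μ D r - distFun μ D r)
      (1 - distFun μ D r) (g (distFun μ D r)) (fun _ => 1)
    rw [binomSum_one] at h3
    simp only [mul_one, sub_self, zero_add] at h3
    rw [condSum, mul_comm, ← h3, sub_self]
  rw [h1]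
  have h4 : ∀ J ∈ Finset.powersetCard k (Finset.univ : Finset κ),
      ∫⁻ v, ENNReal.ofReal (condSum μ D D (Fintype.card κ - k) k
          (fun q => g (distFun μ D q.1)) (maxDist D v)) ∂(Measure.pi fun _ : {j // j ∈ J} => μ)
      = ∫⁻ u in Set.Ioc 0 1, ENNReal.ofReal (k * u ^ (k - 1))
          * ENNReal.ofReal ((1 - u) ^ (Fintype.card κ - k) * g u) := by
    intro J hJ
    have hJ' := (Finset.mem_powersetCard.1 hJ).2
    have hne : Nonempty {j // j ∈ J} := by
      obtain ⟨i, hi⟩ := Finset.card_pos.1 (hJ' ▸ hk)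
      exact ⟨⟨i, hi⟩⟩
    have hmap := map_distFun_maxDist (κ := {j // j ∈ J}) hD hD0 hatom
    rw [Fintype.card_coe, hJ'] at hmap
    have hm : Measurable fun v : {j // j ∈ J} → E => distFun μ D (maxDist D v) :=
      hF.comp (measurable_maxDist hD)
    simp_rw [h2]
    rw [← lintegral_map (f := fun u => ENNReal.ofReal ((1 - u) ^ (Fintype.card κ - k) * g u))
      (by fun_prop) hm, hmap, lintegral_withDensity_eq_lintegral_mul _ (by fun_prop) (by fun_prop)]
    rfl
  rw [Finset.sum_congr rfl h4, Finset.sum_const, Finset.card_powersetCard, Finset.card_univ,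
    nsmul_eq_mul, ← lintegral_const_mul _ (by fun_prop)]
  refine setLIntegral_congr_fun measurableSet_Ioc fun u hu => ?_
  have := hu.1.le
  have := hg0 u
  have : 0 ≤ 1 - u := by linarith [hu.2]
  rw [← ENNReal.ofReal_natCast, ← ENNReal.ofReal_mul (by positivity),
    ← ENNReal.ofReal_mul (by positivity)]
  congr 1
  ring

lemma lintegral_neg_log_distFun_kthDist (hD : Measurable D) (hD0 : ∀ x, 0 ≤ D x)
    (hatom : ∀ r, μ {x | D x = r} = 0) {k : ℕ} (hk : 1 ≤ k) (hkn : k ≤ Fintype.card κ) :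
    ∫⁻ w, ENNReal.ofReal (-Real.log (distFun μ D (kthDist D k w))) ∂(Measure.pi fun _ : κ => μ)
      = ENNReal.ofReal (∑ j ∈ Finset.range (Fintype.card κ - k + 1), 1 / ((k : ℝ) + j)) := by
  have h0 : ∀ w : κ → E, ENNReal.ofReal (-Real.log (distFun μ D (kthDist D k w)))
      = ENNReal.ofReal |Real.log (distFun μ D (kthDist D k w))| := fun w => by
    rw [abs_of_nonpos (Real.log_nonpos (distFun_nonneg _ _) (distFun_le_one _ _))]
  simp_rw [h0]
  rw [lintegral_distFun_kthDist hD hD0 hatom hk hkn (g := fun u => |Real.log u|)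
    (by fun_prop) (fun u => abs_nonneg _)]
  obtain ⟨k, rfl⟩ := Nat.exists_eq_add_of_le' hk
  obtain ⟨m, hm⟩ := Nat.exists_eq_add_of_le hkn
  rw [hm, Nat.add_sub_cancel_left, Nat.add_sub_cancel]
  have h1 : ∫⁻ u in Set.Ioc (0 : ℝ) 1, ENNReal.ofReal (((k + 1 + m).choose (k + 1) : ℝ)
        * ((k + 1 : ℕ) : ℝ) * (u ^ k * (1 - u) ^ m * |Real.log u|))
      = ∫⁻ u in Set.Ioc (0 : ℝ) 1, ENNReal.ofReal (((k + 1 + m).choose (k + 1) : ℝ)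
        * ((k + 1 : ℕ) : ℝ) * -(u ^ k * (1 - u) ^ m * Real.log u)) := by
    refine setLIntegral_congr_fun measurableSet_Ioc fun u hu => ?_
    rw [abs_of_nonpos (Real.log_nonpos hu.1.le hu.2)]
    congr 1
    ring
  rw [h1, ← ofReal_integral_eq_lintegral_ofReal]
  · rw [← intervalIntegral.integral_of_le zero_le_one, intervalIntegral.integral_const_mul,
      intervalIntegral.integral_neg, integral_pow_mul_one_sub_pow_mul_log]
    congr 1
    have hc : (k + m + 1).choose m = (k + 1 + m).choose (k + 1) := by
      rw [show k + m + 1 = k + 1 + m by ring]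
      exact Nat.choose_symm_of_eq_add (by ring)
    have hc0 : ((k + 1 + m).choose (k + 1) : ℝ) ≠ 0 := by
      exact_mod_cast (Nat.choose_pos (by omega)).ne'
    have hk0 : (k : ℝ) + 1 ≠ 0 := by positivity
    rw [hc]
    push_cast
    field_simp
  · have := (intervalIntegrable_mul_log (g := fun u : ℝ => u ^ k * (1 - u) ^ m)
      (by fun_prop)).neg.const_mul (((k + 1 + m).choose (k + 1) : ℝ) * ((k + 1 : ℕ) : ℝ))
    exact (intervalIntegrable_iff_integrableOn_Ioc_of_le zero_le_one).1 this
  · filter_upwards [ae_restrict_mem measurableSet_Ioc] with u hu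
    have h1 := hu.1.le
    have h2 : 0 ≤ 1 - u := by linarith [hu.2]
    have h3 := Real.log_nonpos hu.1.le hu.2
    have h4 : 0 ≤ -(u ^ k * (1 - u) ^ m * Real.log u) := by
      rw [← mul_neg]
      have : 0 ≤ -Real.log u := by linarith
      positivity
    simp only [Pi.zero_apply]
    positivity

/-- Dividing by u lowers the first Beta parameter to k - 1, which must stay positive: this is the
use of k ≥ 2. The exact value is n/(k - 1), with n the number of points. -/
lemma lintegral_inv_distFun_kthDist (hD : Measurable D) (hD0 : ∀ x, 0 ≤ D x)
    (hatom : ∀ r, μ {x | D x = r} = 0) {k : ℕ} (hk : 2 ≤ k) (hkn : k ≤ Fintype.card κ) :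
    ∫⁻ w, ENNReal.ofReal (1 / distFun μ D (kthDist D k w)) ∂(Measure.pi fun _ : κ => μ)
      ≤ ENNReal.ofReal (Fintype.card κ) := by
  have h0 : ∀ w : κ → E, ENNReal.ofReal (1 / distFun μ D (kthDist D k w))
      = ENNReal.ofReal |1 / distFun μ D (kthDist D k w)| := fun w => by
    rw [abs_of_nonneg (div_nonneg zero_le_one (distFun_nonneg _ _))]
  simp_rw [h0]
  rw [lintegral_distFun_kthDist hD hD0 hatom (by omega) hkn (g := fun u => |1 / u|)
    (by fun_prop) (fun u => abs_nonneg _)]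
  obtain ⟨k, rfl⟩ := Nat.exists_eq_add_of_le' hk
  obtain ⟨m, hm⟩ := Nat.exists_eq_add_of_le hkn
  rw [hm, Nat.add_sub_cancel_left, show k + 2 - 1 = k + 1 by omega]
  have h1 : ∫⁻ u in Set.Ioc (0 : ℝ) 1, ENNReal.ofReal (((k + 2 + m).choose (k + 2) : ℝ)
        * ((k + 2 : ℕ) : ℝ) * (u ^ (k + 1) * (1 - u) ^ m * |1 / u|))
      = ∫⁻ u in Set.Ioc (0 : ℝ) 1, ENNReal.ofReal (((k + 2 + m).choose (k + 2) : ℝ)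
        * ((k + 2 : ℕ) : ℝ) * (u ^ k * (1 - u) ^ m)) := by
    refine setLIntegral_congr_fun measurableSet_Ioc fun u hu => ?_
    have hu0 := hu.1
    rw [abs_of_pos (by positivity)]
    congr 1
    field_simp
    ring
  rw [h1, ← ofReal_integral_eq_lintegral_ofReal]
  · rw [← intervalIntegral.integral_of_le zero_le_one, intervalIntegral.integral_const_mul,
      integral_pow_mul_one_sub_pow]
    apply ENNReal.ofReal_le_ofReal
    have hc : ((k + 2 + m).choose (k + 2) : ℝ) * ((k + 2 : ℕ) : ℝ)
        = ((k + 2 + m : ℕ) : ℝ) * (k + m + 1).choose m := by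
      have h2 := Nat.add_one_mul_choose_eq (k + m + 1) (k + 1)
      have h3 : (k + m + 1).choose (k + 1) = (k + m + 1).choose m :=
        Nat.choose_symm_of_eq_add (by ring)
      rw [h3, show k + m + 1 + 1 = k + 2 + m by ring] at h2
      exact_mod_cast h2.symm
    have hc0 : (0 : ℝ) < (k + m + 1).choose m := by
      exact_mod_cast Nat.choose_pos (by omega)
    rw [hc]
    have hk1 : (1 : ℝ) ≤ k + 1 := by
      have : (0 : ℝ) ≤ k := Nat.cast_nonneg k
      linarith
    rw [mul_one_div, mul_comm ((k : ℝ) + 1), ← div_div, mul_div_assoc, div_self hc0.ne', mul_one]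
    exact div_le_self (Nat.cast_nonneg _) hk1
  · exact (Continuous.integrableOn_Icc (by fun_prop)).mono_set Set.Ioc_subset_Icc_self
  · filter_upwards [ae_restrict_mem measurableSet_Ioc] with u hu
    have h1 := hu.1.le
    have h2 : 0 ≤ 1 - u := by linarith [hu.2]
    simp only [Pi.zero_apply]
    positivity

lemma ae_distFun_kthDist_pos (hD : Measurable D) (hD0 : ∀ x, 0 ≤ D x)
    (hatom : ∀ r, μ {x | D x = r} = 0) {k : ℕ} (hk : 1 ≤ k) (hkn : k ≤ Fintype.card κ)
    (hm : Measurable (kthDist D k : (κ → E) → ℝ)) :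
    ∀ᵐ w ∂(Measure.pi fun _ : κ => μ), 0 < distFun μ D (kthDist D k w) := by
  have hmeas : Measurable fun u : ℝ => if u ≤ 0 then (1 : ℝ) else 0 :=
    Measurable.ite measurableSet_Iic measurable_const measurable_const
  have h := lintegral_distFun_kthDist (κ := κ) hD hD0 hatom hk hkn
    (g := fun u => if u ≤ 0 then 1 else 0) hmeas (fun u => by split_ifs <;> norm_num)
  have h0 : ∫⁻ u in Set.Ioc (0 : ℝ) 1, ENNReal.ofReal ((Fintype.card κ).choose k * k
          * (u ^ (k - 1) * (1 - u) ^ (Fintype.card κ - k) * if u ≤ 0 then 1 else 0)) = 0 := by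
    rw [setLIntegral_congr_fun (g := fun _ => 0) measurableSet_Ioc]
    · simp
    · intro u hu
      simp [not_le.2 hu.1]
  rw [h0, lintegral_eq_zero_iff] at h
  · filter_upwards [h] with w hw
    by_contra hn
    rw [if_pos (not_lt.1 hn)] at hw
    simp at hw
  · exact (hmeas.comp ((monotone_distFun D).measurable.comp hm)).ennreal_ofReal

/-- The infimum is attained because the count of finitely many points is right-continuous in the
radius; k ≤ n rules out the infimum of the empty set. -/
lemma kthDist_le_iff {k : ℕ} (hkn : k ≤ Fintype.card κ) (hD0 : ∀ x, 0 ≤ D x) (w : κ → E) {r : ℝ}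
    (hr : 0 ≤ r) : kthDist D k w ≤ r ↔ k ≤ countLE D w r := by
  have hbdd : BddBelow {r : ℝ | 0 ≤ r ∧ k ≤ countLE D w r} := ⟨0, fun r hr => hr.1⟩
  refine ⟨fun h => ?_, fun h => csInf_le hbdd ⟨hr, h⟩⟩
  have hne : {r : ℝ | 0 ≤ r ∧ k ≤ countLE D w r}.Nonempty := by
    refine ⟨∑ j, D (w j), Finset.sum_nonneg fun j _ => hD0 _, hkn.trans_eq ?_⟩
    rw [countLE, Finset.filter_true_of_mem, Finset.card_univ]
    exact fun j _ => Finset.single_le_sum (f := fun j => D (w j)) (fun j _ => hD0 _)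
      (Finset.mem_univ j)
  have hmono : ∀ s, r < s → k ≤ countLE D w s := by
    intro s hs
    obtain ⟨t, ht, hts⟩ := (csInf_lt_iff hbdd hne).1 (h.trans_lt hs)
    refine ht.2.trans (Finset.card_le_card fun j hj => ?_)
    rw [Finset.mem_filter] at hj ⊢
    exact ⟨hj.1, hj.2.trans hts.le⟩
  have hev : ∀ᶠ s in nhdsWithin r (Set.Ioi r), ∀ j, r < D (w j) → s < D (w j) :=
    eventually_all.2 fun j => by
      by_cases hj : r < D (w j)
      · filter_upwards [nhdsWithin_le_nhds (gt_mem_nhds hj)] with s hs _ using hs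
      · exact Eventually.of_forall fun s h => absurd h hj
  obtain ⟨s, hs, hrs⟩ := (hev.and self_mem_nhdsWithin).exists
  refine (hmono s hrs).trans (Finset.card_le_card fun j hj => ?_)
  rw [Finset.mem_filter] at hj ⊢
  refine ⟨hj.1, ?_⟩
  by_contra hlt
  exact absurd hj.2 (not_le.2 (hs j (not_le.1 hlt)))

end NearestNeighborLaw

section LocalEstimate

/-! ### The bias of the estimator at a fixed point -/

variable {E : Type*} [MeasurableSpace E] {μ : Measure E} [IsProbabilityMeasure μ]
  {κ : Type*} [Fintype κ] [DecidableEq κ] {D D' : E → ℝ} {k : ℕ}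

lemma kthDist_nonneg (w : κ → E) : 0 ≤ kthDist D k w := Real.sInf_nonneg fun _ hr => hr.1

lemma measurable_kthDist (hD : Measurable D) (hD0 : ∀ x, 0 ≤ D x) (hkn : k ≤ Fintype.card κ) :
    Measurable (kthDist D k : (κ → E) → ℝ) := by
  refine measurable_of_Iic fun r => ?_
  rcases lt_or_ge r 0 with hr | hr
  · convert MeasurableSet.empty
    ext w
    have := kthDist_nonneg (D := D) (k := k) w
    simp
    linarith
  · have : kthDist D k ⁻¹' Set.Iic r = {w : κ → E | k ≤ countLE D w r} := by
      ext w
      exact kthDist_le_iff hkn hD0 w hr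
    rw [this]
    exact measurableSet_le measurable_const
      ((measurable_countLE hD).comp (measurable_id.prodMk measurable_const))

lemma le_countLE_kthDist (hD0 : ∀ x, 0 ≤ D x) (hDD : ∀ x, D' x ≤ D x) (hkn : k ≤ Fintype.card κ)
    (w : κ → E) : k ≤ countLE D' w (kthDist D k w) := by
  refine ((kthDist_le_iff hkn hD0 w (kthDist_nonneg w)).1 le_rfl).trans
    (Finset.card_le_card fun j hj => ?_)
  rw [Finset.mem_filter] at hj ⊢
  exact ⟨hj.1, (hDD _).trans hj.2⟩

lemma countLE_le_card (w : κ → E) (r : ℝ) : countLE D w r ≤ Fintype.card κ := by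
  rw [countLE, ← Finset.card_univ]
  exact Finset.card_filter_le _ _

/-- The `k`-th neighbor is unlikely to be further than `a` when the `a`-ball has a large mass. -/
lemma measureReal_lt_kthDist_le (hD : Measurable D) (hD0 : ∀ x, 0 ≤ D x)
    (hkn : k ≤ Fintype.card κ) {a : ℝ} (ha : 0 ≤ a) :
    (Measure.pi fun _ : κ => μ).real {w | a < kthDist D k w}
      ≤ Real.exp k * Real.exp (-(Fintype.card κ * distFun μ D a / 2)) := by
  -- Chernoff bound with exponent 1: the event says that fewer than k points lie in the ball, so its
  -- indicator is at most e^k e^(-count), and the expectation factorises over the sample.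
  set h : E → ℝ := fun x => Real.exp (-(if D x ≤ a then 1 else 0)) with hh
  have hset : MeasurableSet {x | D x ≤ a} := measurableSet_le hD measurable_const
  have hprod : ∀ w : κ → E, ∏ j, h (w j) = Real.exp (-(countLE D w a : ℝ)) := by
    intro w
    rw [hh, ← Real.exp_sum, Finset.sum_neg_distrib, countLE, Finset.card_filter]
    push_cast
    rfl
  have hint : ∫ x, h x ∂μ ≤ Real.exp (-(distFun μ D a / 2)) := by
    have h1 : h = fun x => 1 + {x | D x ≤ a}.indicator (fun _ => Real.exp (-1) - 1) x := by
      ext x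
      by_cases hx : D x ≤ a
      · rw [Set.indicator_of_mem (show x ∈ {x | D x ≤ a} from hx), hh]
        simp [hx]
      · rw [Set.indicator_of_notMem (show x ∉ {x | D x ≤ a} from hx), hh]
        simp [hx]
    rw [h1, integral_add (integrable_const _) ((integrable_const _).indicator hset),
      integral_indicator_const _ hset]
    have h2 : Real.exp (-1) ≤ 1 / 2 := by
      rw [Real.exp_neg, ← one_div]
      have := Real.add_one_le_exp (1 : ℝ)
      exact one_div_le_one_div_of_le (by norm_num) (by linarith)
    have h3 := distFun_nonneg (μ := μ) D a
    have h4 := Real.add_one_le_exp (-(distFun μ D a / 2))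
    change (∫ _, (1 : ℝ) ∂μ) + distFun μ D a • (Real.exp (-1) - 1) ≤ _
    simp only [integral_const, probReal_univ, smul_eq_mul, mul_one]
    nlinarith
  have hint0 : 0 ≤ ∫ x, h x ∂μ := integral_nonneg fun x => (Real.exp_pos _).le
  have hpi : ∫ w, ∏ j, h (w j) ∂(Measure.pi fun _ : κ => μ) = (∫ x, h x ∂μ) ^ Fintype.card κ := by
    rw [integral_fintype_prod_eq_prod (fun _ : κ => h)]
    simp
  have hmeasH : Measurable h := by
    refine Real.measurable_exp.comp (Measurable.neg ?_)
    exact Measurable.ite hset measurable_const measurable_const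
  have hbound : Integrable (fun w : κ → E => Real.exp k * ∏ j, h (w j))
      (Measure.pi fun _ : κ => μ) := by
    refine Integrable.of_bound (C := Real.exp k) ?_ (ae_of_all _ fun w => ?_)
    · exact (Measurable.const_mul (Finset.measurable_prod _ fun j _ =>
        hmeasH.comp (measurable_pi_apply j)) _).aestronglyMeasurable
    · rw [hprod, Real.norm_of_nonneg (by positivity)]
      refine mul_le_of_le_one_right (Real.exp_pos _).le (Real.exp_le_one_iff.2 (by simp))
  have hms : MeasurableSet {w : κ → E | a < kthDist D k w} :=
    measurableSet_lt measurable_const (measurable_kthDist hD hD0 hkn)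
  calc (Measure.pi fun _ : κ => μ).real {w | a < kthDist D k w}
      = ∫ w, {w : κ → E | a < kthDist D k w}.indicator (fun _ => (1 : ℝ)) w
          ∂(Measure.pi fun _ : κ => μ) := by
        rw [integral_indicator_const _ hms, smul_eq_mul, mul_one]
    _ ≤ ∫ w, Real.exp k * ∏ j, h (w j) ∂(Measure.pi fun _ : κ => μ) := by
        refine integral_mono ((integrable_const _).indicator hms) hbound fun w => ?_
        simp only
        by_cases hw : w ∈ {w : κ → E | a < kthDist D k w}
        · rw [Set.indicator_of_mem hw, hprod, ← Real.exp_add]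
          refine Real.one_le_exp ?_
          have h1 : ¬ k ≤ countLE D w a := fun h =>
            absurd ((kthDist_le_iff hkn hD0 w ha).2 h) (not_le.2 hw)
          have h2 : (countLE D w a : ℝ) ≤ k := by exact_mod_cast (not_le.1 h1).le
          linarith
        · rw [Set.indicator_of_notMem hw, hprod]
          positivity
    _ = Real.exp k * (∫ x, h x ∂μ) ^ Fintype.card κ := by rw [integral_const_mul, hpi]
    _ ≤ Real.exp k * Real.exp (-(distFun μ D a / 2)) ^ Fintype.card κ := by gcongr
    _ = _ := by
        rw [← Real.exp_nat_mul]
        congr 2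
        ring

lemma neg_two_mul_le_log_one_sub {x : ℝ} (hx0 : 0 ≤ x) (hx : x ≤ 1 / 2) :
    -(2 * x) ≤ Real.log (1 - x) := by
  have h1 : 0 < 1 - x := by linarith
  have h2 := Real.one_sub_inv_le_log_of_pos h1
  have h3 : (1 - x)⁻¹ ≤ 1 + 2 * x := by
    rw [inv_le_iff_one_le_mul₀ h1]
    nlinarith
  linarith

/-- The conditional mean of the number of strip points, up to a bounded additive error. -/
noncomputable def condMean (μ : Measure E) (D D' : E → ℝ) (m : ℕ) (r : ℝ) : ℝ :=
  (m + 1) * (distFun μ D' r - distFun μ D r) / (1 - distFun μ D r)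

lemma condMean_pos {r : ℝ} (hlt : distFun μ D r < distFun μ D' r) (m : ℕ) :
    0 < condMean μ D D' m r := by
  have h1 := distFun_le_one (μ := μ) D' r
  have : 0 < 1 - distFun μ D r := by linarith
  have : 0 < distFun μ D' r - distFun μ D r := by linarith
  unfold condMean
  positivity

lemma condSum_one (m : ℕ) (r : ℝ) :
    condSum μ D D' m k (fun _ => 1) r = (1 - distFun μ D r) ^ m := by
  rw [condSum, binomSum_one]
  congr 1
  ring

lemma condSum_ite (m : ℕ) (S : ℝ → Prop) [DecidablePred S] (G : ℝ × ℕ → ℝ) (r : ℝ) :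
    condSum μ D D' m k (fun q => if S q.1 then G q else 0) r
      = if S r then condSum μ D D' m k G r else 0 := by
  unfold condSum
  split_ifs with h
  · simp [h]
  · simp [h, binomSum]

/-- The normalised strip count has conditional mean at most 1. This and its reciprocal counterpart
`condSum_condMean_div_le` are what log t ≤ t - 1 needs in the two directions. -/
lemma condSum_sub_div_condMean_le {r : ℝ} (hlt : distFun μ D r < distFun μ D' r) (m : ℕ) :
    condSum μ D D' m k (fun q => ((q.2 - k : ℕ) : ℝ) / condMean μ D D' m q.1) r
      ≤ condSum μ D D' m k (fun _ => 1) r := by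
  have h1 := distFun_le_one (μ := μ) D' r
  have hs : 0 ≤ 1 - distFun μ D' r := by linarith
  have hp : 0 < distFun μ D' r - distFun μ D r := by linarith
  have hq := condMean_pos hlt m
  have hps : 0 < 1 - distFun μ D r := by linarith
  rw [condSum_one, condSum]
  have h2 := mul_binomSum_id_le m hp.le hs
  have h3 := binomSum_const_mul m (distFun μ D' r - distFun μ D r) (1 - distFun μ D' r)
    (1 / condMean μ D D' m r) (fun b => (b : ℝ))
  simp only [Nat.add_sub_cancel_left]
  have h4 : (fun b : ℕ => (b : ℝ) / condMean μ D D' m r)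
      = fun b : ℕ => 1 / condMean μ D D' m r * b := by
    ext b
    ring
  rw [h4, h3, one_div_mul_eq_div, div_le_iff₀ hq, condMean, mul_div_assoc', le_div_iff₀ hps]
  rw [show distFun μ D' r - distFun μ D r + (1 - distFun μ D' r) = 1 - distFun μ D r by ring] at h2
  linarith

/-- Since k ≥ 1, the full count k + b is at least b + 1, so the binomial bound for 1/(b + 1)
applies. -/
lemma condSum_inv_mul_condMean_le (hk : 1 ≤ k) {r : ℝ} (hlt : distFun μ D r < distFun μ D' r)
    (m : ℕ) : condSum μ D D' m k (fun q => 1 / (q.2 : ℝ)) r * condMean μ D D' m r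
      ≤ (1 - distFun μ D r) ^ m := by
  have h1 := distFun_le_one (μ := μ) D' r
  have hs : 0 ≤ 1 - distFun μ D' r := by linarith
  have hp : 0 < distFun μ D' r - distFun μ D r := by linarith
  have hps : 0 < 1 - distFun μ D r := by linarith
  have h2 := mul_binomSum_inv_succ_le m (p := distFun μ D' r - distFun μ D r) hs
  rw [show distFun μ D' r - distFun μ D r + (1 - distFun μ D' r) = 1 - distFun μ D r by ring] at h2
  have h3 : condSum μ D D' m k (fun q => 1 / (q.2 : ℝ)) r
      ≤ binomSum m (distFun μ D' r - distFun μ D r) (1 - distFun μ D' r)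
        (fun b => 1 / ((b : ℝ) + 1)) := by
    refine binomSum_mono hp.le hs fun b => ?_
    refine one_div_le_one_div_of_le (by positivity) ?_
    push_cast
    have : (1 : ℝ) ≤ k := by exact_mod_cast hk
    linarith
  rw [condMean, mul_div_assoc', div_le_iff₀ hps, ← pow_succ]
  refine le_trans ?_ h2
  rw [mul_comm]
  gcongr

lemma condSum_condMean_div_le (hk : 1 ≤ k) {r : ℝ} (hlt : distFun μ D r < distFun μ D' r) (m : ℕ) :
    condSum μ D D' m k (fun q => condMean μ D D' m q.1 / (q.2 : ℝ)) r
      ≤ condSum μ D D' m k (fun _ => 1) r := by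
  rw [condSum_one]
  refine le_trans (le_of_eq ?_) (condSum_inv_mul_condMean_le hk hlt m)
  rw [condSum, condSum, mul_comm, ← binomSum_const_mul]
  congr 1
  ext b
  rw [mul_one_div]

lemma condSum_inv_le (hk : 1 ≤ k) {r : ℝ} (hlt : distFun μ D r < distFun μ D' r) (m : ℕ) :
    condSum μ D D' m k (fun q => 1 / (q.2 : ℝ)) r
      ≤ condSum μ D D' m k (fun q => 1 / condMean μ D D' m q.1) r := by
  have h1 := condSum_inv_mul_condMean_le hk hlt m
  rw [← le_div_iff₀ (condMean_pos hlt m)] at h1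
  refine h1.trans (le_of_eq ?_)
  have h2 := binomSum_const_mul m (distFun μ D' r - distFun μ D r) (1 - distFun μ D' r)
    (1 / condMean μ D D' m r) (fun _ => 1)
  rw [binomSum_one] at h2
  simp only [mul_one] at h2
  rw [condSum, h2, one_div_mul_eq_div]
  congr 2
  ring

lemma integrable_and_integral_le_of_lintegral_le {α : Type*} [MeasurableSpace α] {ν : Measure α}
    {f g : α → ℝ} (hf : Measurable f) (hf0 : ∀ x, 0 ≤ f x) (hg : Integrable g ν)
    (hg0 : ∀ x, 0 ≤ g x) (h : ∫⁻ x, ENNReal.ofReal (f x) ∂ν ≤ ∫⁻ x, ENNReal.ofReal (g x) ∂ν) :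
    Integrable f ν ∧ ∫ x, f x ∂ν ≤ ∫ x, g x ∂ν := by
  rw [← ofReal_integral_eq_lintegral_ofReal hg (ae_of_all _ hg0)] at h
  have hint : Integrable f ν := (lintegral_ofReal_ne_top_iff_integrable hf.aestronglyMeasurable
    (ae_of_all _ hf0)).1 (ne_top_of_le_ne_top ENNReal.ofReal_ne_top h)
  rw [← ofReal_integral_eq_lintegral_ofReal hint (ae_of_all _ hf0),
    ENNReal.ofReal_le_ofReal_iff (integral_nonneg hg0)] at h
  exact ⟨hint, h⟩

/-- The ratio of `condMean` to N F' equals (1 - k/N)(F' - F)/(F'(1 - F)), which lies between (1 -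
k/N)(1 - η) and 1. Both factors of the lower bound are at least 1/2, whence the 4 in the second
estimate. -/
lemma abs_log_condMean_sub_le {m N : ℕ} (hN : m + 1 + k = N) (hkN : 2 * k ≤ N) {r η : ℝ}
    (hη : η ≤ 1 / 2) (hF : 0 < distFun μ D r) (hDD : ∀ x, D' x ≤ D x)
    (hFF : distFun μ D r ≤ η * distFun μ D' r) :
    |Real.log (condMean μ D D' m r) - Real.log (N * distFun μ D' r)| ≤ 2 * k / N + 2 * η ∧
      1 / condMean μ D D' m r ≤ 4 / (N * distFun μ D' r) := by
  have hF' : 0 < distFun μ D' r := hF.trans_le (distFun_le_distFun hDD r)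
  have hF1 := distFun_le_one (μ := μ) D' r
  set F := distFun μ D r
  set F' := distFun μ D' r
  have hη0 : 0 ≤ η := by
    by_contra h
    nlinarith
  have hN0 : (0 : ℝ) < N := by
    have : 0 < N := by omega
    exact_mod_cast this
  have hkN' : (k : ℝ) / N ≤ 1 / 2 := by
    rw [div_le_div_iff₀ hN0 (by norm_num)]
    have : (2 : ℝ) * k ≤ N := by exact_mod_cast hkN
    linarith
  have hk0 : (0 : ℝ) ≤ (k : ℝ) / N := by positivity
  have hm : (m : ℝ) + 1 = N * (1 - k / N) := by
    have : (m : ℝ) + 1 + k = N := by exact_mod_cast hN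
    field_simp
    linarith
  have hlt : F < F' := by nlinarith
  have hden : 0 < 1 - F := by linarith
  set t := condMean μ D D' m r / (N * F') with ht
  have hq : condMean μ D D' m r = t * (N * F') := by
    rw [ht]
    field_simp
  have ht' : t = (1 - k / N) * ((F' - F) / (F' * (1 - F))) := by
    have hdef : condMean μ D D' m r = (m + 1) * (F' - F) / (1 - F) := rfl
    rw [ht, hdef, hm]
    field_simp
  have hlow : (1 - k / N) * (1 - η) ≤ t := by
    rw [ht']
    refine mul_le_mul_of_nonneg_left ?_ (by linarith)
    rw [le_div_iff₀ (by positivity)]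
    have : 0 ≤ (1 - η) * F' * F := by
      have : 0 ≤ 1 - η := by linarith
      positivity
    nlinarith
  have hup : t ≤ 1 := by
    rw [ht']
    have h1 : (F' - F) / (F' * (1 - F)) ≤ 1 := by
      rw [div_le_one (by positivity)]
      nlinarith
    have h2 : 0 ≤ (F' - F) / (F' * (1 - F)) := div_nonneg (by linarith) (by positivity)
    nlinarith
  have h4 : 1 / 4 ≤ t := by nlinarith
  have ht0 : 0 < t := by linarith
  constructor
  · rw [hq, Real.log_mul ht0.ne' (by positivity), add_sub_cancel_right, abs_of_nonpos
      (Real.log_nonpos ht0.le hup)]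
    have h5 := Real.log_le_log (by nlinarith) hlow
    rw [Real.log_mul (by linarith) (by linarith)] at h5
    have h6 := neg_two_mul_le_log_one_sub hk0 hkN'
    have h7 := neg_two_mul_le_log_one_sub hη0 hη
    rw [mul_div_assoc]
    linarith
  · rw [hq, div_le_div_iff₀ (by positivity) (by positivity)]
    have : 0 < N * F' := by positivity
    nlinarith

lemma integrable_log_distFun_kthDist (hD : Measurable D) (hD0 : ∀ x, 0 ≤ D x)
    (hatom : ∀ r, μ {x | D x = r} = 0) (hk : 1 ≤ k) (hkn : k ≤ Fintype.card κ) :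
    Integrable (fun w => Real.log (distFun μ D (kthDist D k w))) (Measure.pi fun _ : κ => μ) ∧
    ∫ w, Real.log (distFun μ D (kthDist D k w)) ∂(Measure.pi fun _ : κ => μ)
      = -∑ j ∈ Finset.range (Fintype.card κ - k + 1), 1 / ((k : ℝ) + j) := by
  have hm : Measurable fun w : κ → E => -Real.log (distFun μ D (kthDist D k w)) :=
    (Real.measurable_log.comp ((monotone_distFun D).measurable.comp
      (measurable_kthDist hD hD0 hkn))).neg
  have hnn : ∀ w : κ → E, 0 ≤ -Real.log (distFun μ D (kthDist D k w)) := fun w => by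
    have := Real.log_nonpos (distFun_nonneg (μ := μ) D (kthDist D k w)) (distFun_le_one _ _)
    linarith
  have h := lintegral_neg_log_distFun_kthDist (κ := κ) hD hD0 hatom hk hkn
  have hint : Integrable (fun w => -Real.log (distFun μ D (kthDist D k w)))
      (Measure.pi fun _ : κ => μ) :=
    (lintegral_ofReal_ne_top_iff_integrable hm.aestronglyMeasurable (ae_of_all _ hnn)).1
      (by rw [h]; exact ENNReal.ofReal_ne_top)
  refine ⟨by simpa using hint.neg, ?_⟩
  have h2 := integral_eq_lintegral_of_nonneg_ae (μ := Measure.pi fun _ : κ => μ) (ae_of_all _ hnn) hm.aestronglyMeasurable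
  rw [h, ENNReal.toReal_ofReal (by positivity), integral_neg] at h2
  linarith

/-- The expected logarithmic count is close to the expected logarithm of the strip mass. -/
theorem abs_integral_count_sub_log_le (hD : Measurable D) (hD' : Measurable D')
    (hD0 : ∀ x, 0 ≤ D x) (hDD : ∀ x, D' x ≤ D x) (hatom : ∀ r, μ {x | D x = r} = 0) (hk : 2 ≤ k)
    {N : ℕ} (hN : Fintype.card κ + 1 = N) (hkN : 2 * k ≤ N) {a η θ : ℝ} (hη : η ≤ 1 / 2)
    (hθ : 0 ≤ θ) (hη0 : 0 ≤ η)
    (hpos : ∀ r, 0 < r → r ≤ a → 0 < distFun μ D r)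
    (hratio : ∀ r, 0 < r → r ≤ a → distFun μ D r ≤ η * distFun μ D' r)
    (hinv : ∀ r, 0 < r → r ≤ a →
      1 / (N * distFun μ D' r) ≤ θ * (1 + 1 / (N * distFun μ D r)))
    {φ : ℕ → ℝ} (hφ : ∀ c, 1 ≤ c → |φ c - Real.log c| ≤ 1 / c) :
    Integrable (fun w => if 0 < kthDist D k w ∧ kthDist D k w ≤ a then
      φ (countLE D' w (kthDist D k w)) - Real.log (N * distFun μ D' (kthDist D k w)) else 0)
      (Measure.pi fun _ : κ => μ) ∧
    Integrable (fun w => if 0 < kthDist D k w ∧ kthDist D k w ≤ a then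
      Real.log (N * distFun μ D' (kthDist D k w)) else 0) (Measure.pi fun _ : κ => μ) ∧
    |∫ w, (if 0 < kthDist D k w ∧ kthDist D k w ≤ a then
      φ (countLE D' w (kthDist D k w)) - Real.log (N * distFun μ D' (kthDist D k w)) else 0)
      ∂(Measure.pi fun _ : κ => μ)| ≤ 2 * k / N + 2 * η + 8 * (k + 1) * θ := by
  classical
  set π := Measure.pi fun _ : κ => μ with hπ
  have hkn : k ≤ Fintype.card κ := by omega
  have hk1 : 1 ≤ k := by omega
  set m := Fintype.card κ - k with hm
  have hmN : m + 1 + k = N := by omega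
  have hN0 : (0 : ℝ) < N := by
    have : 0 < N := by omega
    exact_mod_cast this
  set S : ℝ → Prop := fun r => 0 < r ∧ r ≤ a with hS
  have hSm : MeasurableSet {r | S r} := measurableSet_Ioi.inter measurableSet_Iic
  have hlt : ∀ r, S r → distFun μ D r < distFun μ D' r := by
    intro r hr
    have h1 := hratio r hr.1 hr.2
    have h2 := hpos r hr.1 hr.2
    have h3 := h2.trans_le (distFun_le_distFun hDD r)
    nlinarith
  have hFm : Measurable (distFun μ D) := (monotone_distFun D).measurable
  have hFm' : Measurable (distFun μ D') := (monotone_distFun D').measurable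
  have hqm : Measurable (condMean μ D D' m) := by unfold condMean; fun_prop
  have hρm : Measurable (kthDist D k : (κ → E) → ℝ) := measurable_kthDist hD hD0 hkn
  have hnm : Measurable fun w : κ → E => countLE D' w (kthDist D k w) :=
    (measurable_countLE hD').comp (measurable_id.prodMk hρm)
  have hpair : Measurable fun w : κ → E => (kthDist D k w, countLE D' w (kthDist D k w)) :=
    hρm.prodMk hnm
  have hcast : Measurable fun q : ℝ × ℕ => (q.2 : ℝ) := measurable_from_top.comp measurable_snd
  have hcast' : Measurable fun q : ℝ × ℕ => ((q.2 - k : ℕ) : ℝ) :=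
    (measurable_from_top (f := fun c : ℕ => ((c - k : ℕ) : ℝ))).comp measurable_snd
  have hSq : MeasurableSet {q : ℝ × ℕ | S q.1} := measurable_fst hSm
  have hq0 : ∀ r, 0 ≤ condMean μ D D' m r := by
    intro r
    have := distFun_le_one (μ := μ) D r
    have := distFun_le_distFun (μ := μ) hDD r
    unfold condMean
    exact div_nonneg (mul_nonneg (by positivity) (by linarith)) (by linarith)
  -- The functions compared in expectation, with q the conditional mean and c the count: `G1` is (c
  -- - k)/q, `G2` is q/c, `G3` is 1/c and `G4` is 1/q, all restricted to radii in (0, a]. The means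
  -- of `G1` and `G2` are at most that of `G0`, and the mean of `G3` is at most that of `G4`.
  set G0 : ℝ × ℕ → ℝ := fun q => if S q.1 then 1 else 0
  set G1 : ℝ × ℕ → ℝ := fun q => if S q.1 then ((q.2 - k : ℕ) : ℝ) / condMean μ D D' m q.1 else 0
  set G2 : ℝ × ℕ → ℝ := fun q => if S q.1 then condMean μ D D' m q.1 / (q.2 : ℝ) else 0
  set G3 : ℝ × ℕ → ℝ := fun q => if S q.1 then 1 / (q.2 : ℝ) else 0
  set G4 : ℝ × ℕ → ℝ := fun q => if S q.1 then 1 / condMean μ D D' m q.1 else 0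
  have hG0m : Measurable G0 := Measurable.ite hSq measurable_const measurable_const
  have hG1m : Measurable G1 :=
    Measurable.ite hSq (hcast'.div (hqm.comp measurable_fst)) measurable_const
  have hG2m : Measurable G2 :=
    Measurable.ite hSq ((hqm.comp measurable_fst).div hcast) measurable_const
  have hG3m : Measurable G3 := Measurable.ite hSq (measurable_const.div hcast) measurable_const
  have hG4m : Measurable G4 :=
    Measurable.ite hSq (measurable_const.div (hqm.comp measurable_fst)) measurable_const
  have hG0n : ∀ q, 0 ≤ G0 q := fun q => by simp only [G0]; split_ifs <;> norm_num
  have hG1n : ∀ q, 0 ≤ G1 q := fun q => by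
    have := hq0 q.1
    simp only [G1]; split_ifs <;> positivity
  have hG2n : ∀ q, 0 ≤ G2 q := fun q => by
    have := hq0 q.1
    simp only [G2]; split_ifs <;> positivity
  have hG3n : ∀ q, 0 ≤ G3 q := fun q => by simp only [G3]; split_ifs <;> positivity
  have hG4n : ∀ q, 0 ≤ G4 q := fun q => by
    have := hq0 q.1
    simp only [G4]; split_ifs <;> positivity
  set Z : (κ → E) → ℝ × ℕ := fun w => (kthDist D k w, countLE D' w (kthDist D k w)) with hZ
  have hi0 : Integrable (fun w => G0 (Z w)) π :=
    Integrable.of_bound (C := 1) (hG0m.comp hpair).aestronglyMeasurable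
      (ae_of_all _ fun w => by simp only [G0]; split_ifs <;> simp)
  obtain ⟨hi1, hI1⟩ := integrable_and_integral_le_of_lintegral_le (ν := π) (f := fun w => G1 (Z w))
    (g := fun w => G0 (Z w)) (hG1m.comp hpair) (fun w => hG1n _) hi0 (fun w => hG0n _)
    (lintegral_kthDist_countLE_mono hD hD' hD0 hDD hatom hk1 hkn hG1m hG1n hG0m hG0n fun r => by
      rw [condSum_ite m S (fun q => ((q.2 - k : ℕ) : ℝ) / condMean μ D D' m q.1),
        condSum_ite m S (fun _ => 1)]
      split_ifs with h
      · exact condSum_sub_div_condMean_le (hlt r h) m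
      · exact le_rfl)
  obtain ⟨hi2, hI2⟩ := integrable_and_integral_le_of_lintegral_le (ν := π) (f := fun w => G2 (Z w))
    (g := fun w => G0 (Z w)) (hG2m.comp hpair) (fun w => hG2n _) hi0 (fun w => hG0n _)
    (lintegral_kthDist_countLE_mono hD hD' hD0 hDD hatom hk1 hkn hG2m hG2n hG0m hG0n fun r => by
      rw [condSum_ite m S (fun q => condMean μ D D' m q.1 / (q.2 : ℝ)),
        condSum_ite m S (fun _ => 1)]
      split_ifs with h
      · exact condSum_condMean_div_le hk1 (hlt r h) m
      · exact le_rfl)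
  have hFρm : Measurable fun w : κ → E => distFun μ D (kthDist D k w) := hFm.comp hρm
  obtain ⟨hiU, hIU⟩ := integrable_and_integral_le_of_lintegral_le (ν := π)
    (f := fun w => 1 / distFun μ D (kthDist D k w)) (g := fun _ => (Fintype.card κ : ℝ))
    (measurable_const.div hFρm) (fun w => div_nonneg zero_le_one (distFun_nonneg _ _))
    (integrable_const _) (fun _ => by positivity)
    (by
      rw [lintegral_const, measure_univ, mul_one]
      exact lintegral_inv_distFun_kthDist hD hD0 hatom hk hkn)
  rw [integral_const, probReal_univ, one_smul] at hIU
  have hG4le : ∀ w, G4 (Z w) ≤ 4 * θ + 4 * θ / N * (1 / distFun μ D (kthDist D k w)) := by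
    intro w
    have hU := distFun_nonneg (μ := μ) D (kthDist D k w)
    simp only [G4, Z]
    split_ifs with h
    · have h1 := (abs_log_condMean_sub_le hmN hkN hη (hpos _ h.1 h.2) hDD (hratio _ h.1 h.2)).2
      have h2 := hinv _ h.1 h.2
      calc _ ≤ 4 / (N * distFun μ D' (kthDist D k w)) := h1
        _ = 4 * (1 / (N * distFun μ D' (kthDist D k w))) := by ring
        _ ≤ 4 * (θ * (1 + 1 / (N * distFun μ D (kthDist D k w)))) := by gcongr
        _ = _ := by ring
    · positivity
  have hiV : Integrable (fun w => 4 * θ + 4 * θ / N * (1 / distFun μ D (kthDist D k w))) π :=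
    (integrable_const _).add (hiU.const_mul _)
  have hi4 : Integrable (fun w => G4 (Z w)) π :=
    hiV.mono' (hG4m.comp hpair).aestronglyMeasurable (ae_of_all _ fun w => by
      rw [Real.norm_of_nonneg (hG4n _)]
      exact hG4le w)
  have hI4 : ∫ w, G4 (Z w) ∂π ≤ 8 * θ := by
    calc ∫ w, G4 (Z w) ∂π ≤ ∫ w, (4 * θ + 4 * θ / N * (1 / distFun μ D (kthDist D k w))) ∂π :=
          integral_mono hi4 hiV hG4le
      _ = 4 * θ + 4 * θ / N * ∫ w, 1 / distFun μ D (kthDist D k w) ∂π := by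
          rw [integral_add (integrable_const _) (hiU.const_mul _), integral_const, probReal_univ,
            one_smul, integral_const_mul]
      _ ≤ 4 * θ + 4 * θ / N * N := by
          gcongr
          refine hIU.trans ?_
          exact_mod_cast (by omega : Fintype.card κ ≤ N)
      _ = 8 * θ := by
          field_simp
          ring
  obtain ⟨hi3, hI3⟩ := integrable_and_integral_le_of_lintegral_le (ν := π) (f := fun w => G3 (Z w))
    (g := fun w => G4 (Z w)) (hG3m.comp hpair) (fun w => hG3n _) hi4 (fun w => hG4n _)
    (lintegral_kthDist_countLE_mono hD hD' hD0 hDD hatom hk1 hkn hG3m hG3n hG4m hG4n fun r => by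
      rw [condSum_ite m S (fun q => 1 / (q.2 : ℝ)),
        condSum_ite m S (fun q => 1 / condMean μ D D' m q.1)]
      split_ifs with h
      · exact condSum_inv_le hk1 (hlt r h) m
      · exact le_rfl)
  have hSρ : MeasurableSet {w : κ → E | S (kthDist D k w)} := hρm hSm
  have hLm : Measurable fun w : κ → E => if S (kthDist D k w) then
      Real.log (N * distFun μ D' (kthDist D k w)) else 0 :=
    Measurable.ite hSρ (Real.measurable_log.comp ((hFm'.comp hρm).const_mul _)) measurable_const
  have hiL : Integrable (fun w : κ → E => if S (kthDist D k w) then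
      Real.log (N * distFun μ D' (kthDist D k w)) else 0) π := by
    have hlog := (integrable_log_distFun_kthDist (κ := κ) hD hD0 hatom hk1 hkn).1
    refine ((integrable_const |Real.log N|).add hlog.abs).mono' hLm.aestronglyMeasurable
      (ae_of_all _ fun w => ?_)
    simp only [Pi.add_apply]
    split_ifs with h
    · have h1 := hpos _ h.1 h.2
      have h2 := distFun_le_distFun (μ := μ) hDD (kthDist D k w)
      have h3 := h1.trans_le h2
      rw [Real.log_mul hN0.ne' h3.ne']
      refine (norm_add_le _ _).trans (add_le_add le_rfl ?_)
      rw [Real.norm_eq_abs, abs_of_nonpos (Real.log_nonpos h3.le (distFun_le_one _ _)),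
        abs_of_nonpos (Real.log_nonpos h1.le (distFun_le_one _ _))]
      exact neg_le_neg (Real.log_le_log h1 h2)
    · simp
      positivity
  have hPm : Measurable fun w : κ → E => if S (kthDist D k w) then
      φ (countLE D' w (kthDist D k w)) else 0 :=
    Measurable.ite hSρ ((measurable_from_top (f := φ)).comp hnm) measurable_const
  have hn1 : ∀ w : κ → E, k ≤ countLE D' w (kthDist D k w) := le_countLE_kthDist hD0 hDD hkn
  have hiP : Integrable (fun w : κ → E => if S (kthDist D k w) then
      φ (countLE D' w (kthDist D k w)) else 0) π := by
    refine Integrable.of_bound (C := N + 1) hPm.aestronglyMeasurable (ae_of_all _ fun w => ?_)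
    split_ifs with h
    · set c := countLE D' w (kthDist D k w) with hc
      have hc1 : 1 ≤ c := hk1.trans (hn1 w)
      have hc1' : (1 : ℝ) ≤ c := by exact_mod_cast hc1
      have hcN : (c : ℝ) ≤ N := by
        have := countLE_le_card (D := D') w (kthDist D k w)
        exact_mod_cast (by omega : c ≤ N)
      have h1 := abs_le.1 (hφ c hc1)
      have h2 : 1 / (c : ℝ) ≤ 1 := by
        rw [div_le_one (by linarith)]
        exact hc1'
      have h3 := Real.log_nonneg hc1'
      have h4 := Real.log_le_sub_one_of_pos (by linarith : (0 : ℝ) < c)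
      rw [Real.norm_eq_abs, abs_le]
      constructor <;> linarith [h1.1, h1.2]
    · simp
      positivity
  have hsplit : (fun w : κ → E => if S (kthDist D k w) then
      φ (countLE D' w (kthDist D k w)) - Real.log (N * distFun μ D' (kthDist D k w)) else 0)
      = fun w => (if S (kthDist D k w) then φ (countLE D' w (kthDist D k w)) else 0)
        - if S (kthDist D k w) then Real.log (N * distFun μ D' (kthDist D k w)) else 0 := by
    ext w
    split_ifs <;> simp
  have hiΨ : Integrable (fun w : κ → E => if S (kthDist D k w) then
      φ (countLE D' w (kthDist D k w)) - Real.log (N * distFun μ D' (kthDist D k w)) else 0) π := by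
    rw [hsplit]
    exact hiP.sub hiL
  refine ⟨hiΨ, hiL, ?_⟩
  set ε : ℝ := 2 * k / N + 2 * η with hε
  have hε0 : 0 ≤ ε := by positivity
  -- From log(c/q) ≤ c/q - 1 and log(q/c) ≤ q/c - 1. The k points always counted contribute the
  -- extra k/q, and replacing log c by φ(c) costs 1/c.
  have hpt : ∀ w, (if S (kthDist D k w) then
      φ (countLE D' w (kthDist D k w)) - Real.log (N * distFun μ D' (kthDist D k w)) else 0)
        ≤ G3 (Z w) + (G1 (Z w) + k * G4 (Z w) - G0 (Z w)) + ε ∧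
      -G3 (Z w) + (G0 (Z w) - G2 (Z w)) - ε ≤ (if S (kthDist D k w) then
      φ (countLE D' w (kthDist D k w)) - Real.log (N * distFun μ D' (kthDist D k w)) else 0) := by
    intro w
    simp only [G0, G1, G2, G3, G4, Z]
    split_ifs with h
    · set c := countLE D' w (kthDist D k w) with hc
      set q := condMean μ D D' m (kthDist D k w) with hq
      have hqpos : 0 < q := condMean_pos (hlt _ h) m
      have hc1 : 1 ≤ c := hk1.trans (hn1 w)
      have hcpos : (0 : ℝ) < c := by exact_mod_cast hc1
      have h1 := abs_le.1 (hφ c hc1)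
      have h2 := abs_le.1
        (abs_log_condMean_sub_le hmN hkN hη (hpos _ h.1 h.2) hDD (hratio _ h.1 h.2)).1
      rw [← hq, ← hε] at h2
      have h3 := Real.log_le_sub_one_of_pos (by positivity : 0 < (c : ℝ) / q)
      have h4 := Real.log_le_sub_one_of_pos (by positivity : 0 < q / c)
      rw [Real.log_div hcpos.ne' hqpos.ne'] at h3
      rw [Real.log_div hqpos.ne' hcpos.ne'] at h4
      have h5 : ((c - k : ℕ) : ℝ) / q + k * (1 / q) = c / q := by
        rw [Nat.cast_sub (hn1 w)]
        ring
      constructor <;> linarith [h1.1, h1.2, h2.1, h2.2]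
    · constructor <;> simp [hε0]
  have hi14 : Integrable (fun w => G1 (Z w) + k * G4 (Z w)) π := hi1.add (hi4.const_mul k)
  have hi140 : Integrable (fun w => G1 (Z w) + k * G4 (Z w) - G0 (Z w)) π := hi14.sub hi0
  have hi3140 : Integrable (fun w => G3 (Z w) + (G1 (Z w) + k * G4 (Z w) - G0 (Z w))) π :=
    hi3.add hi140
  have hi02 : Integrable (fun w => G0 (Z w) - G2 (Z w)) π := hi0.sub hi2
  have hi302 : Integrable (fun w => -G3 (Z w) + (G0 (Z w) - G2 (Z w))) π := hi3.neg.add hi02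
  have hi3n : Integrable (fun w => -G3 (Z w)) π := hi3.neg
  have hup := integral_mono hiΨ (hi3140.add (integrable_const ε)) fun w => (hpt w).1
  have hlow := integral_mono (hi302.sub (integrable_const ε)) hiΨ fun w => (hpt w).2
  rw [integral_add' hi3140 (integrable_const ε), integral_add hi3 hi140, integral_sub hi14 hi0,
    integral_add hi1 (hi4.const_mul k), integral_const_mul, integral_const, probReal_univ,
    one_smul] at hup
  rw [integral_sub' hi302 (integrable_const ε), integral_add hi3n hi02, integral_neg,
    integral_sub hi0 hi2, integral_const, probReal_univ, one_smul] at hlow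
  have hk0 : (0 : ℝ) ≤ k := Nat.cast_nonneg k
  have hkI : k * ∫ w, G4 (Z w) ∂π ≤ k * (8 * θ) := by gcongr
  have hkθ : 0 ≤ k * (8 * θ) := by positivity
  refine abs_le.2 ⟨?_, ?_⟩ <;> linarith

end LocalEstimate

/-! ### Bias of the local estimate in terms of ball masses -/

section LocalBias

variable {E : Type*} [MeasurableSpace E] {μ : Measure E} [IsProbabilityMeasure μ]
  {κ : Type*} [Fintype κ] [DecidableEq κ] {D Dx Dy : E → ℝ} {k : ℕ}

/-- The truncated estimate at a point, as a function of the distances to the other points. -/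
noncomputable def localEst (φ : ℕ → ℝ) (c a : ℝ) (k : ℕ) (D Dx Dy : E → ℝ) (w : κ → E) : ℝ :=
  if kthDist D k w ≤ a then
    c - φ (countLE Dx w (kthDist D k w)) - φ (countLE Dy w (kthDist D k w))
  else 0

lemma abs_count_le {φ : ℕ → ℝ} (hφ : ∀ c, 1 ≤ c → |φ c - Real.log c| ≤ 1 / c) {c N : ℕ}
    (hc : 1 ≤ c) (hcN : c ≤ N) : |φ c| ≤ Real.log N + 1 := by
  have hc1' : (1 : ℝ) ≤ c := by exact_mod_cast hc
  have h1 := abs_le.1 (hφ c hc)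
  have h2 : 1 / (c : ℝ) ≤ 1 := by
    rw [div_le_one (by linarith)]
    exact hc1'
  have h3 := Real.log_nonneg hc1'
  have h4 : Real.log c ≤ Real.log N := Real.log_le_log (by linarith) (by exact_mod_cast hcN)
  rw [abs_le]
  constructor <;> linarith [h1.1, h1.2]

lemma abs_localEst_le (hD0 : ∀ x, 0 ≤ D x) (hx : ∀ x, Dx x ≤ D x) (hy : ∀ x, Dy x ≤ D x)
    (hk : 1 ≤ k) {N : ℕ} (hN : Fintype.card κ + 1 = N) (hkN : k < N) {φ : ℕ → ℝ}
    (hφ : ∀ c, 1 ≤ c → |φ c - Real.log c| ≤ 1 / c) (c a : ℝ) (w : κ → E) :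
    |localEst φ c a k D Dx Dy w| ≤ |c| + 2 * (Real.log N + 1) := by
  have hkn : k ≤ Fintype.card κ := by omega
  have hlog : 0 ≤ Real.log N := Real.log_natCast_nonneg N
  unfold localEst
  split_ifs with h
  · have h1 := abs_count_le hφ (hk.trans (le_countLE_kthDist hD0 hx hkn w))
      ((countLE_le_card w _).trans (by omega : Fintype.card κ ≤ N))
    have h2 := abs_count_le hφ (hk.trans (le_countLE_kthDist hD0 hy hkn w))
      ((countLE_le_card w _).trans (by omega : Fintype.card κ ≤ N))
    refine (abs_sub _ _).trans ?_
    have h3 := abs_sub c (φ (countLE Dx w (kthDist D k w)))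
    linarith
  · rw [abs_zero]
    positivity

/-- Here t is the target value and l is the approximate value of log F_X + log F_Y - log F; the
estimator's constant involves only the sum l + t. Replacing each φ by the logarithm of the
corresponding mass leaves E log F(ρ), known exactly, so up to small errors ψ - log N and -E log F
cancel and t remains. -/
theorem abs_integral_localEst_sub_le (hD : Measurable D) (hDx : Measurable Dx) (hDy : Measurable Dy)
    (hD0 : ∀ x, 0 ≤ D x) (hx : ∀ x, Dx x ≤ D x) (hy : ∀ x, Dy x ≤ D x)
    (hatom : ∀ r, μ {x | D x = r} = 0) (hk : 2 ≤ k)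
    {N : ℕ} (hN : Fintype.card κ + 1 = N) (hkN : 2 * k ≤ N) {a η θ ξ l t ψ : ℝ} (ha : 0 < a)
    (hη0 : 0 ≤ η) (hη : η ≤ 1 / 2) (hθ : 0 ≤ θ)
    (hpos : ∀ r, 0 < r → r ≤ a → 0 < distFun μ D r)
    (hrx : ∀ r, 0 < r → r ≤ a → distFun μ D r ≤ η * distFun μ Dx r)
    (hry : ∀ r, 0 < r → r ≤ a → distFun μ D r ≤ η * distFun μ Dy r)
    (hix : ∀ r, 0 < r → r ≤ a →
      1 / (N * distFun μ Dx r) ≤ θ * (1 + 1 / (N * distFun μ D r)))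
    (hiy : ∀ r, 0 < r → r ≤ a →
      1 / (N * distFun μ Dy r) ≤ θ * (1 + 1 / (N * distFun μ D r)))
    (hl : ∀ r, 0 < r → r ≤ a → |Real.log (distFun μ Dx r) + Real.log (distFun μ Dy r)
      - Real.log (distFun μ D r) - l| ≤ ξ)
    {φ : ℕ → ℝ} (hφ : ∀ c, 1 ≤ c → |φ c - Real.log c| ≤ 1 / c) :
    |∫ w, localEst φ (ψ + Real.log N + l + t) a k D Dx Dy w ∂(Measure.pi fun _ : κ => μ) - t|
      ≤ (Measure.pi fun _ : κ => μ).real {w | a < kthDist D k w}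
          * (|ψ - Real.log N + t| + |Real.log (distFun μ D a)|)
        + |ψ + ∑ j ∈ Finset.range (Fintype.card κ - k + 1), 1 / ((k : ℝ) + j) - Real.log N|
        + ξ + 2 * (2 * k / N + 2 * η + 8 * (k + 1) * θ) := by
  classical
  have hk1 : 1 ≤ k := by omega
  have hkn : k ≤ Fintype.card κ := by omega
  have hN0 : (0 : ℝ) < N := by
    have : 0 < N := by omega
    exact_mod_cast this
  have hξ : 0 ≤ ξ := (abs_nonneg _).trans (hl a ha le_rfl)
  obtain ⟨hiX, hiLX, hX⟩ := abs_integral_count_sub_log_le (κ := κ) hD hDx hD0 hx hatom hk hN hkN hη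
    hθ hη0 hpos hrx hix hφ
  obtain ⟨hiY, hiLY, hY⟩ := abs_integral_count_sub_log_le (κ := κ) hD hDy hD0 hy hatom hk hN hkN hη
    hθ hη0 hpos hry hiy hφ
  obtain ⟨hiF, hF⟩ := integrable_log_distFun_kthDist (κ := κ) hD hD0 hatom hk1 hkn
  have hρm : Measurable (kthDist D k : (κ → E) → ℝ) := measurable_kthDist hD hD0 hkn
  have hFm : Measurable (distFun μ D) := (monotone_distFun D).measurable
  have hρpos : ∀ᵐ w ∂(Measure.pi fun _ : κ => μ), 0 < kthDist D k w := by
    filter_upwards [ae_distFun_kthDist_pos (κ := κ) hD hD0 hatom hk1 hkn hρm] with w hw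
    refine lt_of_le_of_ne (kthDist_nonneg w) fun h => hw.ne' ?_
    rw [← h]
    have : {x | D x ≤ 0} = {x | D x = 0} := by
      ext x
      exact ⟨fun h => le_antisymm h (hD0 x), fun h => le_of_eq h⟩
    rw [distFun, this, measureReal_def, hatom 0, ENNReal.toReal_zero]
  set π := Measure.pi fun _ : κ => μ with hπ
  set S : ℝ → Prop := fun r => 0 < r ∧ r ≤ a with hS
  have hSm : MeasurableSet {w : κ → E | S (kthDist D k w)} :=
    hρm (measurableSet_Ioi.inter measurableSet_Iic)
  set I : (κ → E) → ℝ := fun w => if S (kthDist D k w) then 1 else 0 with hI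
  have hIm : Measurable I := Measurable.ite hSm measurable_const measurable_const
  have hIb : ∀ w, |I w| ≤ 1 := fun w => by simp only [hI]; split_ifs <;> simp
  have hiI : Integrable I π := Integrable.of_bound (C := 1) hIm.aestronglyMeasurable
    (ae_of_all _ hIb)
  set LF : (κ → E) → ℝ := fun w => Real.log (distFun μ D (kthDist D k w)) with hLF
  set X : (κ → E) → ℝ := fun w => if S (kthDist D k w) then
      φ (countLE Dx w (kthDist D k w)) - Real.log (N * distFun μ Dx (kthDist D k w)) else 0 with hXd
  set Y : (κ → E) → ℝ := fun w => if S (kthDist D k w) then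
      φ (countLE Dy w (kthDist D k w)) - Real.log (N * distFun μ Dy (kthDist D k w)) else 0 with hYd
  set LX : (κ → E) → ℝ := fun w => if S (kthDist D k w) then
      Real.log (N * distFun μ Dx (kthDist D k w)) else 0 with hLXd
  set LY : (κ → E) → ℝ := fun w => if S (kthDist D k w) then
      Real.log (N * distFun μ Dy (kthDist D k w)) else 0 with hLYd
  have hiIF : Integrable (fun w => I w * LF w) π := by
    refine hiF.mono (hIm.aestronglyMeasurable.mul hiF.aestronglyMeasurable)
      (ae_of_all _ fun w => ?_)
    rw [norm_mul]
    exact mul_le_of_le_one_left (norm_nonneg _) (hIb w)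
  set R : (κ → E) → ℝ := fun w => LX w + LY w - (2 * Real.log N + l) * I w - I w * LF w with hR
  have hiR : Integrable R π := ((hiLX.add hiLY).sub (hiI.const_mul _)).sub hiIF
  have hRb : ∀ w, ‖R w‖ ≤ ξ := by
    intro w
    by_cases h : S (kthDist D k w)
    · have hp := hpos _ h.1 h.2
      have hpx := hp.trans_le (distFun_le_distFun hx (kthDist D k w))
      have hpy := hp.trans_le (distFun_le_distFun hy (kthDist D k w))
      have h1 := hl _ h.1 h.2
      simp only [hR, hLXd, hLYd, hI, hLF, if_pos h, Real.norm_eq_abs]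
      rw [Real.log_mul hN0.ne' hpx.ne', Real.log_mul hN0.ne' hpy.ne']
      refine le_trans (le_of_eq ?_) h1
      congr 1
      ring
    · simp [hR, hLXd, hLYd, hI, h, hξ]
  have hRI : |∫ w, R w ∂π| ≤ ξ := by
    have := norm_integral_le_of_norm_le_const (μ := π) (ae_of_all _ hRb)
    simpa using this
  -- Removing the truncation costs little: beyond a the mass is at least F(a), so its logarithm is
  -- at most |log F(a)| in absolute value.
  have htail : |∫ w, (LF w - I w * LF w) ∂π|
      ≤ π.real {w | a < kthDist D k w} * |Real.log (distFun μ D a)| := by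
    have hset : MeasurableSet {w : κ → E | a < kthDist D k w} :=
      measurableSet_lt measurable_const hρm
    have h1 : ∫ w, {w : κ → E | a < kthDist D k w}.indicator
        (fun _ => |Real.log (distFun μ D a)|) w ∂π
        = π.real {w | a < kthDist D k w} * |Real.log (distFun μ D a)| := by
      rw [integral_indicator_const _ hset, smul_eq_mul]
    rw [← h1, ← Real.norm_eq_abs]
    refine norm_integral_le_of_norm_le ((integrable_const _).indicator hset) ?_
    filter_upwards [hρpos] with w hw
    by_cases h : kthDist D k w ≤ a
    · have : S (kthDist D k w) := ⟨hw, h⟩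
      rw [Set.indicator_of_notMem (by simpa using h)]
      simp [hI, this]
    · rw [Set.indicator_of_mem (by simpa using h)]
      have h2 : ¬ S (kthDist D k w) := fun h' => h h'.2
      simp only [hI, if_neg h2, zero_mul, sub_zero, hLF, Real.norm_eq_abs]
      have hFa := hpos a ha le_rfl
      have h3 := monotone_distFun (μ := μ) D (not_le.1 h).le
      rw [abs_of_nonpos (Real.log_nonpos (distFun_nonneg _ _) (distFun_le_one _ _)),
        abs_of_nonpos (Real.log_nonpos (distFun_nonneg _ _) (distFun_le_one _ _))]
      exact neg_le_neg (Real.log_le_log hFa h3)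
  have hIint : ∫ w, I w ∂π = 1 - π.real {w | a < kthDist D k w} := by
    have hset : MeasurableSet {w : κ → E | a < kthDist D k w} :=
      measurableSet_lt measurable_const hρm
    have h1 : ∫ w, I w ∂π = ∫ w, (1 - {w : κ → E | a < kthDist D k w}.indicator
        (fun _ => (1 : ℝ)) w) ∂π := by
      refine integral_congr_ae ?_
      filter_upwards [hρpos] with w hw
      by_cases h : kthDist D k w ≤ a
      · have : S (kthDist D k w) := ⟨hw, h⟩
        rw [Set.indicator_of_notMem (by simpa using h)]
        simp [hI, this]
      · have h2 : ¬ S (kthDist D k w) := fun h' => h h'.2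
        rw [Set.indicator_of_mem (by simpa using h)]
        simp [hI, h2]
    rw [h1, integral_sub (integrable_const _) ((integrable_const _).indicator hset),
      integral_indicator_const _ hset]
    simp
  -- Exact decomposition: `X` and `Y` are the two count errors, `R` the error in the mass identity,
  -- the bracket the truncated tail, and the final `LF` has the known Beta mean.
  have hest : ∫ w, localEst φ (ψ + Real.log N + l + t) a k D Dx Dy w ∂π
      = ∫ w, ((ψ - Real.log N + t) * I w - X w - Y w - R w + (LF w - I w * LF w) - LF w) ∂π := by
    refine integral_congr_ae ?_
    filter_upwards [hρpos] with w hw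
    by_cases h : kthDist D k w ≤ a
    · have : S (kthDist D k w) := ⟨hw, h⟩
      simp only [localEst, hI, hXd, hYd, hR, hLXd, hLYd, if_pos h, if_pos this]
      ring
    · have h2 : ¬ S (kthDist D k w) := fun h' => h h'.2
      simp [localEst, hI, hXd, hYd, hR, hLXd, hLYd, h, h2]
  have j1 : Integrable (fun w => (ψ - Real.log N + t) * I w) π := hiI.const_mul _
  have j2 : Integrable (fun w => (ψ - Real.log N + t) * I w - X w) π := j1.sub hiX
  have j3 : Integrable (fun w => (ψ - Real.log N + t) * I w - X w - Y w) π := j2.sub hiY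
  have j4 : Integrable (fun w => (ψ - Real.log N + t) * I w - X w - Y w - R w) π := j3.sub hiR
  have j5 : Integrable (fun w => LF w - I w * LF w) π := hiF.sub hiIF
  have j6 : Integrable (fun w => (ψ - Real.log N + t) * I w - X w - Y w - R w
    + (LF w - I w * LF w)) π := j4.add j5
  rw [hest, integral_sub j6 hiF, integral_add j4 j5, integral_sub j3 hiR, integral_sub j2 hiY,
    integral_sub j1 hiX, integral_const_mul, hIint, hF]
  set P := π.real {w | a < kthDist D k w} with hP
  have hP0 : 0 ≤ P := measureReal_nonneg
  set s := ∑ j ∈ Finset.range (Fintype.card κ - k + 1), 1 / ((k : ℝ) + j) with hs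
  have e1 : |P * (ψ - Real.log N + t)| ≤ P * |ψ - Real.log N + t| := by
    rw [abs_mul, abs_of_nonneg hP0]
  have b1 := abs_le.1 e1
  have b2 := abs_le.1 hX
  have b3 := abs_le.1 hY
  have b4 := abs_le.1 hRI
  have b5 := abs_le.1 htail
  have b6 := abs_le.1 (le_refl |ψ + s - Real.log N|)
  rw [abs_le]
  constructor <;> nlinarith [b1.1, b1.2, b2.1, b2.2, b3.1, b3.2, b4.1, b4.2, b5.1, b5.2, b6.1, b6.2]

end LocalBias

section Geometry

/-! ### Balls, projections and marginals -/

/-- The properties of the `ℓ_p` distance used below; `v` is the volume of the unit ball. -/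
structure IsBallDist (ι : Type*) [Fintype ι] (p : ℝ≥0∞) (v : ℝ) : Prop where
  pos : 0 < v
  measurable_left : ∀ z : EuclideanSpace ℝ ι, Measurable fun w : EuclideanSpace ℝ ι => lpDist p w z
  nonneg : ∀ u w : EuclideanSpace ℝ ι, 0 ≤ lpDist p u w
  abs_sub_le : ∀ (u w : EuclideanSpace ℝ ι) (i : ι), |u i - w i| ≤ lpDist p u w
  volume_le : ∀ (z : EuclideanSpace ℝ ι) (r : ℝ), 0 ≤ r →
    volume {w | lpDist p w z ≤ r} = ENNReal.ofReal (v * r ^ Fintype.card ι)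

lemma lpDist_two {ι : Type*} [Fintype ι] (u w : EuclideanSpace ℝ ι) : lpDist 2 u w = dist u w := rfl

lemma lpDist_top {ι : Type*} [Fintype ι] (u w : EuclideanSpace ℝ ι) :
    lpDist ∞ u w = ‖u.ofLp - w.ofLp‖ := by
  rw [lpDist, dist_eq_norm]
  refine le_antisymm ?_ ?_
  · rw [PiLp.norm_eq_ciSup]
    exact Real.iSup_le (fun i => norm_le_pi_norm (u.ofLp - w.ofLp) i) (norm_nonneg _)
  · rw [pi_norm_le_iff_of_nonneg (norm_nonneg _)]
    exact fun i => PiLp.norm_apply_le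
      (WithLp.toLp ∞ u.ofLp - WithLp.toLp ∞ w.ofLp : PiLp ∞ fun _ : ι => ℝ) i

lemma measurable_lpDist {ι α : Type*} [Fintype ι] [MeasurableSpace α] {p : ℝ≥0∞}
    (hp : p = 2 ∨ p = ∞) {g h : α → EuclideanSpace ℝ ι} (hg : Measurable g) (hh : Measurable h) :
    Measurable fun x => lpDist p (g x) (h x) := by
  rcases hp with rfl | rfl
  · simp only [lpDist_two]
    fun_prop
  · simp only [lpDist_top]
    fun_prop

lemma isBallDist_two (ι : Type*) [Fintype ι] [Nonempty ι] :
    IsBallDist ι 2 (unitBallVolume (Fintype.card ι)) where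
  pos := by
    unfold unitBallVolume
    have : 0 < Real.Gamma ((Fintype.card ι : ℝ) / 2 + 1) := Real.Gamma_pos_of_pos (by positivity)
    positivity
  measurable_left z := by
    simp only [lpDist_two]
    fun_prop
  nonneg u w := dist_nonneg
  abs_sub_le u w i := by
    rw [lpDist_two, dist_eq_norm]
    simpa using PiLp.norm_apply_le (u - w) i
  volume_le z r hr := by
    have h : {w | lpDist 2 w z ≤ r} = Metric.closedBall z r := rfl
    have hv : √Real.pi ^ Fintype.card ι / Real.Gamma ((Fintype.card ι : ℝ) / 2 + 1)
        = unitBallVolume (Fintype.card ι) := by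
      rw [unitBallVolume, Real.sqrt_eq_rpow, ← Real.rpow_natCast, ← Real.rpow_mul Real.pi_pos.le]
      congr 2
      ring
    rw [h, EuclideanSpace.volume_closedBall, hv, mul_comm, ← ENNReal.ofReal_pow hr,
      ← ENNReal.ofReal_mul]
    unfold unitBallVolume
    have : 0 < Real.Gamma ((Fintype.card ι : ℝ) / 2 + 1) := Real.Gamma_pos_of_pos (by positivity)
    positivity

lemma isBallDist_top (ι : Type*) [Fintype ι] : IsBallDist ι ∞ (2 ^ Fintype.card ι) where
  pos := by positivity
  measurable_left z := by
    simp only [lpDist_top]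
    fun_prop
  nonneg u w := dist_nonneg
  abs_sub_le u w i := by
    rw [lpDist_top]
    exact norm_le_pi_norm (u.ofLp - w.ofLp) i
  volume_le z r hr := by
    have h : {w | lpDist ∞ w z ≤ r} = WithLp.ofLp ⁻¹' Metric.closedBall z.ofLp r := by
      ext w
      simp [lpDist_top, dist_eq_norm]
    rw [h, (PiLp.volume_preserving_ofLp ι).measure_preimage
      Metric.isClosed_closedBall.measurableSet.nullMeasurableSet, Real.volume_pi_closedBall _ hr,
      mul_pow]

variable {dx dy : ℕ}

/-- The first component of a point of the joint space. -/
noncomputable def projX (z : EuclideanSpace ℝ (Fin dx ⊕ Fin dy)) : EuclideanSpace ℝ (Fin dx) :=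
  WithLp.toLp 2 fun i => z (Sum.inl i)

/-- The second component of a point of the joint space. -/
noncomputable def projY (z : EuclideanSpace ℝ (Fin dx ⊕ Fin dy)) : EuclideanSpace ℝ (Fin dy) :=
  WithLp.toLp 2 fun i => z (Sum.inr i)

lemma measurable_projX :
    Measurable (projX : EuclideanSpace ℝ (Fin dx ⊕ Fin dy) → EuclideanSpace ℝ (Fin dx)) := by
  unfold projX
  fun_prop

lemma measurable_projY :
    Measurable (projY : EuclideanSpace ℝ (Fin dx ⊕ Fin dy) → EuclideanSpace ℝ (Fin dy)) := by
  unfold projY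
  fun_prop

lemma measurePreserving_joint : MeasurePreserving
    (fun q : EuclideanSpace ℝ (Fin dx) × EuclideanSpace ℝ (Fin dy) => joint q.1 q.2)
    volume volume := by
  have h1 := ((PiLp.volume_preserving_ofLp (Fin dx)).prod (PiLp.volume_preserving_ofLp (Fin dy)))
  have h2 := (measurePreserving_sumPiEquivProdPi_symm (fun _ : Fin dx ⊕ Fin dy => (volume : Measure ℝ)))
  have h3 := (PiLp.volume_preserving_toLp (Fin dx ⊕ Fin dy)).comp (h2.comp h1)
  have h4 : ∀ q : EuclideanSpace ℝ (Fin dx) × EuclideanSpace ℝ (Fin dy),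
      WithLp.toLp 2 ((MeasurableEquiv.sumPiEquivProdPi fun _ : Fin dx ⊕ Fin dy => ℝ).symm
        (Prod.map WithLp.ofLp WithLp.ofLp q)) = joint q.1 q.2 := fun q =>
    congrArg (WithLp.toLp 2) (funext fun i => by rcases i with i | i <;> rfl)
  simp only [← h4]
  exact h3

lemma lpDist_projX_le {p : ℝ≥0∞} (hp : p = 2 ∨ p = ∞) (u w : EuclideanSpace ℝ (Fin dx ⊕ Fin dy)) :
    lpDist p (projX u) (projX w) ≤ lpDist p u w := by
  rcases hp with rfl | rfl
  · rw [lpDist_two, lpDist_two, EuclideanSpace.dist_eq, EuclideanSpace.dist_eq]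
    refine Real.sqrt_le_sqrt ?_
    rw [Fintype.sum_sum_type]
    exact le_add_of_nonneg_right (by positivity)
  · rw [lpDist_top, lpDist_top, pi_norm_le_iff_of_nonneg (norm_nonneg _)]
    intro i
    have h := norm_le_pi_norm (u.ofLp - w.ofLp) (Sum.inl i)
    exact h

lemma lpDist_projY_le {p : ℝ≥0∞} (hp : p = 2 ∨ p = ∞) (u w : EuclideanSpace ℝ (Fin dx ⊕ Fin dy)) :
    lpDist p (projY u) (projY w) ≤ lpDist p u w := by
  rcases hp with rfl | rfl
  · rw [lpDist_two, lpDist_two, EuclideanSpace.dist_eq, EuclideanSpace.dist_eq]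
    refine Real.sqrt_le_sqrt ?_
    rw [Fintype.sum_sum_type]
    exact le_add_of_nonneg_left (by positivity)
  · rw [lpDist_top, lpDist_top, pi_norm_le_iff_of_nonneg (norm_nonneg _)]
    intro i
    have h := norm_le_pi_norm (u.ofLp - w.ofLp) (Sum.inr i)
    exact h

/-- Ball volume is continuous in the radius, so spheres are null. This supplies the absence of atoms
for the distance from a fixed point. -/
lemma IsBallDist.volume_eq_zero {ι : Type*} [Fintype ι] [Nonempty ι] {p : ℝ≥0∞} {v : ℝ}
    (h : IsBallDist ι p v) (z : EuclideanSpace ℝ ι) (r : ℝ) : volume {w | lpDist p w z = r} = 0 := by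
  have hm : ∀ s, MeasurableSet {w | lpDist p w z ≤ s} := fun s =>
    measurableSet_le (h.measurable_left z) measurable_const
  rcases lt_trichotomy r 0 with hr | hr | hr
  · have he : {w | lpDist p w z = r} = ∅ :=
      Set.eq_empty_of_forall_notMem fun w hw => (h.nonneg w z).not_gt (lt_of_eq_of_lt hw hr)
    rw [he, measure_empty]
  · refine measure_mono_null (t := {w | lpDist p w z ≤ r}) (fun w hw => le_of_eq hw) ?_
    rw [h.volume_le z r hr.ge, hr, zero_pow Fintype.card_ne_zero, mul_zero, ENNReal.ofReal_zero]
  · have key : ∀ s, 0 ≤ s → s < r → volume {w | lpDist p w z = r}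
        ≤ ENNReal.ofReal (v * r ^ Fintype.card ι - v * s ^ Fintype.card ι) := by
      intro s hs hsr
      have hv := h.pos
      rw [ENNReal.ofReal_sub _ (by positivity), ← h.volume_le z r hr.le, ← h.volume_le z s hs,
        ← measure_sdiff (s₁ := {w | lpDist p w z ≤ r}) (s₂ := {w | lpDist p w z ≤ s})
          (fun w hw => le_trans hw hsr.le) (hm s).nullMeasurableSet
          (by rw [h.volume_le z s hs]; exact ENNReal.ofReal_ne_top)]
      exact measure_mono fun w hw => ⟨le_of_eq hw, by simpa [show lpDist p w z = r from hw] using hsr⟩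
    have hlim : Tendsto (fun s => ENNReal.ofReal (v * r ^ Fintype.card ι - v * s ^ Fintype.card ι))
        (nhdsWithin r (Set.Iio r)) (nhds (ENNReal.ofReal 0)) := by
      refine ENNReal.tendsto_ofReal (Tendsto.mono_left ?_ nhdsWithin_le_nhds)
      have : Continuous fun s : ℝ => v * r ^ Fintype.card ι - v * s ^ Fintype.card ι := by fun_prop
      simpa using this.tendsto r
    rw [ENNReal.ofReal_zero] at hlim
    refine le_antisymm (ge_of_tendsto hlim ?_) zero_le
    filter_upwards [self_mem_nhdsWithin, nhdsWithin_le_nhds (lt_mem_nhds hr)] with s hs hs0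
    exact key s hs0.le hs

end Geometry

/-! ### Marginals of a function on a product space -/

section Marginals

variable {α β : Type*} [MeasurableSpace α] [MeasurableSpace β] {ν₁ : Measure α} {ν₂ : Measure β}
  [SFinite ν₂]

lemma setLIntegral_marginal [SFinite ν₁] {F : α × β → ℝ} (hF : Integrable F (ν₁.prod ν₂)) (hFm : Measurable F)
    (hF0 : ∀ q, 0 ≤ F q) {g : α → ℝ≥0∞} (hg : Measurable g) :
    ∫⁻ q, ENNReal.ofReal (F q) * g q.1 ∂(ν₁.prod ν₂)
      = ∫⁻ x, ENNReal.ofReal (∫ y, F (x, y) ∂ν₂) * g x ∂ν₁ := by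
  rw [lintegral_prod _ (by fun_prop)]
  refine lintegral_congr_ae ?_
  filter_upwards [hF.prod_right_ae] with x hx
  rw [lintegral_mul_const _ (by fun_prop), ofReal_integral_eq_lintegral_ofReal hx
    (ae_of_all _ fun y => hF0 _)]

/-- If the marginal at x is nonzero, some y has F(x, y) ≥ c with conditional density below C, so the
marginal exceeds c/C. The form |C| + 1 keeps the denominator positive for any real C. -/
lemma ae_marginal_dichotomy {F : α × β → ℝ} {c C : ℝ} (hF0 : ∀ q, 0 ≤ F q)
    (hcond : ∀ᵐ q ∂(ν₁.prod ν₂), F q / (∫ y, F (q.1, y) ∂ν₂) < C)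
    (hd : ∀ᵐ q ∂(ν₁.prod ν₂), F q = 0 ∨ c ≤ F q) :
    ∀ᵐ x ∂ν₁, (∫ y, F (x, y) ∂ν₂) = 0 ∨ c / (|C| + 1) ≤ ∫ y, F (x, y) ∂ν₂ := by
  filter_upwards [Measure.ae_ae_of_ae_prod (hcond.and hd)] with x hx
  by_cases h0 : (∫ y, F (x, y) ∂ν₂) = 0
  · exact Or.inl h0
  right
  have hpos : 0 < ∫ y, F (x, y) ∂ν₂ :=
    lt_of_le_of_ne (integral_nonneg fun y => hF0 _) (Ne.symm h0)
  have hex : ∃ y, (F (x, y) / (∫ y, F (x, y) ∂ν₂) < C ∧ (F (x, y) = 0 ∨ c ≤ F (x, y)))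
      ∧ F (x, y) ≠ 0 := by
    by_contra! hn
    refine h0 (integral_eq_zero_of_ae ?_)
    filter_upwards [hx] with y hy using hn y hy
  obtain ⟨y, ⟨h1, h2⟩, h3⟩ := hex
  have h4 := h2.resolve_left h3
  rw [div_lt_iff₀ hpos] at h1
  rw [div_le_iff₀ (by positivity)]
  have := le_abs_self C
  nlinarith

end Marginals

/-! ### Consequences of the regularity assumption -/

section Density

variable {dx dy : ℕ} {f : EuclideanSpace ℝ (Fin dx ⊕ Fin dy) → ℝ}
  {Ca Cb Cc Cd Ce Cf Cg Ch C0 : ℝ}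

/-- On {f < C0/2} the weight e^(-bf) is at least e^(-b C0/2), so the mass of that set is at most Cc
e^(-b C0/2), which tends to 0 as b grows. -/
lemma RateAssumption.dichotomy (hf : RateAssumption f Ca Cb Cc Cd Ce Cf Cg Ch C0)
    (hm : Measurable f) (h0 : ∀ z, 0 ≤ f z) (hi : Integrable f) :
    ∀ᵐ z, f z = 0 ∨ C0 / 2 ≤ f z := by
  have hC0 := hf.C0_pos
  set A : Set (EuclideanSpace ℝ (Fin dx ⊕ Fin dy)) := {z | f z < C0 / 2} with hA
  have hAm : MeasurableSet A := measurableSet_lt hm measurable_const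
  have hbound : ∀ b : ℝ, 1 < b → ∫ z in A, f z ≤ Cc * Real.exp (-(C0 / 2) * b) := by
    intro b hb
    have hexp : Integrable fun z => f z * Real.exp (-b * f z) := by
      refine hi.mono (by fun_prop) (ae_of_all _ fun z => ?_)
      rw [norm_mul]
      refine mul_le_of_le_one_right (norm_nonneg _) ?_
      rw [Real.norm_of_nonneg (Real.exp_pos _).le, Real.exp_le_one_iff]
      have := h0 z
      nlinarith
    have h1 : Real.exp (-b * (C0 / 2)) * ∫ z in A, f z ≤ Cc * Real.exp (-C0 * b) := by
      rw [← integral_const_mul]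
      refine le_trans ?_ (hf.tail b hb)
      calc ∫ z in A, Real.exp (-b * (C0 / 2)) * f z ≤ ∫ z in A, f z * Real.exp (-b * f z) := by
            refine setIntegral_mono_on (hi.integrableOn.const_mul _) hexp.integrableOn hAm
              fun z hz => ?_
            rw [mul_comm]
            refine mul_le_mul_of_nonneg_left (Real.exp_le_exp.2 ?_) (h0 z)
            have : f z < C0 / 2 := hz
            nlinarith
        _ ≤ ∫ z, f z * Real.exp (-b * f z) := setIntegral_le_integral hexp
            (ae_of_all _ fun z => mul_nonneg (h0 z) (Real.exp_pos _).le)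
    have h2 : Real.exp (-C0 * b) = Real.exp (-b * (C0 / 2)) * Real.exp (-(C0 / 2) * b) := by
      rw [← Real.exp_add]
      congr 1
      ring
    rw [h2] at h1
    have h3 := Real.exp_pos (-b * (C0 / 2))
    rw [mul_left_comm] at h1
    exact le_of_mul_le_mul_left h1 h3
  have hlim : Tendsto (fun b : ℝ => Cc * Real.exp (-(C0 / 2) * b)) atTop (nhds (Cc * 0)) := by
    refine Tendsto.const_mul _ (Real.tendsto_exp_atBot.comp ?_)
    exact tendsto_id.const_mul_atTop_of_neg (by linarith)
  rw [mul_zero] at hlim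
  have hle : ∫ z in A, f z ≤ 0 := by
    refine ge_of_tendsto hlim ?_
    filter_upwards [eventually_gt_atTop 1] with b hb using hbound b hb
  have heq : ∫ z in A, f z = 0 := le_antisymm hle (integral_nonneg h0)
  have hae := (setIntegral_eq_zero_iff_of_nonneg_ae (ae_of_all _ h0) hi.integrableOn).1 heq
  rw [EventuallyEq, ae_restrict_iff' hAm] at hae
  filter_upwards [hae] with z hz
  by_cases hzA : z ∈ A
  · exact Or.inl (hz hzA)
  · exact Or.inr (not_lt.1 hzA)

lemma RateAssumption.piecewiseSmooth (hf : RateAssumption f Ca Cb Cc Cd Ce Cf Cg Ch C0)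
    (hm : Measurable f) (h0 : ∀ z, 0 ≤ f z) (h1 : ∫⁻ z, ENNReal.ofReal (f z) = 1) :
    PiecewiseSmooth f (C0 / 2) Ca Cd := by
  have hne : ∫⁻ z, ENNReal.ofReal (f z) ≠ ∞ := by rw [h1]; exact ENNReal.one_ne_top
  have hi : Integrable f := (lintegral_ofReal_ne_top_iff_integrable hm.aestronglyMeasurable
    (ae_of_all _ h0)).1 hne
  refine ⟨half_pos hf.C0_pos, hm, h0, hne, hf.bounded, hf.dichotomy hm h0 hi, ?_⟩
  have := hf.hausdorff
  rw [Fintype.card_sum, Fintype.card_fin, Fintype.card_fin, Nat.cast_add]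
  exact ne_top_of_le_ne_top ENNReal.ofReal_ne_top this

lemma lintegral_projX (hm : Measurable f) (h0 : ∀ z, 0 ≤ f z) (hi : Integrable f)
    {g : EuclideanSpace ℝ (Fin dx) → ℝ≥0∞} (hg : Measurable g) :
    ∫⁻ z, ENNReal.ofReal (f z) * g (projX z) = ∫⁻ x, ENNReal.ofReal (marginalX f x) * g x := by
  have hj := measurePreserving_joint (dx := dx) (dy := dy)
  have hmeas : Measurable fun z => ENNReal.ofReal (f z) * g (projX z) :=
    hm.ennreal_ofReal.mul (hg.comp measurable_projX)
  rw [← hj.lintegral_comp hmeas]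
  exact setLIntegral_marginal (F := fun q => f (joint q.1 q.2)) (hj.integrable_comp_of_integrable hi)
    (hm.comp hj.measurable) (fun q => h0 _) hg

lemma lintegral_projY (hm : Measurable f) (h0 : ∀ z, 0 ≤ f z) (hi : Integrable f)
    {g : EuclideanSpace ℝ (Fin dy) → ℝ≥0∞} (hg : Measurable g) :
    ∫⁻ z, ENNReal.ofReal (f z) * g (projY z) = ∫⁻ y, ENNReal.ofReal (marginalY f y) * g y := by
  have hj := (measurePreserving_joint (dx := dx) (dy := dy)).comp
    (Measure.measurePreserving_swap (μ := (volume : Measure (EuclideanSpace ℝ (Fin dy))))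
      (ν := (volume : Measure (EuclideanSpace ℝ (Fin dx)))))
  have hmeas : Measurable fun z => ENNReal.ofReal (f z) * g (projY z) :=
    hm.ennreal_ofReal.mul (hg.comp measurable_projY)
  rw [← hj.lintegral_comp hmeas]
  exact setLIntegral_marginal (F := fun q => f (joint q.2 q.1)) (hj.integrable_comp_of_integrable hi)
    (hm.comp hj.measurable) (fun q => h0 _) hg

lemma measurable_marginalX (hm : Measurable f) : Measurable (marginalX f) :=
  (StronglyMeasurable.integral_prod_right (f := fun x y => f (joint x y))
    (hm.comp measurePreserving_joint.measurable).stronglyMeasurable).measurable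

lemma measurable_marginalY (hm : Measurable f) : Measurable (marginalY f) :=
  (StronglyMeasurable.integral_prod_right (f := fun y x => f (joint x y))
    (hm.comp (measurePreserving_joint.measurable.comp measurable_swap)).stronglyMeasurable).measurable

lemma RateAssumption.piecewiseSmooth_marginalX
    (hf : RateAssumption f Ca Cb Cc Cd Ce Cf Cg Ch C0) (hm : Measurable f) (h0 : ∀ z, 0 ≤ f z)
    (h1 : ∫⁻ z, ENNReal.ofReal (f z) = 1) :
    PiecewiseSmooth (marginalX f) (C0 / 2 / (|Ce| + 1)) Cf Cd := by
  have hs := hf.piecewiseSmooth hm h0 h1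
  have hj := measurePreserving_joint (dx := dx) (dy := dy)
  refine ⟨by have := hs.pos; positivity, measurable_marginalX hm,
    fun x => integral_nonneg fun y => h0 _, ?_, ?_, ?_, ?_⟩
  · have := lintegral_projX hm h0 hs.integrable (g := fun _ => 1) measurable_const
    simp only [mul_one] at this
    rw [← this, h1]
    exact ENNReal.one_ne_top
  · filter_upwards [hf.margX] with x hx using hx.le
  · exact ae_marginal_dichotomy (F := fun q => f (joint q.1 q.2)) (fun q => h0 _) hf.condYX
      (hj.quasiMeasurePreserving.ae hs.dichotomy)
  · rw [Fintype.card_fin]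
    exact ne_top_of_le_ne_top ENNReal.ofReal_ne_top hf.hausdorffX

lemma RateAssumption.piecewiseSmooth_marginalY
    (hf : RateAssumption f Ca Cb Cc Cd Ce Cf Cg Ch C0) (hm : Measurable f) (h0 : ∀ z, 0 ≤ f z)
    (h1 : ∫⁻ z, ENNReal.ofReal (f z) = 1) :
    PiecewiseSmooth (marginalY f) (C0 / 2 / (|Ce| + 1)) Cf Cd := by
  have hs := hf.piecewiseSmooth hm h0 h1
  have hsw := Measure.measurePreserving_swap (μ := (volume : Measure (EuclideanSpace ℝ (Fin dy))))
      (ν := (volume : Measure (EuclideanSpace ℝ (Fin dx))))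
  have hj := (measurePreserving_joint (dx := dx) (dy := dy)).comp hsw
  refine ⟨by have := hs.pos; positivity, measurable_marginalY hm,
    fun x => integral_nonneg fun y => h0 _, ?_, ?_, ?_, ?_⟩
  · have := lintegral_projY hm h0 hs.integrable (g := fun _ => 1) measurable_const
    simp only [mul_one] at this
    rw [← this, h1]
    exact ENNReal.one_ne_top
  · filter_upwards [hf.margY] with x hx using hx.le
  · exact ae_marginal_dichotomy (F := fun q => f (joint q.2 q.1)) (fun q => h0 _)
      (hsw.quasiMeasurePreserving.ae hf.condXY) (hj.quasiMeasurePreserving.ae hs.dichotomy)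
  · rw [Fintype.card_fin]
    exact ne_top_of_le_ne_top ENNReal.ofReal_ne_top hf.hausdorffY

end Density

/-! ### The bias bound with an explicit tail -/

section LocalBias

variable {E : Type*} [MeasurableSpace E] {μ : Measure E} [IsProbabilityMeasure μ]
  {κ : Type*} [Fintype κ] [DecidableEq κ] {D Dx Dy : E → ℝ} {k : ℕ}

theorem abs_integral_localEst_sub_le_of_tail (hD : Measurable D) (hDx : Measurable Dx)
    (hDy : Measurable Dy) (hD0 : ∀ x, 0 ≤ D x) (hx : ∀ x, Dx x ≤ D x) (hy : ∀ x, Dy x ≤ D x)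
    (hatom : ∀ r, μ {x | D x = r} = 0) (hk : 2 ≤ k)
    {N : ℕ} (hN : Fintype.card κ + 1 = N) (hkN : 2 * k ≤ N) {a η ξ l t ψ T : ℝ} (ha : 0 < a)
    (hη0 : 0 ≤ η) (hη : η ≤ 1 / 2)
    (hpos : ∀ r, 0 < r → r ≤ a → 0 < distFun μ D r)
    (hrx : ∀ r, 0 < r → r ≤ a → distFun μ D r ≤ η * distFun μ Dx r)
    (hry : ∀ r, 0 < r → r ≤ a → distFun μ D r ≤ η * distFun μ Dy r)
    (hl : ∀ r, 0 < r → r ≤ a → |Real.log (distFun μ Dx r) + Real.log (distFun μ Dy r)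
      - Real.log (distFun μ D r) - l| ≤ ξ)
    {φ : ℕ → ℝ} (hφ : ∀ c, 1 ≤ c → |φ c - Real.log c| ≤ 1 / c) (haN : 1 / (N : ℝ) ≤ a)
    (htail : 2 * Real.log N ≤ Fintype.card κ * distFun μ D a / 2)
    (hFa : 1 / (N : ℝ) ≤ distFun μ D a)
    (hψ : |ψ + ∑ j ∈ Finset.range (Fintype.card κ - k + 1), 1 / ((k : ℝ) + j) - Real.log N|
      ≤ 2 / N) (ht : |t| ≤ T) :
    |∫ w, localEst φ (ψ + Real.log N + l + t) a k D Dx Dy w ∂(Measure.pi fun _ : κ => μ) - t|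
      ≤ (Real.exp k * (|ψ| + T + 2) + 2 + 4 * k) * a + ξ + (4 + 16 * (k + 1)) * η := by
  have hkn : k ≤ Fintype.card κ := by omega
  have hN1 : (1 : ℝ) ≤ N := by
    have : 1 ≤ N := by omega
    exact_mod_cast this
  have hN0 : (0 : ℝ) < N := by linarith
  -- The ratio bound already controls the inverse marginal mass, so θ may be taken equal to η.
  have hinv : ∀ r, 0 < r → r ≤ a → ∀ F : ℝ, distFun μ D r ≤ η * F →
      1 / (N * F) ≤ η * (1 + 1 / (N * distFun μ D r)) := by
    intro r hr hra F hF
    have hp := hpos r hr hra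
    have hηF : 0 < η * F := hp.trans_le hF
    have hη1 : 0 < η := lt_of_le_of_ne hη0 fun h => by rw [← h, zero_mul] at hηF; exact hηF.false
    have hF0 : 0 < F := (pos_iff_pos_of_mul_pos hηF).1 hη1
    have h1 : 1 / (N * F) ≤ η * (1 / (N * distFun μ D r)) := by
      rw [mul_one_div, div_le_div_iff₀ (by positivity) (by positivity)]
      nlinarith
    linarith
  refine (abs_integral_localEst_sub_le hD hDx hDy hD0 hx hy hatom hk hN hkN ha hη0 hη hη0 hpos hrx
    hry (fun r hr hra => hinv r hr hra _ (hrx r hr hra))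
    (fun r hr hra => hinv r hr hra _ (hry r hr hra)) hl hφ).trans ?_
  have hlogN : 0 ≤ Real.log N := Real.log_nonneg hN1
  have hT : 0 ≤ T := (abs_nonneg t).trans ht
  have hP : (Measure.pi fun _ : κ => μ).real {w | a < kthDist D k w} ≤ Real.exp k * (1 / (N : ℝ)) ^ 2 := by
    refine (measureReal_lt_kthDist_le hD hD0 hkn ha.le).trans ?_
    refine mul_le_mul_of_nonneg_left ?_ (Real.exp_pos _).le
    have h1 : (1 / (N : ℝ)) ^ 2 = Real.exp (-(2 * Real.log N)) := by
      rw [show -(2 * Real.log N) = -Real.log N + -Real.log N by ring, Real.exp_add,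
        ← Real.log_inv, Real.exp_log (by positivity)]
      ring
    rw [h1, Real.exp_le_exp]
    linarith
  have hF1 : |Real.log (distFun μ D a)| ≤ Real.log N := by
    rw [abs_of_nonpos (Real.log_nonpos (distFun_nonneg _ _) (distFun_le_one _ _))]
    have := Real.log_le_log (by positivity) hFa
    rw [one_div, Real.log_inv] at this
    linarith
  have hlog : Real.log N ≤ N := Real.log_le_self hN0.le
  have hsum : |ψ - Real.log N + t| + |Real.log (distFun μ D a)| ≤ (|ψ| + T + 2) * N := by
    have h1 : |ψ - Real.log N + t| ≤ |ψ| + Real.log N + |t| := by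
      refine (abs_add_le _ _).trans ?_
      have := abs_sub ψ (Real.log N)
      rw [abs_of_nonneg hlogN] at this
      linarith
    nlinarith [abs_nonneg ψ]
  have hmain : (Measure.pi fun _ : κ => μ).real {w | a < kthDist D k w}
      * (|ψ - Real.log N + t| + |Real.log (distFun μ D a)|)
      ≤ Real.exp k * (|ψ| + T + 2) * (1 / N) := by
    calc _ ≤ Real.exp k * (1 / (N : ℝ)) ^ 2 * ((|ψ| + T + 2) * N) :=
          mul_le_mul hP hsum (by positivity) (by positivity)
      _ = _ := by
          field_simp
  have hcoef : 0 ≤ Real.exp k * (|ψ| + T + 2) := by positivity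
  have h2 := mul_le_mul_of_nonneg_left haN hcoef
  have h3 : 2 / (N : ℝ) = 2 * (1 / N) := by ring
  have h4 : 2 * (k : ℝ) / N = 2 * k * (1 / N) := by ring
  have h5 := mul_le_mul_of_nonneg_left haN (show (0 : ℝ) ≤ 4 * k by positivity)
  rw [h4]
  rw [h3] at hψ
  nlinarith

end LocalBias

/-! ### The truncation radius -/

section Threshold

lemma threshold_pow {d : ℕ} (hd : d ≠ 0) (δ : ℝ) (N : ℕ) :
    threshold d δ N ^ d = Real.log N ^ (1 + δ) / N := by
  rw [threshold, one_div, Real.rpow_inv_natCast_pow _ hd]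
  have := Real.log_natCast_nonneg N
  positivity

lemma tendsto_log_natCast : Tendsto (fun N : ℕ => Real.log N) atTop atTop :=
  Real.tendsto_log_atTop.comp tendsto_natCast_atTop_atTop

lemma tendsto_threshold {d : ℕ} (hd : d ≠ 0) {δ : ℝ} :
    Tendsto (fun N : ℕ => threshold d δ N) atTop (nhds 0) := by
  have h1 : Tendsto (fun x : ℝ => Real.log x ^ (1 + δ) / x) atTop (nhds 0) := by
    have := (isLittleO_log_rpow_rpow_atTop (s := 1) (1 + δ) one_pos).tendsto_div_nhds_zero
    simpa using this
  have hp : (0 : ℝ) < 1 / d := by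
    have : (0 : ℝ) < d := by exact_mod_cast Nat.pos_of_ne_zero hd
    positivity
  have h2 := (h1.comp tendsto_natCast_atTop_atTop).rpow_const (p := 1 / (d : ℝ)) (Or.inr hp.le)
  rw [Real.zero_rpow hp.ne'] at h2
  exact h2

/-- A ball of radius a_N has expected count of order (log N)^(1+δ). Since δ > 0 this exceeds any
multiple of log N, and with the factor 8 the Chernoff tail becomes O(N⁻²). -/
lemma eventually_threshold {d : ℕ} (hd : d ≠ 0) {δ : ℝ} (hδ : 0 < δ) {A : ℝ} (hA : 0 < A) (B : ℝ) :
    ∀ᶠ N : ℕ in atTop, 0 < threshold d δ N ∧ threshold d δ N ≤ 1 ∧ B * threshold d δ N ≤ 1 / 2 ∧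
      1 / (N : ℝ) ≤ threshold d δ N ∧ 1 ≤ Real.log N ∧
      8 * Real.log N ≤ N * (A * threshold d δ N ^ d) := by
  have h1 : ∀ᶠ N : ℕ in atTop, B * threshold d δ N ≤ 1 / 2 := by
    have := (tendsto_threshold hd (δ := δ)).const_mul B
    rw [mul_zero] at this
    exact this.eventually_le_const (by norm_num)
  have h2 : ∀ᶠ N : ℕ in atTop, threshold d δ N ≤ 1 :=
    (tendsto_threshold hd (δ := δ)).eventually_le_const one_pos
  have h3 : ∀ᶠ N : ℕ in atTop, 8 / A ≤ Real.log N ^ δ :=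
    ((tendsto_rpow_atTop hδ).comp tendsto_log_natCast).eventually_ge_atTop _
  filter_upwards [h1, h2, h3, tendsto_log_natCast.eventually_ge_atTop 1, eventually_gt_atTop 0]
    with N h1 h2 h3 h4 h5
  have hN : (0 : ℝ) < N := by exact_mod_cast h5
  have hpos : 0 < threshold d δ N := by
    unfold threshold
    have : 0 < Real.log N := by linarith
    positivity
  refine ⟨hpos, h2, h1, ?_, h4, ?_⟩
  · refine le_trans ?_ (pow_le_of_le_one hpos.le h2 hd)
    rw [threshold_pow hd]
    gcongr
    exact Real.one_le_rpow h4 (by linarith)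
  · rw [threshold_pow hd, Real.rpow_add (by linarith), Real.rpow_one]
    rw [div_le_iff₀ hA] at h3
    have : (N : ℝ) * (A * (Real.log N * Real.log N ^ δ / N)) = Real.log N * (Real.log N ^ δ * A) := by
      field_simp
    rw [this]
    nlinarith

end Threshold

/-! ### Ball masses under the joint and marginal laws -/

section Densities

variable {ι : Type*} [Fintype ι] {g : EuclideanSpace ℝ ι → ℝ} {c C Cd v : ℝ} {p : ℝ≥0∞}

lemma PiecewiseSmooth.ae_withDensity (hg : PiecewiseSmooth g c C Cd) :
    ∀ᵐ z ∂(volume.withDensity fun z => ENNReal.ofReal (g z)), c ≤ g z ∧ g z ≤ C := by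
  rw [ae_withDensity_iff hg.measurable.ennreal_ofReal]
  filter_upwards [hg.le, hg.dichotomy] with z h1 h2 h3
  exact ⟨h2.resolve_left fun h => h3 (by rw [h, ENNReal.ofReal_zero]), h1⟩

lemma PiecewiseSmooth.distFun_eq (hg : PiecewiseSmooth g c C Cd) {D : EuclideanSpace ℝ ι → ℝ}
    (hD : Measurable D) (r : ℝ) :
    distFun (volume.withDensity fun z => ENNReal.ofReal (g z)) D r = ∫ w in {w | D w ≤ r}, g w := by
  rw [distFun, measureReal_def, withDensity_apply _ (measurableSet_le hD measurable_const),
    integral_eq_lintegral_of_nonneg_ae (ae_of_all _ hg.nonneg)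
      hg.measurable.aestronglyMeasurable]

lemma PiecewiseSmooth.distFun_bounds (hg : PiecewiseSmooth g c C Cd) (hb : IsBallDist ι p v)
    {a r : ℝ} (hr : 0 < r) (hra : r ≤ a) {z : EuclideanSpace ℝ ι} (hz : c ≤ g z)
    (hM : oscMax g a z ≠ ∞)
    (hMA : 4 ^ Fintype.card ι * oscMax (Set.indicator {z | 0 < g z} fun _ => (1 : ℝ)) a z
      ≤ ENNReal.ofReal (v / 2)) :
    c * v / 2 * r ^ Fintype.card ι
      ≤ distFun (volume.withDensity fun z => ENNReal.ofReal (g z)) (fun w => lpDist p w z) r ∧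
    distFun (volume.withDensity fun z => ENNReal.ofReal (g z)) (fun w => lpDist p w z) r
      ≤ C * v * r ^ Fintype.card ι ∧
    |Real.log (distFun (volume.withDensity fun z => ENNReal.ofReal (g z))
        (fun w => lpDist p w z) r) - Real.log (v * g z * r ^ Fintype.card ι)|
      ≤ 2 * 4 ^ Fintype.card ι / (c * v) * (oscMax g a z).toReal := by
  rw [hg.distFun_eq (hb.measurable_left z)]
  exact hg.setIntegral_bounds hr hra hb.pos hz hM hMA
    (fun w hw i => (hb.abs_sub_le w z i).trans hw) (hb.volume_le z r hr.le)

variable {dx dy : ℕ} {f : EuclideanSpace ℝ (Fin dx ⊕ Fin dy) → ℝ}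

lemma map_projX (hm : Measurable f) (h0 : ∀ z, 0 ≤ f z) (hi : Integrable f) :
    (volume.withDensity fun z => ENNReal.ofReal (f z)).map projX
      = volume.withDensity fun x => ENNReal.ofReal (marginalX f x) := by
  ext s hs
  have h := lintegral_projX hm h0 hi (g := s.indicator 1) (measurable_one.indicator hs)
  rw [Measure.map_apply measurable_projX hs, withDensity_apply _ (measurable_projX hs),
    withDensity_apply _ hs, ← lintegral_indicator (measurable_projX hs), ← lintegral_indicator hs]
  refine (lintegral_congr fun z => ?_).trans (h.trans (lintegral_congr fun x => ?_))
  · by_cases hz : projX z ∈ s <;> simp [Set.indicator, hz]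
  · by_cases hz : x ∈ s <;> simp [Set.indicator, hz]

lemma map_projY (hm : Measurable f) (h0 : ∀ z, 0 ≤ f z) (hi : Integrable f) :
    (volume.withDensity fun z => ENNReal.ofReal (f z)).map projY
      = volume.withDensity fun y => ENNReal.ofReal (marginalY f y) := by
  ext s hs
  have h := lintegral_projY hm h0 hi (g := s.indicator 1) (measurable_one.indicator hs)
  rw [Measure.map_apply measurable_projY hs, withDensity_apply _ (measurable_projY hs),
    withDensity_apply _ hs, ← lintegral_indicator (measurable_projY hs), ← lintegral_indicator hs]
  refine (lintegral_congr fun z => ?_).trans (h.trans (lintegral_congr fun x => ?_))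
  · by_cases hz : projY z ∈ s <;> simp [Set.indicator, hz]
  · by_cases hz : x ∈ s <;> simp [Set.indicator, hz]

lemma distFun_comp {E F : Type*} [MeasurableSpace E] [MeasurableSpace F] {μ : Measure E}
    {π : E → F} (hπ : Measurable π) {D : F → ℝ} (hD : Measurable D) (r : ℝ) :
    distFun μ (fun w => D (π w)) r = distFun (μ.map π) D r := by
  rw [distFun, distFun, map_measureReal_apply hπ (measurableSet_le hD measurable_const)]
  rfl

lemma abs_log_le_of_mem {l u x : ℝ} (hl : 0 < l) (hlx : l ≤ x) (hxu : x ≤ u) :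
    |Real.log x| ≤ |Real.log l| + |Real.log u| := by
  have h1 := Real.log_le_log hl hlx
  have h2 := Real.log_le_log (hl.trans_le hlx) hxu
  rw [abs_le]
  constructor
  · linarith [neg_abs_le (Real.log l), abs_nonneg (Real.log u)]
  · linarith [le_abs_self (Real.log u), abs_nonneg (Real.log l)]

end Densities

/-! ### Bias of the local estimate at a good point -/

section Pointwise

variable {dx dy : ℕ} {f : EuclideanSpace ℝ (Fin dx ⊕ Fin dy) → ℝ}

/-- The information density `log (f(x, y) / (f_X(x) f_Y(y)))`. -/
noncomputable def infoDensity (f : EuclideanSpace ℝ (Fin dx ⊕ Fin dy) → ℝ)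
    (z : EuclideanSpace ℝ (Fin dx ⊕ Fin dy)) : ℝ :=
  Real.log (f z) - Real.log (marginalX f (projX z)) - Real.log (marginalY f (projY z))

/-- The support of a density, as an indicator function. -/
noncomputable def supp {ι : Type*} (g : EuclideanSpace ℝ ι → ℝ) : EuclideanSpace ℝ ι → ℝ :=
  Set.indicator {z | 0 < g z} fun _ => (1 : ℝ)

variable {c cx cy C Cx Cy Cd v vx vy : ℝ} {p : ℝ≥0∞}

lemma abs_infoDensity_le (hc : 0 < c) (hcx : 0 < cx) (hcy : 0 < cy)
    {z : EuclideanSpace ℝ (Fin dx ⊕ Fin dy)} (hz : c ≤ f z ∧ f z ≤ C)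
    (hzx : cx ≤ marginalX f (projX z) ∧ marginalX f (projX z) ≤ Cx)
    (hzy : cy ≤ marginalY f (projY z) ∧ marginalY f (projY z) ≤ Cy) :
    |infoDensity f z| ≤ (|Real.log c| + |Real.log C|) + (|Real.log cx| + |Real.log Cx|)
      + (|Real.log cy| + |Real.log Cy|) := by
  have h1 := abs_log_le_of_mem hc hz.1 hz.2
  have h2 := abs_log_le_of_mem hcx hzx.1 hzx.2
  have h3 := abs_log_le_of_mem hcy hzy.1 hzy.2
  unfold infoDensity
  have h4 := abs_sub (Real.log (f z) - Real.log (marginalX f (projX z)))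
    (Real.log (marginalY f (projY z)))
  have h5 := abs_sub (Real.log (f z)) (Real.log (marginalX f (projX z)))
  linarith

/-- The conditional mean of the local estimate, given the sample point `z`. -/
noncomputable def meanLocalEst (f : EuclideanSpace ℝ (Fin dx ⊕ Fin dy) → ℝ) (p : ℝ≥0∞) (φ : ℕ → ℝ)
    (c a : ℝ) (k n : ℕ) (z : EuclideanSpace ℝ (Fin dx ⊕ Fin dy)) : ℝ :=
  ∫ w, localEst φ c a k (fun u => lpDist p u z) (fun u => lpDist p (projX u) (projX z))
      (fun u => lpDist p (projY u) (projY z)) w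
    ∂(Measure.pi fun _ : Fin n => volume.withDensity fun z => ENNReal.ofReal (f z))

theorem exists_abs_meanLocalEst_sub_le (hdx : dx ≠ 0) (hdy : dy ≠ 0)
    (hf : PiecewiseSmooth f c C Cd) (hfx : PiecewiseSmooth (marginalX f) cx Cx Cd)
    (hfy : PiecewiseSmooth (marginalY f) cy Cy Cd)
    [IsProbabilityMeasure (volume.withDensity fun z => ENNReal.ofReal (f z))]
    (hp : p = 2 ∨ p = ∞)
    (hb : IsBallDist (Fin dx ⊕ Fin dy) p v) (hbx : IsBallDist (Fin dx) p vx)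
    (hby : IsBallDist (Fin dy) p vy) {k : ℕ} (hk : 2 ≤ k) {δ : ℝ} (hδ : 0 < δ) {φ : ℕ → ℝ}
    (hφ : ∀ c, 1 ≤ c → |φ c - Real.log c| ≤ 1 / c) {ψ : ℝ}
    (hψ : ∀ n N : ℕ, n + 1 = N → k ≤ n →
      |ψ + ∑ j ∈ Finset.range (n - k + 1), 1 / ((k : ℝ) + j) - Real.log N| ≤ 2 / N) :
    ∃ K : ℝ, 0 < K ∧ ∀ᶠ N : ℕ in atTop, ∀ n : ℕ, n + 1 = N →
      ∀ z : EuclideanSpace ℝ (Fin dx ⊕ Fin dy), c ≤ f z ∧ f z ≤ C →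
      cx ≤ marginalX f (projX z) ∧ marginalX f (projX z) ≤ Cx →
      cy ≤ marginalY f (projY z) ∧ marginalY f (projY z) ≤ Cy →
      oscMax f (threshold (dx + dy) δ N) z ≠ ∞ →
      oscMax (marginalX f) (threshold (dx + dy) δ N) (projX z) ≠ ∞ →
      oscMax (marginalY f) (threshold (dx + dy) δ N) (projY z) ≠ ∞ →
      4 ^ (dx + dy) * oscMax (supp f) (threshold (dx + dy) δ N) z ≤ ENNReal.ofReal (v / 2) →
      4 ^ dx * oscMax (supp (marginalX f)) (threshold (dx + dy) δ N) (projX z)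
        ≤ ENNReal.ofReal (vx / 2) →
      4 ^ dy * oscMax (supp (marginalY f)) (threshold (dx + dy) δ N) (projY z)
        ≤ ENNReal.ofReal (vy / 2) →
      |meanLocalEst f p φ (ψ + Real.log N + Real.log (vx * vy / v)) (threshold (dx + dy) δ N) k n z
          - infoDensity f z|
        ≤ K * ((oscMax f (threshold (dx + dy) δ N) z).toReal
          + (oscMax (marginalX f) (threshold (dx + dy) δ N) (projX z)).toReal
          + (oscMax (marginalY f) (threshold (dx + dy) δ N) (projY z)).toReal
          + threshold (dx + dy) δ N) := by
  have hd : dx + dy ≠ 0 := by omega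
  have hc := hf.pos
  have hcx := hfx.pos
  have hcy := hfy.pos
  have hv := hb.pos
  have hvx := hbx.pos
  have hvy := hby.pos
  have hmap := map_projX hf.measurable hf.nonneg hf.integrable
  have hmapy := map_projY hf.measurable hf.nonneg hf.integrable
  set T := (|Real.log c| + |Real.log C|) + (|Real.log cx| + |Real.log Cx|)
      + (|Real.log cy| + |Real.log Cy|) with hT
  -- The joint mass is at most C v r^d and the marginal mass at least cx vx r^dx / 2. Their ratio is
  -- a constant times r^dy ≤ a, because dy ≥ 1 and r ≤ a ≤ 1; likewise with the roles exchanged.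
  set H := 2 * |C| * v / (cx * vx) + 2 * |C| * v / (cy * vy) with hH
  have hH0 : 0 ≤ H := by positivity
  set K₀ := (Real.exp k * (|ψ| + T + 2) + 2 + 4 * k) + (4 + 16 * (k + 1)) * H with hK₀
  have hK₀0 : 0 < K₀ := by positivity
  set K₁ := 2 * 4 ^ (dx + dy) / (c * v) with hK₁
  set K₂ := 2 * 4 ^ dx / (cx * vx) with hK₂
  set K₃ := 2 * 4 ^ dy / (cy * vy) with hK₃
  refine ⟨K₀ + K₁ + K₂ + K₃, by positivity, ?_⟩
  filter_upwards [eventually_threshold hd hδ (show 0 < c * v / 2 by positivity) H,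
    eventually_ge_atTop (2 * k)] with N ⟨ha, ha1, hHa, haN, hlog, htail⟩ hkN n hn z hz hzx hzy hM hMx
    hMy hA hAx hAy
  set a := threshold (dx + dy) δ N with ha_def
  have hfz : 0 < f z := hc.trans_le hz.1
  have hC : 0 < C := hfz.trans_le hz.2
  have hgx : 0 < marginalX f (projX z) := hcx.trans_le hzx.1
  have hgy : 0 < marginalY f (projY z) := hcy.trans_le hzy.1
  set μ := (volume.withDensity fun z => ENNReal.ofReal (f z)) with hμ
  set D : EuclideanSpace ℝ (Fin dx ⊕ Fin dy) → ℝ := fun u => lpDist p u z with hD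
  set Dx : EuclideanSpace ℝ (Fin dx ⊕ Fin dy) → ℝ :=
    fun u => lpDist p (projX u) (projX z) with hDx
  set Dy : EuclideanSpace ℝ (Fin dx ⊕ Fin dy) → ℝ :=
    fun u => lpDist p (projY u) (projY z) with hDy
  have hDm : Measurable D := hb.measurable_left z
  have hDxm : Measurable Dx := (hbx.measurable_left (projX z)).comp measurable_projX
  have hDym : Measurable Dy := (hby.measurable_left (projY z)).comp measurable_projY
  have hF : ∀ r, 0 < r → r ≤ a → c * v / 2 * r ^ (dx + dy) ≤ distFun μ D r ∧
      distFun μ D r ≤ C * v * r ^ (dx + dy) ∧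
      |Real.log (distFun μ D r) - Real.log (v * f z * r ^ (dx + dy))|
        ≤ K₁ * (oscMax f a z).toReal := by
    intro r hr hra
    have := hf.distFun_bounds hb hr hra hz.1 hM (by simpa [supp] using hA)
    simpa [Fintype.card_sum] using this
  have hFx : ∀ r, 0 < r → r ≤ a → cx * vx / 2 * r ^ dx ≤ distFun μ Dx r ∧
      |Real.log (distFun μ Dx r) - Real.log (vx * marginalX f (projX z) * r ^ dx)|
        ≤ K₂ * (oscMax (marginalX f) a (projX z)).toReal := by
    intro r hr hra
    have h := hfx.distFun_bounds hbx hr hra hzx.1 hMx (by simpa [supp] using hAx)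
    rw [← hmap, ← distFun_comp measurable_projX (hbx.measurable_left (projX z)),
      Fintype.card_fin] at h
    exact ⟨h.1, h.2.2⟩
  have hFy : ∀ r, 0 < r → r ≤ a → cy * vy / 2 * r ^ dy ≤ distFun μ Dy r ∧
      |Real.log (distFun μ Dy r) - Real.log (vy * marginalY f (projY z) * r ^ dy)|
        ≤ K₃ * (oscMax (marginalY f) a (projY z)).toReal := by
    intro r hr hra
    have h := hfy.distFun_bounds hby hr hra hzy.1 hMy (by simpa [supp] using hAy)
    rw [← hmapy, ← distFun_comp measurable_projY (hby.measurable_left (projY z)),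
      Fintype.card_fin] at h
    exact ⟨h.1, h.2.2⟩
  have hatom : ∀ r, μ {u | D u = r} = 0 := by
    have : Nonempty (Fin dx ⊕ Fin dy) := ⟨Sum.inl ⟨0, Nat.pos_of_ne_zero hdx⟩⟩
    exact fun r => withDensity_absolutelyContinuous _ _ (hb.volume_eq_zero z r)
  have hpos : ∀ r, 0 < r → r ≤ a → 0 < distFun μ D r := fun r hr hra =>
    lt_of_lt_of_le (by positivity) (hF r hr hra).1
  have hratio : ∀ {e e' : ℕ} {A r G : ℝ}, e' ≠ 0 → e + e' = dx + dy → 0 < A →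
      2 * |C| * v / A ≤ H → 0 < r → r ≤ a → A / 2 * r ^ e ≤ G → distFun μ D r ≤ H * a * G := by
    intro e e' A r G he' hee hA hAH hr hra hG
    have h1 := (hF r hr hra).2.1
    have h2 : r ^ e' ≤ a := (pow_le_of_le_one hr.le (hra.trans ha1) he').trans hra
    rw [← hee, pow_add] at h1
    rw [abs_of_pos hC] at hAH
    calc distFun μ D r ≤ C * v * (r ^ e * r ^ e') := h1
      _ = 2 * C * v / A * r ^ e' * (A / 2 * r ^ e) := by field_simp
      _ ≤ H * a * G := by gcongr
  have hrx : ∀ r, 0 < r → r ≤ a → distFun μ D r ≤ H * a * distFun μ Dx r := fun r hr hra =>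
    hratio hdy rfl (mul_pos hcx hvx) (le_add_of_nonneg_right (by positivity)) hr hra (hFx r hr hra).1
  have hry : ∀ r, 0 < r → r ≤ a → distFun μ D r ≤ H * a * distFun μ Dy r := fun r hr hra =>
    hratio hdx (add_comm _ _) (mul_pos hcy hvy) (le_add_of_nonneg_left (by positivity)) hr hra
      (hFy r hr hra).1
  have hN0 : (0 : ℝ) < N := by
    have : 0 < N := by omega
    exact_mod_cast this
  have hnN : (n : ℝ) + 1 = N := by exact_mod_cast hn
  have hNn : (N : ℝ) / 2 ≤ n := by
    have : (2 : ℝ) ≤ N := by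
      have : 2 ≤ N := by omega
      exact_mod_cast this
    linarith
  have hFa := (hF a ha le_rfl).1
  -- The multiples of log r cancel between the three masses, leaving the volume constant and the
  -- information density with errors given by the three oscillations.
  have hl : ∀ r, 0 < r → r ≤ a → |Real.log (distFun μ Dx r) + Real.log (distFun μ Dy r)
      - Real.log (distFun μ D r) - (Real.log (vx * vy / v) - infoDensity f z)|
      ≤ K₁ * (oscMax f a z).toReal + K₂ * (oscMax (marginalX f) a (projX z)).toReal
        + K₃ * (oscMax (marginalY f) a (projY z)).toReal := by
    intro r hr hra
    have h1 := abs_le.1 (hF r hr hra).2.2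
    have h2 := abs_le.1 (hFx r hr hra).2
    have h3 := abs_le.1 (hFy r hr hra).2
    have e1 : Real.log (v * f z * r ^ (dx + dy))
        = Real.log v + Real.log (f z) + (dx + dy) * Real.log r := by
      rw [Real.log_mul (by positivity) (by positivity), Real.log_mul hv.ne' hfz.ne', Real.log_pow]
      push_cast
      ring
    have e2 : Real.log (vx * marginalX f (projX z) * r ^ dx)
        = Real.log vx + Real.log (marginalX f (projX z)) + dx * Real.log r := by
      rw [Real.log_mul (by positivity) (by positivity), Real.log_mul hvx.ne' hgx.ne', Real.log_pow]
    have e3 : Real.log (vy * marginalY f (projY z) * r ^ dy)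
        = Real.log vy + Real.log (marginalY f (projY z)) + dy * Real.log r := by
      rw [Real.log_mul (by positivity) (by positivity), Real.log_mul hvy.ne' hgy.ne', Real.log_pow]
    rw [e1] at h1
    rw [e2] at h2
    rw [e3] at h3
    rw [Real.log_div (by positivity) hv.ne', Real.log_mul hvx.ne' hvy.ne', infoDensity, abs_le]
    constructor <;> linarith [h1.1, h1.2, h2.1, h2.2, h3.1, h3.2]
  have key := abs_integral_localEst_sub_le_of_tail (κ := Fin n) (μ := μ) hDm hDxm hDym
    (fun u => hb.nonneg u z) (fun u => lpDist_projX_le hp u z) (fun u => lpDist_projY_le hp u z)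
    hatom hk (by rw [Fintype.card_fin, hn]) hkN ha (by positivity) hHa hpos hrx hry hl hφ haN
    (by
      rw [Fintype.card_fin]
      have h1 : (N : ℝ) / 2 * (c * v / 2 * a ^ (dx + dy)) ≤ n * distFun μ D a :=
        mul_le_mul hNn hFa (by positivity) (by positivity)
      linarith)
    (by
      rw [div_le_iff₀ hN0]
      nlinarith)
    (by
      rw [Fintype.card_fin]
      exact hψ n N hn (by omega))
    (abs_infoDensity_le hc hcx hcy hz hzx hzy)
  have hest : ψ + Real.log N + (Real.log (vx * vy / v) - infoDensity f z) + infoDensity f z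
      = ψ + Real.log N + Real.log (vx * vy / v) := by ring
  rw [hest] at key
  refine key.trans ?_
  have m1 : 0 ≤ (oscMax f a z).toReal := ENNReal.toReal_nonneg
  have m2 : 0 ≤ (oscMax (marginalX f) a (projX z)).toReal := ENNReal.toReal_nonneg
  have m3 : 0 ≤ (oscMax (marginalY f) a (projY z)).toReal := ENNReal.toReal_nonneg
  have p1 : 0 < K₁ := by positivity
  have p2 : 0 < K₂ := by positivity
  have p3 : 0 < K₃ := by positivity
  generalize (oscMax f a z).toReal = t1 at *
  generalize (oscMax (marginalX f) a (projX z)).toReal = t2 at *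
  generalize (oscMax (marginalY f) a (projY z)).toReal = t3 at *
  have q1 : K₁ * t1 ≤ (K₀ + K₁ + K₂ + K₃) * t1 := by gcongr; linarith
  have q2 : K₂ * t2 ≤ (K₀ + K₁ + K₂ + K₃) * t2 := by gcongr; linarith
  have q3 : K₃ * t3 ≤ (K₀ + K₁ + K₂ + K₃) * t3 := by gcongr; linarith
  have q0 : K₀ * a ≤ (K₀ + K₁ + K₂ + K₃) * a := by gcongr; linarith
  have q4 : (Real.exp k * (|ψ| + T + 2) + 2 + 4 * k) * a + (4 + 16 * (k + 1)) * (H * a)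
    = K₀ * a := by rw [hK₀]; ring
  linarith

end Pointwise

/-! ### Expected oscillation under the density -/

section Oscillation

variable {ι : Type*} [Fintype ι] {g : EuclideanSpace ℝ ι → ℝ} {c C Cd : ℝ}

lemma PiecewiseSmooth.measurable_supp (hg : PiecewiseSmooth g c C Cd) : Measurable (supp g) :=
  measurable_const.indicator (measurableSet_lt measurable_const hg.measurable)

lemma PiecewiseSmooth.lintegral_withDensity_le (hg : PiecewiseSmooth g c C Cd)
    {h : EuclideanSpace ℝ ι → ℝ≥0∞} (hh : Measurable h) :
    ∫⁻ z, h z ∂(volume.withDensity fun z => ENNReal.ofReal (g z))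
      ≤ ENNReal.ofReal C * ∫⁻ z, h z := by
  rw [lintegral_withDensity_eq_lintegral_mul _ hg.measurable.ennreal_ofReal hh,
    ← lintegral_const_mul _ hh]
  refine lintegral_mono_ae ?_
  filter_upwards [hg.le] with z hz
  exact mul_le_mul_left (ENNReal.ofReal_le_ofReal hz) _

/-- The factor L has two origins. For g it is the logarithm lost in the Zygmund recursion; for the
support it is the crude size of the estimate, affordable because the indicator's modulus is free of
logarithms. -/
lemma PiecewiseSmooth.exists_lintegral_oscMax_le (hg : PiecewiseSmooth g c C Cd) :
    ∃ K : ℝ, 0 ≤ K ∧ ∀ a L : ℝ, 0 < a → a ≤ 1 → 1 ≤ L → Real.log (1 / a) ≤ L →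
      ∫⁻ z, oscMax g a z ∂(volume.withDensity fun z => ENNReal.ofReal (g z))
        ≤ ENNReal.ofReal (K * (a * L)) ∧
      ENNReal.ofReal L * ∫⁻ z, oscMax (supp g) a z
          ∂(volume.withDensity fun z => ENNReal.ofReal (g z))
        ≤ ENNReal.ofReal (K * (a * L)) := by
  obtain ⟨K, hK, h1⟩ := hg.exists_shiftBound
  obtain ⟨K', hK', h2⟩ := hg.exists_shiftBound_indicator
  set S := ∑' j : ℕ, ((j : ℝ) + 1) / 2 ^ j with hS
  have hS0 : 0 ≤ S := tsum_nonneg fun j => by positivity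
  refine ⟨|C| * (2 * K * S) + |C| * (K' * S), by positivity, fun a L ha ha1 hL haL => ⟨?_, ?_⟩⟩
  · have hlog : 0 ≤ Real.log (1 / a) := Real.log_nonneg (by rw [le_div_iff₀ ha]; linarith)
    have hB : 0 ≤ K * (a * (1 + Real.log (1 / a))) := by positivity
    refine (hg.lintegral_withDensity_le (measurable_oscMax hg.measurable a)).trans ?_
    refine (mul_le_mul_right (lintegral_oscMax_le hg.measurable ha hB (h1 a ha ha1)) _).trans ?_
    refine (mul_le_mul_left (ENNReal.ofReal_le_ofReal (le_abs_self C)) _).trans ?_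
    rw [← ENNReal.ofReal_mul (abs_nonneg C)]
    refine ENNReal.ofReal_le_ofReal ?_
    have h3 : K * (a * (1 + Real.log (1 / a))) ≤ K * (a * (2 * L)) := by gcongr; linarith
    calc |C| * (K * (a * (1 + Real.log (1 / a))) * S) ≤ |C| * (K * (a * (2 * L)) * S) := by gcongr
      _ = |C| * (2 * K * S) * (a * L) := by ring
      _ ≤ _ := by
        refine mul_le_mul_of_nonneg_right (le_add_of_nonneg_right (by positivity)) (by positivity)
  · have hB : 0 ≤ K' * a := by positivity
    have h3 := hg.lintegral_withDensity_le (measurable_oscMax hg.measurable_supp a)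
    have h4 := lintegral_oscMax_le hg.measurable_supp ha hB (h2 a ha)
    have h5 : ∫⁻ z, oscMax (supp g) a z ∂(volume.withDensity fun z => ENNReal.ofReal (g z))
        ≤ ENNReal.ofReal (|C| * (K' * a * S)) := by
      rw [ENNReal.ofReal_mul (abs_nonneg C)]
      exact h3.trans (mul_le_mul' (ENNReal.ofReal_le_ofReal (le_abs_self C)) h4)
    refine (mul_le_mul_right h5 _).trans ?_
    rw [← ENNReal.ofReal_mul (by linarith)]
    refine ENNReal.ofReal_le_ofReal ?_
    calc L * (|C| * (K' * a * S)) = |C| * (K' * S) * (a * L) := by ring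
      _ ≤ _ := by
        refine mul_le_mul_of_nonneg_right (le_add_of_nonneg_left (by positivity)) (by positivity)

end Oscillation

/-! ### Combining good and bad points -/

section Bias

variable {dx dy : ℕ} {f : EuclideanSpace ℝ (Fin dx ⊕ Fin dy) → ℝ}
  {c cx cy C Cx Cy Cd v vx vy : ℝ} {p : ℝ≥0∞}

lemma abs_meanLocalEst_le [IsProbabilityMeasure (volume.withDensity fun z => ENNReal.ofReal (f z))]
    (hp : p = 2 ∨ p = ∞) (hb : IsBallDist (Fin dx ⊕ Fin dy) p v) {k n N : ℕ} (hk : 1 ≤ k)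
    (hN : n + 1 = N) (hkN : k < N) {φ : ℕ → ℝ}
    (hφ : ∀ c, 1 ≤ c → |φ c - Real.log c| ≤ 1 / c) (c₀ a : ℝ)
    (z : EuclideanSpace ℝ (Fin dx ⊕ Fin dy)) :
    |meanLocalEst f p φ c₀ a k n z| ≤ |c₀| + 2 * (Real.log N + 1) := by
  have h := norm_integral_le_of_norm_le_const
    (μ := Measure.pi fun _ : Fin n => volume.withDensity fun z => ENNReal.ofReal (f z))
    (f := localEst φ c₀ a k (fun u => lpDist p u z) (fun u => lpDist p (projX u) (projX z))
      (fun u => lpDist p (projY u) (projY z)))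
    (ae_of_all _ fun w => abs_localEst_le (κ := Fin n) (fun u => hb.nonneg u z)
      (fun u => lpDist_projX_le hp u z) (fun u => lpDist_projY_le hp u z) hk
      (by rw [Fintype.card_fin, hN]) hkN hφ c₀ a w)
  simpa [meanLocalEst] using h

/-- Markov's inequality in pointwise form: where the support oscillates too much, 1 is bounded by a
multiple of that oscillation. -/
lemma one_le_of_lt_mul {A : ℝ≥0∞} {d : ℕ} (hv : 0 < v)
    (h : ENNReal.ofReal (v / 2) < 4 ^ d * A) : 1 ≤ ENNReal.ofReal (2 * 4 ^ d / v) * A := by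
  have h1 : ENNReal.ofReal (2 * 4 ^ d / v) = ENNReal.ofReal (2 / v) * 4 ^ d := by
    rw [mul_div_right_comm, ENNReal.ofReal_mul (by positivity), ENNReal.ofReal_pow (by norm_num)]
    norm_num
  have h2 : (1 : ℝ≥0∞) = ENNReal.ofReal (2 / v) * ENNReal.ofReal (v / 2) := by
    rw [← ENNReal.ofReal_mul (by positivity), ← ENNReal.ofReal_one]
    congr 1
    field_simp
  rw [h1, mul_assoc, h2]
  exact mul_le_mul_right h.le _

/-- This removes all smallness conditions on z. An infinite density oscillation makes the right side
infinite; large support oscillation is met by the crude bound K' log N; otherwise the bound for good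
points applies. -/
theorem exists_ofReal_abs_meanLocalEst_sub_le (hdx : dx ≠ 0) (hdy : dy ≠ 0)
    (hf : PiecewiseSmooth f c C Cd) (hfx : PiecewiseSmooth (marginalX f) cx Cx Cd)
    (hfy : PiecewiseSmooth (marginalY f) cy Cy Cd)
    [IsProbabilityMeasure (volume.withDensity fun z => ENNReal.ofReal (f z))]
    (hp : p = 2 ∨ p = ∞)
    (hb : IsBallDist (Fin dx ⊕ Fin dy) p v) (hbx : IsBallDist (Fin dx) p vx)
    (hby : IsBallDist (Fin dy) p vy) {k : ℕ} (hk : 2 ≤ k) {δ : ℝ} (hδ : 0 < δ) {φ : ℕ → ℝ}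
    (hφ : ∀ c, 1 ≤ c → |φ c - Real.log c| ≤ 1 / c) {ψ : ℝ}
    (hψ : ∀ n N : ℕ, n + 1 = N → k ≤ n →
      |ψ + ∑ j ∈ Finset.range (n - k + 1), 1 / ((k : ℝ) + j) - Real.log N| ≤ 2 / N) :
    ∃ K : ℝ, 0 < K ∧ ∀ᶠ N : ℕ in atTop, ∀ n : ℕ, n + 1 = N →
      ∀ z : EuclideanSpace ℝ (Fin dx ⊕ Fin dy), c ≤ f z ∧ f z ≤ C →
      cx ≤ marginalX f (projX z) ∧ marginalX f (projX z) ≤ Cx →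
      cy ≤ marginalY f (projY z) ∧ marginalY f (projY z) ≤ Cy →
      ENNReal.ofReal |meanLocalEst f p φ (ψ + Real.log N + Real.log (vx * vy / v))
          (threshold (dx + dy) δ N) k n z - infoDensity f z|
        ≤ ENNReal.ofReal K * ((oscMax f (threshold (dx + dy) δ N) z
          + oscMax (marginalX f) (threshold (dx + dy) δ N) (projX z)
          + oscMax (marginalY f) (threshold (dx + dy) δ N) (projY z))
          + ENNReal.ofReal (Real.log N) * (oscMax (supp f) (threshold (dx + dy) δ N) z
          + oscMax (supp (marginalX f)) (threshold (dx + dy) δ N) (projX z)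
          + oscMax (supp (marginalY f)) (threshold (dx + dy) δ N) (projY z))
          + ENNReal.ofReal (threshold (dx + dy) δ N)) := by
  have hd : dx + dy ≠ 0 := by omega
  have hv := hb.pos
  have hvx := hbx.pos
  have hvy := hby.pos
  obtain ⟨K, hK, hev⟩ := exists_abs_meanLocalEst_sub_le hdx hdy hf hfx hfy hp hb hbx hby hk hδ hφ hψ
  set T := (|Real.log c| + |Real.log C|) + (|Real.log cx| + |Real.log Cx|)
      + (|Real.log cy| + |Real.log Cy|) with hT
  set K' := |ψ| + |Real.log (vx * vy / v)| + 5 + T with hK'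
  have hT0 : 0 ≤ T := by positivity
  have hK'0 : 0 < K' := by positivity
  set Q := 2 * 4 ^ (dx + dy) / v + 2 * 4 ^ dx / vx + 2 * 4 ^ dy / vy with hQ
  have hQ0 : 0 < Q := by positivity
  refine ⟨K + K' * Q, by positivity, ?_⟩
  filter_upwards [hev, eventually_threshold hd hδ one_pos 0, eventually_gt_atTop k] with N hN
    ⟨ha, ha1, _, haN, hlog, _⟩ hkN n hn z hz hzx hzy
  set a := threshold (dx + dy) δ N with ha_def
  set M := oscMax f a z
  set Mx := oscMax (marginalX f) a (projX z)
  set My := oscMax (marginalY f) a (projY z)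
  set A := oscMax (supp f) a z
  set Ax := oscMax (supp (marginalX f)) a (projX z)
  set Ay := oscMax (supp (marginalY f)) a (projY z)
  have hKle : ENNReal.ofReal K ≤ ENNReal.ofReal (K + K' * Q) :=
    ENNReal.ofReal_le_ofReal (le_add_of_nonneg_right (by positivity))
  by_cases hM : M ≠ ∞ ∧ Mx ≠ ∞ ∧ My ≠ ∞
  swap
  · have hsum : M + Mx + My = ∞ := by
      simp only [ENNReal.add_eq_top]
      tauto
    have hne : ENNReal.ofReal (K + K' * Q) ≠ 0 := by
      rw [ne_eq, ENNReal.ofReal_eq_zero, not_le]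
      positivity
    rw [hsum, top_add, top_add, ENNReal.mul_top hne]
    exact le_top
  by_cases hA : 4 ^ (dx + dy) * A ≤ ENNReal.ofReal (v / 2) ∧ 4 ^ dx * Ax ≤ ENNReal.ofReal (vx / 2)
      ∧ 4 ^ dy * Ay ≤ ENNReal.ofReal (vy / 2)
  · refine (ENNReal.ofReal_le_ofReal (hN n hn z hz hzx hzy hM.1 hM.2.1 hM.2.2 hA.1 hA.2.1
      hA.2.2)).trans ?_
    rw [ENNReal.ofReal_mul hK.le, ENNReal.ofReal_add (by positivity) ha.le,
      ENNReal.ofReal_add (by positivity) (by positivity),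
      ENNReal.ofReal_add (by positivity) (by positivity), ENNReal.ofReal_toReal hM.1,
      ENNReal.ofReal_toReal hM.2.1, ENNReal.ofReal_toReal hM.2.2]
    exact mul_le_mul' hKle (add_le_add_left (le_add_of_nonneg_right zero_le) _)
  · have hone : 1 ≤ ENNReal.ofReal Q * (A + Ax + Ay) := by
      have hQ1 : ENNReal.ofReal (2 * 4 ^ (dx + dy) / v) ≤ ENNReal.ofReal Q :=
        ENNReal.ofReal_le_ofReal (by
          have : 0 < 2 * 4 ^ dx / vx := by positivity
          have : 0 < 2 * 4 ^ dy / vy := by positivity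
          linarith)
      have hQ2 : ENNReal.ofReal (2 * 4 ^ dx / vx) ≤ ENNReal.ofReal Q :=
        ENNReal.ofReal_le_ofReal (by
          have : 0 < 2 * 4 ^ (dx + dy) / v := by positivity
          have : 0 < 2 * 4 ^ dy / vy := by positivity
          linarith)
      have hQ3 : ENNReal.ofReal (2 * 4 ^ dy / vy) ≤ ENNReal.ofReal Q :=
        ENNReal.ofReal_le_ofReal (by
          have : 0 < 2 * 4 ^ (dx + dy) / v := by positivity
          have : 0 < 2 * 4 ^ dx / vx := by positivity
          linarith)
      simp only [not_and_or, not_le] at hA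
      rcases hA with h | h | h
      · exact (one_le_of_lt_mul hv h).trans (mul_le_mul' hQ1
          ((le_add_of_nonneg_right zero_le).trans (le_add_of_nonneg_right zero_le)))
      · exact (one_le_of_lt_mul hvx h).trans (mul_le_mul' hQ2
          ((le_add_of_nonneg_left zero_le).trans (le_add_of_nonneg_right zero_le)))
      · exact (one_le_of_lt_mul hvy h).trans (mul_le_mul' hQ3 (le_add_of_nonneg_left zero_le))
    have hcrude : |meanLocalEst f p φ (ψ + Real.log N + Real.log (vx * vy / v)) a k n z
        - infoDensity f z| ≤ K' * Real.log N := by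
      have h1 := abs_meanLocalEst_le (f := f) hp hb (by omega : 1 ≤ k) hn hkN hφ
        (ψ + Real.log N + Real.log (vx * vy / v)) a z
      have h2 := abs_infoDensity_le hf.pos hfx.pos hfy.pos hz hzx hzy
      have h3 := abs_sub (meanLocalEst f p φ (ψ + Real.log N + Real.log (vx * vy / v)) a k n z)
        (infoDensity f z)
      have h4 := abs_add_three ψ (Real.log N) (Real.log (vx * vy / v))
      rw [abs_of_nonneg (show 0 ≤ Real.log N by linarith)] at h4
      have h5 : (|ψ| + |Real.log (vx * vy / v)| + 2 + T) * 1
          ≤ (|ψ| + |Real.log (vx * vy / v)| + 2 + T) * Real.log N := by gcongr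
      rw [hK']
      linarith
    calc _ ≤ ENNReal.ofReal (K' * Real.log N) * 1 := by
          rw [mul_one]
          exact ENNReal.ofReal_le_ofReal hcrude
      _ ≤ ENNReal.ofReal (K' * Real.log N) * (ENNReal.ofReal Q * (A + Ax + Ay)) :=
          mul_le_mul_right hone _
      _ = ENNReal.ofReal (K' * Q) * (ENNReal.ofReal (Real.log N) * (A + Ax + Ay)) := by
          rw [ENNReal.ofReal_mul hK'0.le, ENNReal.ofReal_mul hK'0.le]
          ring
      _ ≤ _ := by
          refine mul_le_mul' (ENNReal.ofReal_le_ofReal (le_add_of_nonneg_left hK.le)) ?_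
          exact (le_add_of_nonneg_left zero_le).trans (le_add_of_nonneg_right zero_le)

theorem exists_lintegral_abs_meanLocalEst_sub_le (hdx : dx ≠ 0) (hdy : dy ≠ 0)
    (hf : PiecewiseSmooth f c C Cd) (hfx : PiecewiseSmooth (marginalX f) cx Cx Cd)
    (hfy : PiecewiseSmooth (marginalY f) cy Cy Cd)
    [IsProbabilityMeasure (volume.withDensity fun z => ENNReal.ofReal (f z))]
    (hp : p = 2 ∨ p = ∞)
    (hb : IsBallDist (Fin dx ⊕ Fin dy) p v) (hbx : IsBallDist (Fin dx) p vx)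
    (hby : IsBallDist (Fin dy) p vy) {k : ℕ} (hk : 2 ≤ k) {δ : ℝ} (hδ : 0 < δ) {φ : ℕ → ℝ}
    (hφ : ∀ c, 1 ≤ c → |φ c - Real.log c| ≤ 1 / c) {ψ : ℝ}
    (hψ : ∀ n N : ℕ, n + 1 = N → k ≤ n →
      |ψ + ∑ j ∈ Finset.range (n - k + 1), 1 / ((k : ℝ) + j) - Real.log N| ≤ 2 / N) :
    ∃ K : ℝ, 0 < K ∧ ∀ᶠ N : ℕ in atTop, ∀ n : ℕ, n + 1 = N →
      ∫⁻ z, ENNReal.ofReal |meanLocalEst f p φ (ψ + Real.log N + Real.log (vx * vy / v))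
          (threshold (dx + dy) δ N) k n z - infoDensity f z|
          ∂(volume.withDensity fun z => ENNReal.ofReal (f z))
        ≤ ENNReal.ofReal (K * (threshold (dx + dy) δ N * Real.log N)) := by
  have hd : dx + dy ≠ 0 := by omega
  obtain ⟨K, hK, hev⟩ :=
    exists_ofReal_abs_meanLocalEst_sub_le hdx hdy hf hfx hfy hp hb hbx hby hk hδ hφ hψ
  obtain ⟨K₁, hK₁, h₁⟩ := hf.exists_lintegral_oscMax_le
  obtain ⟨K₂, hK₂, h₂⟩ := hfx.exists_lintegral_oscMax_le
  obtain ⟨K₃, hK₃, h₃⟩ := hfy.exists_lintegral_oscMax_le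
  refine ⟨K * (2 * K₁ + 2 * K₂ + 2 * K₃ + 1), by positivity, ?_⟩
  filter_upwards [hev, eventually_threshold hd hδ one_pos 0, eventually_gt_atTop 0] with N hN
    ⟨ha, ha1, _, haN, hlog, _⟩ hN0 n hn
  set a := threshold (dx + dy) δ N with ha_def
  have hN0' : (0 : ℝ) < N := by exact_mod_cast hN0
  have haL : Real.log (1 / a) ≤ Real.log N := by
    refine Real.log_le_log (by positivity) ?_
    rw [div_le_iff₀ ha]
    rwa [div_le_iff₀ hN0', mul_comm] at haN
  obtain ⟨m1, s1⟩ := h₁ a _ ha ha1 hlog haL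
  obtain ⟨m2, s2⟩ := h₂ a _ ha ha1 hlog haL
  obtain ⟨m3, s3⟩ := h₃ a _ ha ha1 hlog haL
  have hmapx := map_projX hf.measurable hf.nonneg hf.integrable
  have hmapy := map_projY hf.measurable hf.nonneg hf.integrable
  have oM := measurable_oscMax hf.measurable a
  have oMx := measurable_oscMax hfx.measurable a
  have oMy := measurable_oscMax hfy.measurable a
  have oA := measurable_oscMax hf.measurable_supp a
  have oAx := measurable_oscMax hfx.measurable_supp a
  have oAy := measurable_oscMax hfy.measurable_supp a
  rw [← hmapx, lintegral_map oMx measurable_projX] at m2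
  rw [← hmapx, lintegral_map oAx measurable_projX] at s2
  rw [← hmapy, lintegral_map oMy measurable_projY] at m3
  rw [← hmapy, lintegral_map oAy measurable_projY] at s3
  have aex : ∀ᵐ z ∂(volume.withDensity fun z => ENNReal.ofReal (f z)),
      cx ≤ marginalX f (projX z) ∧ marginalX f (projX z) ≤ Cx :=
    ae_of_ae_map measurable_projX.aemeasurable (by rw [hmapx]; exact hfx.ae_withDensity)
  have aey : ∀ᵐ z ∂(volume.withDensity fun z => ENNReal.ofReal (f z)),
      cy ≤ marginalY f (projY z) ∧ marginalY f (projY z) ≤ Cy :=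
    ae_of_ae_map measurable_projY.aemeasurable (by rw [hmapy]; exact hfy.ae_withDensity)
  have hle := lintegral_mono_ae (μ := volume.withDensity fun z => ENNReal.ofReal (f z)) (by
    filter_upwards [hf.ae_withDensity, aex, aey] with z h1 h2 h3 using hN n hn z h1 h2 h3)
  refine hle.trans ?_
  have pX := measurable_projX (dx := dx) (dy := dy)
  have pY := measurable_projY (dx := dx) (dy := dy)
  have oMx' := oMx.comp pX
  have oMy' := oMy.comp pY
  have oAx' := oAx.comp pX
  have oAy' := oAy.comp pY
  simp only [Function.comp_def] at oMx' oMy' oAx' oAy'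
  have oS : Measurable fun z => ENNReal.ofReal (Real.log N) * (oscMax (supp f) a z
      + oscMax (supp (marginalX f)) a (projX z) + oscMax (supp (marginalY f)) a (projY z)) := by
    fun_prop
  rw [lintegral_const_mul _ (by fun_prop), lintegral_add_right _ measurable_const,
    lintegral_add_right _ oS, lintegral_add_right _ oMy',
    lintegral_add_right _ oMx', lintegral_const_mul _ (by fun_prop), lintegral_add_right _ oAy',
    lintegral_add_right _ oAx', lintegral_const, measure_univ, mul_one,
    mul_add (ENNReal.ofReal (Real.log N)), mul_add (ENNReal.ofReal (Real.log N))]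
  have hlast : ENNReal.ofReal a ≤ ENNReal.ofReal (1 * (a * Real.log N)) :=
    ENNReal.ofReal_le_ofReal (by nlinarith)
  refine (mul_le_mul_right (add_le_add (add_le_add (add_le_add (add_le_add m1 m2) m3)
    (add_le_add (add_le_add s1 s2) s3)) hlast) _).trans ?_
  rw [← ENNReal.ofReal_add (by positivity) (by positivity),
    ← ENNReal.ofReal_add (by positivity) (by positivity),
    ← ENNReal.ofReal_add (by positivity) (by positivity),
    ← ENNReal.ofReal_add (by positivity) (by positivity), ← ENNReal.ofReal_mul hK.le]
  refine ENNReal.ofReal_le_ofReal (le_of_eq ?_)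
  ring

end Bias

/-! ### Digamma at integers -/

section Digamma

lemma digamma_natCast_add_one (n : ℕ) :
    digamma ((n : ℝ) + 1) = -Real.eulerMascheroniConstant + harmonic n := by
  rw [digamma, logDeriv_apply, Real.deriv_Gamma_nat, Real.Gamma_nat_eq_factorial]
  have : (n.factorial : ℝ) ≠ 0 := by positivity
  field_simp

lemma log_lt_digamma {n : ℕ} (hn : 1 ≤ n) : Real.log n < digamma ((n : ℝ) + 1) := by
  rw [digamma_natCast_add_one]
  have := Real.eulerMascheroniConstant_lt_eulerMascheroniSeq' n
  rw [Real.eulerMascheroniSeq', if_neg (by omega)] at this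
  linarith

lemma digamma_lt_log (n : ℕ) : digamma ((n : ℝ) + 1) < Real.log ((n : ℝ) + 1) := by
  rw [digamma_natCast_add_one]
  have := Real.eulerMascheroniSeq_lt_eulerMascheroniConstant n
  rw [Real.eulerMascheroniSeq] at this
  linarith

lemma log_add_one_sub_log_le {n : ℕ} (hn : 1 ≤ n) :
    Real.log ((n : ℝ) + 1) - Real.log n ≤ 1 / n := by
  have hn0 : (0 : ℝ) < n := by exact_mod_cast hn
  rw [← Real.log_div (by positivity) hn0.ne']
  refine (Real.log_le_sub_one_of_pos (by positivity)).trans (le_of_eq ?_)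
  field_simp
  ring

lemma abs_digamma_sub_log_le (n : ℕ) (hn : 1 ≤ n) :
    |digamma ((n : ℝ) + 1) - Real.log n| ≤ 1 / n := by
  have h1 := log_lt_digamma hn
  have h2 := digamma_lt_log n
  have h3 := log_add_one_sub_log_le hn
  rw [abs_of_pos (by linarith)]
  linarith

/-- The sum is -E log F(ρ), so this evaluates the Beta mean as ψ(k) - ψ(n + 1). With N = n + 1 the
estimator's log N differs from ψ(N) by O(1/N). -/
lemma digamma_add_sum {k n : ℕ} (hk : 1 ≤ k) (hkn : k ≤ n) :
    digamma k + ∑ j ∈ Finset.range (n - k + 1), 1 / ((k : ℝ) + j) = digamma ((n : ℝ) + 1) := by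
  obtain ⟨m, rfl⟩ := Nat.exists_eq_add_of_le hkn
  rw [Nat.add_sub_cancel_left]
  have hsucc : ∀ i : ℕ, digamma ((k + i : ℕ) : ℝ) + 1 / ((k : ℝ) + i)
      = digamma (((k + i : ℕ) : ℝ) + 1) := by
    intro i
    obtain ⟨q, hq⟩ : ∃ q, k + i = q + 1 := ⟨k + i - 1, by omega⟩
    have hc : (k : ℝ) + i = q + 1 := by exact_mod_cast hq
    rw [digamma_natCast_add_one, hq, hc, harmonic_succ, Nat.cast_add_one, digamma_natCast_add_one]
    push_cast
    rw [one_div]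
    ring
  induction m with
  | zero => simpa using hsucc 0
  | succ m ih =>
    rw [Finset.sum_range_succ, ← add_assoc, ih (by omega), ← hsucc (m + 1)]
    rw [← add_assoc k m 1, Nat.cast_add_one (k + m)]

lemma abs_digamma_add_sum_sub_log_le {k : ℕ} (hk : 1 ≤ k) (n N : ℕ) (hn : n + 1 = N) (hkn : k ≤ n) :
    |digamma k + ∑ j ∈ Finset.range (n - k + 1), 1 / ((k : ℝ) + j) - Real.log N| ≤ 2 / N := by
  have hn1 : 1 ≤ n := hk.trans hkn
  have hn1' : (1 : ℝ) ≤ n := by exact_mod_cast hn1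
  have h1 := log_lt_digamma hn1
  have h2 := digamma_lt_log n
  have h3 := log_add_one_sub_log_le hn1
  rw [digamma_add_sum hk hkn, ← hn, Nat.cast_add_one, abs_of_neg (by linarith)]
  have h4 : 1 / (n : ℝ) ≤ 2 / (n + 1) := by
    rw [div_le_div_iff₀ (by positivity) (by positivity)]
    linarith
  linarith

end Digamma

/-! ### From the sample to one point and its neighbours -/

section Sample

variable {dx dy : ℕ} {f : EuclideanSpace ℝ (Fin dx ⊕ Fin dy) → ℝ}
  {p : ℝ≥0∞} {v vx vy : ℝ}

/-- The local estimate at the `i`-th point of a sample. -/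
noncomputable def pointEst {N : ℕ} (p : ℝ≥0∞) (φ : ℕ → ℝ) (c a : ℝ) (k : ℕ)
    (w : Fin N → EuclideanSpace ℝ (Fin dx ⊕ Fin dy)) (i : Fin N) : ℝ :=
  if knnDist p k w i ≤ a then
    c - φ (neighborCount p (fun j => projX (w j)) i (knnDist p k w i))
      - φ (neighborCount p (fun j => projY (w j)) i (knnDist p k w i))
  else 0

/-- The local estimate at a point `q.1`, given the other points `q.2`. -/
noncomputable def splitEst (p : ℝ≥0∞) (φ : ℕ → ℝ) (c a : ℝ) (k n : ℕ)
    (q : EuclideanSpace ℝ (Fin dx ⊕ Fin dy) × (Fin n → EuclideanSpace ℝ (Fin dx ⊕ Fin dy))) : ℝ :=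
  localEst φ c a k (fun u => lpDist p u q.1) (fun u => lpDist p (projX u) (projX q.1))
    (fun u => lpDist p (projY u) (projY q.1)) q.2

lemma neighborCount_eq_countLE {ι : Type*} [Fintype ι] {n : ℕ}
    (w : Fin (n + 1) → EuclideanSpace ℝ ι) (i : Fin (n + 1)) (r : ℝ) :
    neighborCount p w i r = countLE (fun u => lpDist p u (w i)) (fun j => w (i.succAbove j)) r := by
  rw [neighborCount, countLE, Finset.card_filter, Finset.card_filter, Fin.sum_univ_succAbove _ i]
  simp [Fin.succAbove_ne]

lemma pointEst_eq_splitEst {n : ℕ} (φ : ℕ → ℝ) (c a : ℝ) (k : ℕ)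
    (w : Fin (n + 1) → EuclideanSpace ℝ (Fin dx ⊕ Fin dy)) (i : Fin (n + 1)) :
    pointEst p φ c a k w i = splitEst p φ c a k n
      (MeasurableEquiv.piFinSuccAbove (fun _ => EuclideanSpace ℝ (Fin dx ⊕ Fin dy)) i w) := by
  have hρ : knnDist p k w i
      = kthDist (fun u => lpDist p u (w i)) k (fun j => w (i.succAbove j)) := by
    simp only [knnDist, kthDist, neighborCount_eq_countLE]
  simp only [pointEst, hρ, neighborCount_eq_countLE]
  rfl

lemma measurable_kthDist_vector {n : ℕ} (k : ℕ) :
    Measurable fun w : Fin n → ℝ => kthDist (fun x : ℝ => |x|) k w := by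
  by_cases hkn : k ≤ Fintype.card (Fin n)
  · exact measurable_kthDist (by fun_prop) (fun x => abs_nonneg x) hkn
  · have : ∀ w : Fin n → ℝ, kthDist (fun x : ℝ => |x|) k w = 0 := by
      intro w
      have hempty : {r : ℝ | 0 ≤ r ∧ k ≤ countLE (fun x : ℝ => |x|) w r} = ∅ :=
        Set.eq_empty_of_forall_notMem fun r hr =>
          hkn (hr.2.trans (countLE_le_card w r))
      rw [kthDist, hempty, Real.sInf_empty]
    simp only [this]
    exact measurable_const

/-- Earlier measurability results fix the centre. Joint measurability follows because everything
depends on (z, w) only through vectors of distances, on which the counts are those of the real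
function x ↦ |x|. -/
lemma measurable_splitEst (hp : p = 2 ∨ p = ∞) (hb : IsBallDist (Fin dx ⊕ Fin dy) p v) (hbx : IsBallDist (Fin dx) p vx)
    (hby : IsBallDist (Fin dy) p vy) (φ : ℕ → ℝ) (c a : ℝ) (k n : ℕ) :
    Measurable (splitEst (dx := dx) (dy := dy) p φ c a k n) := by
  have hcount : ∀ {ι : Type} [Fintype ι]
      {π : EuclideanSpace ℝ (Fin dx ⊕ Fin dy) → EuclideanSpace ℝ ι}, Measurable π →
      Measurable fun q : EuclideanSpace ℝ (Fin dx ⊕ Fin dy) ×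
        (Fin n → EuclideanSpace ℝ (Fin dx ⊕ Fin dy)) => fun j => lpDist p (π (q.2 j)) (π q.1) := by
    intro ι _ π hπ
    exact measurable_pi_lambda _ fun j => measurable_lpDist hp
      (hπ.comp ((measurable_pi_apply j).comp measurable_snd)) (hπ.comp measurable_fst)
  have habs : ∀ {ι : Type} [Fintype ι] {u : ℝ}, IsBallDist ι p u →
      ∀ (π : EuclideanSpace ℝ (Fin dx ⊕ Fin dy) → EuclideanSpace ℝ ι)
      (z : EuclideanSpace ℝ (Fin dx ⊕ Fin dy))
      (w : Fin n → EuclideanSpace ℝ (Fin dx ⊕ Fin dy)) (r : ℝ),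
      countLE (fun u => lpDist p (π u) (π z)) w r
        = countLE (fun x : ℝ => |x|) (fun j => lpDist p (π (w j)) (π z)) r := by
    intro ι _ u hu π z w r
    simp only [countLE, abs_of_nonneg (hu.nonneg _ _)]
  have hρ : ∀ (z : EuclideanSpace ℝ (Fin dx ⊕ Fin dy))
      (w : Fin n → EuclideanSpace ℝ (Fin dx ⊕ Fin dy)),
      kthDist (fun u => lpDist p u z) k w
        = kthDist (fun x : ℝ => |x|) k (fun j => lpDist p (w j) z) := by
    intro z w
    simp only [kthDist]
    have := habs hb id z w
    simp only [id] at this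
    simp only [this]
  have hm := hcount measurable_id
  simp only [id] at hm
  have hρm := (measurable_kthDist_vector (n := n) k).comp hm
  have hcm : Measurable fun q : (Fin n → ℝ) × ℝ => countLE (fun x : ℝ => |x|) q.1 q.2 :=
    measurable_countLE (by fun_prop)
  have hx := hcm.comp ((hcount measurable_projX).prodMk hρm)
  have hy := hcm.comp ((hcount measurable_projY).prodMk hρm)
  have hφ : Measurable φ := measurable_from_nat
  unfold splitEst localEst
  simp only [hρ, habs hbx projX, habs hby projY]
  exact Measurable.ite (hρm measurableSet_Iic)
    ((measurable_const.sub (hφ.comp hx)).sub (hφ.comp hy)) measurable_const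

/-- The counts take only the values 0, …, n, so φ at a count is bounded by a finite sum. No relation
between k and n is needed, which gives integrability for every N. -/
lemma abs_splitEst_le (φ : ℕ → ℝ) (c a : ℝ) (k n : ℕ)
    (q : EuclideanSpace ℝ (Fin dx ⊕ Fin dy) × (Fin n → EuclideanSpace ℝ (Fin dx ⊕ Fin dy))) :
    |splitEst p φ c a k n q| ≤ |c| + 2 * ∑ m ∈ Finset.range (n + 1), |φ m| := by
  have hs : 0 ≤ ∑ m ∈ Finset.range (n + 1), |φ m| := Finset.sum_nonneg fun m _ => abs_nonneg _
  have h : ∀ (D : EuclideanSpace ℝ (Fin dx ⊕ Fin dy) → ℝ) (r : ℝ),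
      |φ (countLE D q.2 r)| ≤ ∑ m ∈ Finset.range (n + 1), |φ m| := by
    intro D r
    refine Finset.single_le_sum (f := fun m => |φ m|) (fun m _ => abs_nonneg _) ?_
    have := countLE_le_card (D := D) q.2 r
    rw [Fintype.card_fin] at this
    exact Finset.mem_range.2 (by omega)
  unfold splitEst localEst
  split_ifs
  · refine (abs_sub _ _).trans ?_
    refine (add_le_add (abs_sub _ _) le_rfl).trans ?_
    have h1 := h (fun u => lpDist p (projX u) (projX q.1)) (kthDist (fun u => lpDist p u q.1) k q.2)
    have h2 := h (fun u => lpDist p (projY u) (projY q.1)) (kthDist (fun u => lpDist p u q.1) k q.2)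
    linarith
  · rw [abs_zero]
    positivity

lemma integrable_splitEst [IsProbabilityMeasure (volume.withDensity fun z => ENNReal.ofReal (f z))]
    (hp : p = 2 ∨ p = ∞) (hb : IsBallDist (Fin dx ⊕ Fin dy) p v) (hbx : IsBallDist (Fin dx) p vx)
    (hby : IsBallDist (Fin dy) p vy) (φ : ℕ → ℝ) (c a : ℝ) (k n : ℕ) :
    Integrable (splitEst (dx := dx) (dy := dy) p φ c a k n)
      ((volume.withDensity fun z => ENNReal.ofReal (f z)).prod
        (Measure.pi fun _ : Fin n => volume.withDensity fun z => ENNReal.ofReal (f z))) :=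
  Integrable.of_bound (measurable_splitEst hp hb hbx hby φ c a k n).aestronglyMeasurable _
    (ae_of_all _ fun q => abs_splitEst_le φ c a k n q)

variable {Ω : Type*} [MeasurableSpace Ω] {P : Measure Ω} [IsProbabilityMeasure P]
  {Z : ℕ → Ω → EuclideanSpace ℝ (Fin dx ⊕ Fin dy)}

lemma integrable_pointEst (hp : p = 2 ∨ p = ∞) (hb : IsBallDist (Fin dx ⊕ Fin dy) p v)
    (hbx : IsBallDist (Fin dx) p vx) (hby : IsBallDist (Fin dy) p vy) (hZ : ∀ i, Measurable (Z i))
    (φ : ℕ → ℝ) (c a : ℝ) (k N : ℕ) (i : Fin N) :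
    Integrable (fun ω => pointEst p φ c a k (fun j : Fin N => Z j ω) i) P := by
  obtain ⟨n, rfl⟩ : ∃ n, N = n + 1 := ⟨N - 1, by have := i.pos; omega⟩
  simp only [pointEst_eq_splitEst]
  refine Integrable.of_bound (((measurable_splitEst hp hb hbx hby φ c a k n).comp
    ((MeasurableEquiv.measurable _).comp
      (measurable_pi_lambda _ fun j => hZ _))).aestronglyMeasurable) _
    (ae_of_all _ fun ω => abs_splitEst_le φ c a k n _)

/-- Separate the i-th point from the others in the product law; Fubini then conditions on it, and
the value does not depend on i. -/
lemma integral_pointEst [IsProbabilityMeasure (volume.withDensity fun z => ENNReal.ofReal (f z))]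
    (hp : p = 2 ∨ p = ∞) (hb : IsBallDist (Fin dx ⊕ Fin dy) p v)
    (hbx : IsBallDist (Fin dx) p vx) (hby : IsBallDist (Fin dy) p vy) (hZ : ∀ i, Measurable (Z i))
    (hindep : iIndepFun Z P)
    (hlaw : ∀ i, P.map (Z i) = volume.withDensity fun z => ENNReal.ofReal (f z))
    (φ : ℕ → ℝ) (c a : ℝ) (k n : ℕ) (i : Fin (n + 1)) :
    ∫ ω, pointEst p φ c a k (fun j : Fin (n + 1) => Z j ω) i ∂P
      = ∫ z, meanLocalEst f p φ c a k n z
          ∂(volume.withDensity fun z => ENNReal.ofReal (f z)) := by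
  set μ := volume.withDensity fun z => ENNReal.ofReal (f z) with hμ
  have hm : Measurable fun (ω : Ω) (j : Fin (n + 1)) => Z j ω := measurable_pi_lambda _ fun j => hZ _
  have hmap : P.map (fun (ω : Ω) (j : Fin (n + 1)) => Z j ω) = Measure.pi fun _ => μ := by
    have h1 := (iIndepFun_iff_map_fun_eq_pi_map (μ := P) (f := fun (j : Fin (n + 1)) => Z j)
      fun j => (hZ _).aemeasurable).1 (hindep.precomp Fin.val_injective)
    simpa only [hlaw] using h1
  have hmp := measurePreserving_piFinSuccAbove (fun _ : Fin (n + 1) => μ) i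
  have hs := measurable_splitEst hp hb hbx hby φ c a k n
  simp only [pointEst_eq_splitEst]
  have h2 := integral_map (μ := P) hm.aemeasurable
    (f := fun w => splitEst p φ c a k n
      (MeasurableEquiv.piFinSuccAbove (fun _ => EuclideanSpace ℝ (Fin dx ⊕ Fin dy)) i w))
    (hs.comp (MeasurableEquiv.measurable _)).aestronglyMeasurable
  rw [← h2, hmap, hmp.integral_comp' (g := splitEst p φ c a k n),
    integral_prod _ (integrable_splitEst hp hb hbx hby φ c a k n)]
  rfl

end Sample

/-! ### Mutual information as the mean information density -/

section Information

variable {dx dy : ℕ} {f : EuclideanSpace ℝ (Fin dx ⊕ Fin dy) → ℝ}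
  {c cx cy C Cx Cy Cd : ℝ}

lemma PiecewiseSmooth.integrable_log {ι : Type*} [Fintype ι] {g : EuclideanSpace ℝ ι → ℝ}
    (hg : PiecewiseSmooth g c C Cd)
    [IsFiniteMeasure (volume.withDensity fun z => ENNReal.ofReal (g z))] :
    Integrable (fun z => Real.log (g z)) (volume.withDensity fun z => ENNReal.ofReal (g z)) := by
  refine Integrable.of_bound (C := |Real.log c| + |Real.log C|)
    (Real.measurable_log.comp hg.measurable).aestronglyMeasurable ?_
  filter_upwards [hg.ae_withDensity] with z hz using abs_log_le_of_mem hg.pos hz.1 hz.2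

lemma PiecewiseSmooth.integral_log {ι : Type*} [Fintype ι] {g : EuclideanSpace ℝ ι → ℝ}
    (hg : PiecewiseSmooth g c C Cd) :
    ∫ z, Real.log (g z) ∂(volume.withDensity fun z => ENNReal.ofReal (g z))
      = -differentialEntropy g := by
  rw [integral_withDensity_eq_integral_toReal_smul hg.measurable.ennreal_ofReal
    (ae_of_all _ fun z => ENNReal.ofReal_lt_top), differentialEntropy, neg_neg]
  simp only [ENNReal.toReal_ofReal (hg.nonneg _), smul_eq_mul]

lemma integrable_infoDensity_and_integral_eq (hf : PiecewiseSmooth f c C Cd)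
    (hfx : PiecewiseSmooth (marginalX f) cx Cx Cd) (hfy : PiecewiseSmooth (marginalY f) cy Cy Cd)
    [IsProbabilityMeasure (volume.withDensity fun z => ENNReal.ofReal (f z))] :
    Integrable (infoDensity f) (volume.withDensity fun z => ENNReal.ofReal (f z)) ∧
    ∫ z, infoDensity f z ∂(volume.withDensity fun z => ENNReal.ofReal (f z))
      = mutualInformation f := by
  have hmapx := map_projX hf.measurable hf.nonneg hf.integrable
  have hmapy := map_projY hf.measurable hf.nonneg hf.integrable
  have hpx : IsFiniteMeasure (volume.withDensity fun x => ENNReal.ofReal (marginalX f x)) := by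
    rw [← hmapx]
    infer_instance
  have hpy : IsFiniteMeasure (volume.withDensity fun y => ENNReal.ofReal (marginalY f y)) := by
    rw [← hmapy]
    infer_instance
  have i1 := hf.integrable_log
  have i2 := hfx.integrable_log
  have i3 := hfy.integrable_log
  have e1 := hf.integral_log
  have e2 := hfx.integral_log
  have e3 := hfy.integral_log
  have m2 : Measurable fun u => Real.log (marginalX f u) :=
    Real.measurable_log.comp hfx.measurable
  have m3 : Measurable fun u => Real.log (marginalY f u) :=
    Real.measurable_log.comp hfy.measurable
  rw [← hmapx] at i2 e2
  rw [← hmapy] at i3 e3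
  have j2 := i2.comp_measurable measurable_projX
  have j3 := i3.comp_measurable measurable_projY
  rw [integral_map measurable_projX.aemeasurable m2.aestronglyMeasurable] at e2
  rw [integral_map measurable_projY.aemeasurable m3.aestronglyMeasurable] at e3
  refine ⟨(i1.sub j2).sub j3, ?_⟩
  have h1 := integral_sub (i1.sub j2) j3
  have h2 := integral_sub i1 j2
  simp only [Pi.sub_apply, Function.comp_apply] at h1 h2
  simp only [infoDensity]
  rw [h1, h2, e1, e2, e3, mutualInformation]
  ring

end Information

/-! ### The rate for a general local estimate -/

section Rate

variable {dx dy : ℕ} {f : EuclideanSpace ℝ (Fin dx ⊕ Fin dy) → ℝ}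
  {c cx cy C Cx Cy Cd v vx vy : ℝ} {p : ℝ≥0∞}
  {Ω : Type*} [MeasurableSpace Ω] {P : Measure Ω} [IsProbabilityMeasure P]
  {Z : ℕ → Ω → EuclideanSpace ℝ (Fin dx ⊕ Fin dy)}

/-- The bias is O(a_N log N), and log N ≤ (log N)^(1+δ) brings it to the stated form. -/
lemma threshold_mul_log_le {δ : ℝ} (hδ : 0 < δ) {N : ℕ} (hlog : 1 ≤ Real.log N) :
    threshold (dx + dy) δ N * Real.log N
      ≤ Real.log N ^ ((1 + δ) * (1 + 1 / ((dx : ℝ) + dy))) / (N : ℝ) ^ (1 / ((dx : ℝ) + dy)) := by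
  have h0 : 0 < Real.log N := by linarith
  have h1 : threshold (dx + dy) δ N
      = Real.log N ^ ((1 + δ) * (1 / ((dx : ℝ) + dy))) / (N : ℝ) ^ (1 / ((dx : ℝ) + dy)) := by
    rw [threshold, Real.div_rpow (by positivity) (by positivity), ← Real.rpow_mul h0.le,
      Nat.cast_add]
  have h2 : Real.log N ≤ Real.log N ^ (1 + δ) :=
    Real.self_le_rpow_of_one_le hlog (by linarith)
  have h3 : (1 + δ) * (1 + 1 / ((dx : ℝ) + dy)) = (1 + δ) * (1 / ((dx : ℝ) + dy)) + (1 + δ) := by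
    ring
  rw [h1, h3, Real.rpow_add h0, div_mul_eq_mul_div]
  gcongr

theorem isBigO_integral_pointEst_sub (hdx : dx ≠ 0) (hdy : dy ≠ 0)
    (hf : PiecewiseSmooth f c C Cd) (hfx : PiecewiseSmooth (marginalX f) cx Cx Cd)
    (hfy : PiecewiseSmooth (marginalY f) cy Cy Cd)
    [IsProbabilityMeasure (volume.withDensity fun z => ENNReal.ofReal (f z))]
    (hp : p = 2 ∨ p = ∞)
    (hb : IsBallDist (Fin dx ⊕ Fin dy) p v) (hbx : IsBallDist (Fin dx) p vx)
    (hby : IsBallDist (Fin dy) p vy) (hZ : ∀ i, Measurable (Z i)) (hindep : iIndepFun Z P)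
    (hlaw : ∀ i, P.map (Z i) = volume.withDensity fun z => ENNReal.ofReal (f z))
    {k : ℕ} (hk : 2 ≤ k) {δ : ℝ} (hδ : 0 < δ) {φ : ℕ → ℝ}
    (hφ : ∀ c, 1 ≤ c → |φ c - Real.log c| ≤ 1 / c) :
    (fun N : ℕ => (∫ ω, 1 / (N : ℝ) * ∑ i : Fin N,
        pointEst p φ (digamma k + Real.log N + Real.log (vx * vy / v)) (threshold (dx + dy) δ N) k
          (fun j : Fin N => Z j ω) i ∂P) - mutualInformation f) =O[atTop]
      (fun N : ℕ => Real.log N ^ ((1 + δ) * (1 + 1 / ((dx : ℝ) + dy)))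
          / (N : ℝ) ^ (1 / ((dx : ℝ) + dy))) := by
  have hd : dx + dy ≠ 0 := by omega
  obtain ⟨K, hK, hev⟩ := exists_lintegral_abs_meanLocalEst_sub_le hdx hdy hf hfx hfy hp hb hbx hby
    hk hδ hφ (abs_digamma_add_sum_sub_log_le (by omega))
  obtain ⟨hii, hI⟩ := integrable_infoDensity_and_integral_eq hf hfx hfy
  refine IsBigO.of_bound K ?_
  filter_upwards [hev, eventually_threshold hd hδ one_pos 0, eventually_gt_atTop 0] with N hN
    ⟨ha, _, _, _, hlog, _⟩ hN0
  obtain ⟨n, rfl⟩ : ∃ n, N = n + 1 := ⟨N - 1, by omega⟩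
  have hrate := threshold_mul_log_le (dx := dx) (dy := dy) hδ hlog
  have hle := hN n rfl
  set c₀ := digamma k + Real.log (n + 1 : ℕ) + Real.log (vx * vy / v) with hc₀
  set a := threshold (dx + dy) δ (n + 1) with ha_def
  have hmean : ∫ ω, 1 / ((n + 1 : ℕ) : ℝ) * ∑ i : Fin (n + 1),
      pointEst p φ c₀ a k (fun j : Fin (n + 1) => Z j ω) i ∂P
      = ∫ z, meanLocalEst f p φ c₀ a k n z
          ∂(volume.withDensity fun z => ENNReal.ofReal (f z)) := by
    rw [integral_const_mul, integral_finsetSum _ fun i _ =>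
      integrable_pointEst hp hb hbx hby hZ φ c₀ a k (n + 1) i]
    simp only [integral_pointEst hp hb hbx hby hZ hindep hlaw, Finset.sum_const, Finset.card_univ,
      Fintype.card_fin, nsmul_eq_mul]
    have : ((n + 1 : ℕ) : ℝ) ≠ 0 := by positivity
    field_simp
  have him : Integrable (meanLocalEst f p φ c₀ a k n)
      (volume.withDensity fun z => ENNReal.ofReal (f z)) :=
    (integrable_splitEst hp hb hbx hby φ c₀ a k n).integral_prod_left
  rw [hmean, ← hI, ← integral_sub him hii]
  have hrate0 : 0 ≤ a * Real.log (n + 1 : ℕ) := by positivity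
  refine (norm_integral_le_lintegral_norm _).trans ?_
  refine (ENNReal.toReal_mono ENNReal.ofReal_ne_top hle).trans ?_
  rw [ENNReal.toReal_ofReal (by positivity), Real.norm_of_nonneg (hrate0.trans hrate)]
  exact mul_le_mul_of_nonneg_left hrate hK.le

end Rate

/-! ### Specialisation to the two estimators -/

section Main

variable {dx dy : ℕ}

/-- In the maximum norm the unit balls have volume 2^d, so the volume correction is log 1 = 0, and
the KSG estimate shows no such term. -/
lemma pointEst_eq_localKSG {N : ℕ} (k : ℕ) (δ : ℝ) (x : Fin N → EuclideanSpace ℝ (Fin dx))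
    (y : Fin N → EuclideanSpace ℝ (Fin dy)) (i : Fin N) :
    pointEst ∞ (fun m => digamma ((m : ℝ) + 1)) (digamma k + Real.log N
        + Real.log (2 ^ dx * 2 ^ dy / 2 ^ (dx + dy))) (threshold (dx + dy) δ N) k
        (fun j => joint (x j) (y j)) i
      = localKSG k δ x y i := by
  rw [← pow_add, div_self (by positivity), Real.log_one, add_zero]
  rfl

lemma pointEst_eq_localBIKSG {N : ℕ} (k : ℕ) (δ : ℝ) (x : Fin N → EuclideanSpace ℝ (Fin dx))
    (y : Fin N → EuclideanSpace ℝ (Fin dy)) (i : Fin N) :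
    pointEst 2 (fun m => Real.log m) (digamma k + Real.log N
        + Real.log (unitBallVolume dx * unitBallVolume dy / unitBallVolume (dx + dy)))
        (threshold (dx + dy) δ N) k (fun j => joint (x j) (y j)) i
      = localBIKSG k δ x y i := rfl

/-- Of a positive number and its reciprocal one is at least 1, so k > 1. -/
lemma two_le_of_max_div_lt (hdx : 1 ≤ dx) (hdy : 1 ≤ dy) {k : ℕ}
    (hk : max ((dx : ℝ) / dy) ((dy : ℝ) / dx) < k) : 2 ≤ k := by
  have hx : (0 : ℝ) < dx := by exact_mod_cast hdx
  have hy : (0 : ℝ) < dy := by exact_mod_cast hdy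
  have h1 : (1 : ℝ) < k := by
    rcases le_total (dx : ℝ) dy with h | h
    · exact ((one_le_div hx).2 h).trans_lt ((le_max_right _ _).trans_lt hk)
    · exact ((one_le_div hy).2 h).trans_lt ((le_max_left _ _).trans_lt hk)
  exact_mod_cast h1

end Main

end KSG

theorem mainTheorem2 {dx dy : ℕ} (hdx : 1 ≤ dx) (hdy : 1 ≤ dy)
    (f : EuclideanSpace ℝ (Fin dx ⊕ Fin dy) → ℝ) (hf_meas : Measurable f) (hf_nonneg : ∀ z, 0 ≤ f z)
    (Ca Cb Cc Cd Ce Cf Cg Ch C0 : ℝ)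
    (hf : KSG.RateAssumption f Ca Cb Cc Cd Ce Cf Cg Ch C0)
    {Ω : Type*} [MeasurableSpace Ω] (P : Measure Ω) [IsProbabilityMeasure P]
    (X : ℕ → Ω → EuclideanSpace ℝ (Fin dx)) (Y : ℕ → Ω → EuclideanSpace ℝ (Fin dy))
    (hX : ∀ i, Measurable (X i)) (hY : ∀ i, Measurable (Y i))
    (hindep : iIndepFun (fun i ω => KSG.joint (X i ω) (Y i ω)) P)
    (hlaw : ∀ i, P.map (fun ω => KSG.joint (X i ω) (Y i ω)) =
      volume.withDensity (fun z => ENNReal.ofReal (f z)))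
    (k : ℕ) (hk : max ((dx : ℝ) / dy) ((dy : ℝ) / dx) < k)
    (δ : ℝ) (hδ : 0 < δ) :
    ((∀ N : ℕ, Integrable
        (fun ω => KSG.tKSG k δ (fun i : Fin N => X i ω) (fun i : Fin N => Y i ω)) P) ∧
      (fun N : ℕ =>
        (∫ ω, KSG.tKSG k δ (fun i : Fin N => X i ω) (fun i : Fin N => Y i ω) ∂P)
          - KSG.mutualInformation f) =O[atTop]
      (fun N : ℕ => Real.log N ^ ((1 + δ) * (1 + 1 / ((dx : ℝ) + dy)))
          / (N : ℝ) ^ (1 / ((dx : ℝ) + dy)))) ∧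
    ((∀ N : ℕ, Integrable
        (fun ω => KSG.tBIKSG k δ (fun i : Fin N => X i ω) (fun i : Fin N => Y i ω)) P) ∧
      (fun N : ℕ =>
        (∫ ω, KSG.tBIKSG k δ (fun i : Fin N => X i ω) (fun i : Fin N => Y i ω) ∂P)
          - KSG.mutualInformation f) =O[atTop]
      (fun N : ℕ => Real.log N ^ ((1 + δ) * (1 + 1 / ((dx : ℝ) + dy)))
          / (N : ℝ) ^ (1 / ((dx : ℝ) + dy)))) := by
  have hk2 := KSG.two_le_of_max_div_lt hdx hdy hk
  have hZ : ∀ i, Measurable fun ω => KSG.joint (X i ω) (Y i ω) := fun i =>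
    KSG.measurePreserving_joint.measurable.comp ((hX i).prodMk (hY i))
  have hprob : IsProbabilityMeasure (volume.withDensity fun z => ENNReal.ofReal (f z)) := by
    rw [← hlaw 0]
    exact Measure.isProbabilityMeasure_map (hZ 0).aemeasurable
  have h1 : ∫⁻ z, ENNReal.ofReal (f z) = 1 := by
    have := hprob.measure_univ
    rwa [withDensity_apply _ MeasurableSet.univ, Measure.restrict_univ] at this
  have hs := hf.piecewiseSmooth hf_meas hf_nonneg h1
  have hsx := hf.piecewiseSmooth_marginalX hf_meas hf_nonneg h1
  have hsy := hf.piecewiseSmooth_marginalY hf_meas hf_nonneg h1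
  have hnx : Nonempty (Fin dx) := ⟨⟨0, hdx⟩⟩
  have hny : Nonempty (Fin dy) := ⟨⟨0, hdy⟩⟩
  have bt := KSG.isBallDist_top (Fin dx ⊕ Fin dy)
  have btx := KSG.isBallDist_top (Fin dx)
  have bty := KSG.isBallDist_top (Fin dy)
  have b2 := KSG.isBallDist_two (Fin dx ⊕ Fin dy)
  have b2x := KSG.isBallDist_two (Fin dx)
  have b2y := KSG.isBallDist_two (Fin dy)
  simp only [Fintype.card_sum, Fintype.card_fin] at bt btx bty b2 b2x b2y
  refine ⟨⟨fun N => ?_, ?_⟩, fun N => ?_, ?_⟩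
  · simp only [KSG.tKSG, ← KSG.pointEst_eq_localKSG]
    exact (integrable_finsetSum _ fun i _ =>
      KSG.integrable_pointEst (Or.inr rfl) bt btx bty hZ _ _ _ _ _ i).const_mul _
  · simp only [KSG.tKSG, ← KSG.pointEst_eq_localKSG]
    exact KSG.isBigO_integral_pointEst_sub (by omega) (by omega) hs hsx hsy (Or.inr rfl) bt btx bty
      hZ hindep hlaw hk2 hδ KSG.abs_digamma_sub_log_le
  · simp only [KSG.tBIKSG, ← KSG.pointEst_eq_localBIKSG]
    exact (integrable_finsetSum _ fun i _ =>
      KSG.integrable_pointEst (Or.inl rfl) b2 b2x b2y hZ _ _ _ _ _ i).const_mul _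
  · simp only [KSG.tBIKSG, ← KSG.pointEst_eq_localBIKSG]
    exact KSG.isBigO_integral_pointEst_sub (by omega) (by omega) hs hsx hsy (Or.inl rfl) b2 b2x b2y
      hZ hindep hlaw hk2 hδ fun m _ => by rw [sub_self, abs_zero]; positivity
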